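/- Let $f=f(x_1,x_2,x_3)$ and consider the following four classes of second order PDEs over open sets $\Omega\subset\mathbb R^3$, where $\lambda_i=\lambda_i(x_i)$ are real $C^\infty$ functions of one variable and $\Lambda(z)=a(x_1,x_2)+i\,b(x_1,x_2)$ is holomorphic in $z=x_1+ix_2$: (A) $(\lambda_2-\lambda_3)f_{x_1}f_{x_2x_3}+(\lambda_3-\lambda_1)f_{x_2}f_{x_3x_1}+(\lambda_1-\lambda_2)f_{x_3}f_{x_1x_2}=0$, with $\lambda_1(x_1),\lambda_2(x_2),\lambda_3(x_3)$ pairwise different on $\Omega$; (B) $f_{x_1}f_{x_1x_3}-f_{x_3}f_{x_1x_1}+(\lambda_2-\lambda_3)(f_{x_1}f_{x_2x_3}-f_{x_2}f_{x_1x_3})+\lambda_2'f_{x_1}f_{x_3}=0$, with $\lambda_2(x_2)\ne\lambda_3(x_3)$ on $\Omega$; (C) $f_{x_1}f_{x_1x_3}-f_{x_3}f_{x_1x_1}+e^{-\lambda_3'x_2}(f_{x_2}f_{x_1x_2}-f_{x_1}f_{x_2x_2})+\lambda_3''x_2f_{x_1}^2=0$; (D) $a(f_{x_1}f_{x_2x_3}-f_{x_2}f_{x_1x_3})+b(f_{x_3}f_{x_1x_1}+f_{x_3}f_{x_2x_2}-f_{x_1}f_{x_1x_3}-f_{x_2}f_{x_2x_3})+\lambda_3(f_{x_2}f_{x_1x_3}-f_{x_1}f_{x_2x_3})=0$,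 with $b\neq0$ on $\Omega$. The equivalence pseudogroup $\mathcal G_X$ of class $X$ consists of the (prolongations to 1-jets of the) local diffeomorphisms $(x,f)\mapsto(\varphi(x),F(f))$, where $\varphi$ has the form - for A: $(X_1(x_1),X_2(x_2),X_3(x_3))$; - for B: $(X_2'(x_2)x_1+X_1(x_2),\,X_2(x_2),\,X_3(x_3))$; - for C (applied to the equation with parameter $\lambda_3$): $\Bigl(X_3'e^{\lambda_3'X_2/X_3'}x_1+\int_0^{x_2}(X_3''s+X_2')e^{\lambda_3'(s+X_2/X_3')}ds+X_1,\;X_3'x_2+X_2,\;X_3\Bigr)$ with $X_1,X_2,X_3,\lambda_3'$ evaluated at $x_3$; - for D: $(\operatorname{Re}Z(z),\operatorname{Im}Z(z),X_3(x_3))$ with $Z$ holomorphic. Two equations of class $X$ near points $x$ and $y$ are called $\mathcal G_X$-equivalent if some element of $\mathcal G_X$ defined near $x$ sends $x$ to $y$ and the first equation to the second. Theorem. 1. If $X\neq Y$ are two of the classes A, B, C, D, then no equation of class $X$ is contact equivalent to an equation of class $Y$: no contact transformation between nonempty open subsets of the space of 1-jets, over the domains of the two equations, carries one equation to the other. 2.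 For every class $X$ the quotient by $\mathcal G_X$ has no functional parameters, in the following sense. Let an equation of class $X$ over $\Omega$ be given. (a) Near every point of $\Omega$ at which each of its parameters $\lambda_i$ either is locally constant or has some nonvanishing derivative of positive order, it is $\mathcal G_X$-equivalent to an equation of class $X$ near the origin with each $\lambda_i$ of the form $c_i$ or $c_i\pm x_i^{k_i}$ and, in class D, $\Lambda$ of the form $c$ or $c+z^k$ ($k_i,k\ge1$). (b) There is an open dense subset of $\Omega$ near every point of which it is $\mathcal G_X$-equivalent to an equation of class $X$ near some point, with each $\lambda_i(x_i)$ equal to $x_i$ or to a constant and, in class D, $\Lambda(z)$ equal to $z$ or to a constant. 3. On the generic stratum, i.e. near every point of $\Omega$ at which the derivatives of all parameters ($\lambda_i'$ and, in class D, $\Lambda'$) are nonzero, an equation of class $X$ is $\mathcal G_X$-equivalent to the equation $X_0$ near some point, where $A_0,B_0,C_0,D_0$ are the equations of the respective classes with $\lambda_i(x_i)=x_i$ and $\Lambda(z)=z$. -/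

import Mathlib

open scoped ContDiff

noncomputable section

/-! ### First and second jets of functions of three variables; contact transformations -/

/-- The independent variables `(x₁, x₂, x₃)`, stored with indices `0, 1, 2`. -/
abbrev R3 : Type := Fin 3 → ℝ

/-- The space `J¹(ℝ³)` of 1-jets `(x, u, p)` of functions `u = f(x)`, with `pᵢ = f_{xᵢ}`. -/
abbrev Jet1 : Type := R3 × ℝ × R3

/-- The contact form `du - ∑ pᵢ dxᵢ` at the 1-jet `θ`, evaluated on the tangent vector `v`. -/
def contactForm (θ v : Jet1) : ℝ := v.2.1 - ∑ i, θ.2.2 i * v.1 i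

/-- A smooth contact transformation defined on the set `U` of 1-jets: a diffeomorphism of `U` onto
its image which multiplies the contact form by a nonvanishing factor. -/
structure IsContactTransformation (Φ : Jet1 → Jet1) (U : Set Jet1) : Prop where
  isOpen : IsOpen U
  contDiffOn : ContDiffOn ℝ ∞ Φ U
  injOn : Set.InjOn Φ U
  bijective_fderiv : ∀ θ ∈ U, Function.Bijective (fderiv ℝ Φ θ)
  contact : ∀ θ ∈ U, ∃ ρ : ℝ, ρ ≠ 0 ∧
    ∀ v : Jet1, contactForm (Φ θ) (fderiv ℝ Φ θ v) = ρ * contactForm θ v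

/-- The lift `v ↦ (v, p·v, h v)` determined by the 2-jet `(θ, h)`, where `h` is the Hessian. -/
def jetLift (θ : Jet1) (h : Matrix (Fin 3) (Fin 3) ℝ) : R3 →ₗ[ℝ] Jet1 where
  toFun v := (v, ∑ i, θ.2.2 i * v i, h.mulVec v)
  map_add' v w := by
    simp [Matrix.mulVec_add, mul_add, Finset.sum_add_distrib]
  map_smul' c v := by
    simp [Matrix.mulVec_smul, Finset.mul_sum, mul_left_comm]

/-- The 3-plane in `T_θ J¹` determined by the 2-jet `(θ, h)`: the tangent space of the graph
`x ↦ (x, f(x), df(x))` of any function `f` having this 2-jet. -/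
def jetPlane (θ : Jet1) (h : Matrix (Fin 3) (Fin 3) ℝ) : Submodule ℝ Jet1 :=
  LinearMap.range (jetLift θ h)

/-- The left-hand side of a second order scalar equation `E(x, f, df, D²f) = 0`. -/
abbrev PDE2 : Type := Jet1 → Matrix (Fin 3) (Fin 3) ℝ → ℝ

/-- The prolongation of `Φ` to 2-jets over `U` identifies the equations `E = 0` and `E' = 0`:
whenever the differential of `Φ` carries the plane of a 2-jet to the plane of a 2-jet,
the first 2-jet lies on the first equation iff the second lies on the second equation. -/
def MapsEquation (Φ : Jet1 → Jet1) (U : Set Jet1) (E E' : PDE2) : Prop :=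
  ∀ θ ∈ U, ∀ h h' : Matrix (Fin 3) (Fin 3) ℝ, h.IsSymm → h'.IsSymm →
    (jetPlane θ h).map (fderiv ℝ Φ θ : Jet1 →ₗ[ℝ] Jet1) = jetPlane (Φ θ) h' →
    (E θ h = 0 ↔ E' (Φ θ) h' = 0)

/-- The equation `E = 0` over `Ω` and the equation `E' = 0` over `Ω'` are somewhere locally
equivalent: some contact transformation between nonempty open sets of 1-jets over `Ω` and over `Ω'`
identifies them. -/
def ContactEquivalent (Ω : Set R3) (E : PDE2) (Ω' : Set R3) (E' : PDE2) : Prop :=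
  ∃ (U : Set Jet1) (Φ : Jet1 → Jet1), U.Nonempty ∧ IsContactTransformation Φ U ∧
    (∀ θ ∈ U, θ.1 ∈ Ω) ∧ (∀ θ ∈ U, (Φ θ).1 ∈ Ω') ∧ MapsEquation Φ U E E'

/-! ### The four classes of equations -/

/-- The labels of the four classes. -/
inductive WebClass : Type
  | A
  | B
  | C
  | D

/-- The complex coordinate `z = x₁ + i x₂`. -/
def zCoord (x : R3) : ℂ := ⟨x 0, x 1⟩

/-- The functional parameters: `(λ₁, λ₂, λ₃)` for class A, `(λ₂, λ₃)` for class B, `λ₃` for class C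
and `(Λ, λ₃)` with `Λ = a + i b` for class D. -/
def WebParam : WebClass → Type
  | .A => (ℝ → ℝ) × (ℝ → ℝ) × (ℝ → ℝ)
  | .B => (ℝ → ℝ) × (ℝ → ℝ)
  | .C => ℝ → ℝ
  | .D => (ℂ → ℂ) × (ℝ → ℝ)

/-- The left-hand side of the equation of the given class with the given parameters. -/
def webPDE : (X : WebClass) → WebParam X → PDE2
  | .A, (l₁, l₂, l₃), (x, _, p), h =>
      (l₂ (x 1) - l₃ (x 2)) * p 0 * h 1 2 + (l₃ (x 2) - l₁ (x 0)) * p 1 * h 2 0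
        + (l₁ (x 0) - l₂ (x 1)) * p 2 * h 0 1
  | .B, (l₂, l₃), (x, _, p), h =>
      p 0 * h 0 2 - p 2 * h 0 0 + (l₂ (x 1) - l₃ (x 2)) * (p 0 * h 1 2 - p 1 * h 0 2)
        + deriv l₂ (x 1) * p 0 * p 2
  | .C, l₃, (x, _, p), h =>
      p 0 * h 0 2 - p 2 * h 0 0
        + Real.exp (-(deriv l₃ (x 2) * x 1)) * (p 1 * h 0 1 - p 0 * h 1 1)
        + deriv (deriv l₃) (x 2) * x 1 * p 0 ^ 2
  | .D, (L, l₃), (x, _, p), h =>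
      (L (zCoord x)).re * (p 0 * h 1 2 - p 1 * h 0 2)
        + (L (zCoord x)).im * (p 2 * h 0 0 + p 2 * h 1 1 - p 0 * h 0 2 - p 1 * h 1 2)
        + l₃ (x 2) * (p 1 * h 0 2 - p 0 * h 1 2)

/-- The points at which the eigenvalues belonging to different Jordan blocks are different
(for class D these are `Λ`, its conjugate, and the real number `λ₃`, so this means `b ≠ 0`). -/
def nondegLocus : (X : WebClass) → WebParam X → Set R3
  | .A, (l₁, l₂, l₃) => {x | l₁ (x 0) ≠ l₂ (x 1) ∧ l₂ (x 1) ≠ l₃ (x 2) ∧ l₁ (x 0) ≠ l₃ (x 2)}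
  | .B, (l₂, l₃) => {x | l₂ (x 1) ≠ l₃ (x 2)}
  | .C, _ => Set.univ
  | .D, (L, _) => {x | (L (zCoord x)).im ≠ 0}

/-- Smoothness of the real parameters and holomorphy of `Λ` at the point `x`. -/
def ParamSmoothAt : (X : WebClass) → WebParam X → R3 → Prop
  | .A, (l₁, l₂, l₃), x =>
      ContDiffAt ℝ ∞ l₁ (x 0) ∧ ContDiffAt ℝ ∞ l₂ (x 1) ∧ ContDiffAt ℝ ∞ l₃ (x 2)
  | .B, (l₂, l₃), x => ContDiffAt ℝ ∞ l₂ (x 1) ∧ ContDiffAt ℝ ∞ l₃ (x 2)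
  | .C, l₃, x => ContDiffAt ℝ ∞ l₃ (x 2)
  | .D, (L, l₃), x => AnalyticAt ℂ L (zCoord x) ∧ ContDiffAt ℝ ∞ l₃ (x 2)

/-- `l` is an admissible choice of functional parameters of class `X` over the open set `Ω`. -/
structure IsWebParam (X : WebClass) (Ω : Set R3) (l : WebParam X) : Prop where
  isOpen : IsOpen Ω
  smooth : ∀ x ∈ Ω, ParamSmoothAt X l x
  nondeg : Ω ⊆ nondegLocus X l

/-! ### The equivalence pseudogroups -/

/-- The changes of the independent variables, over `W`, in the equivalence pseudogroup of class `X`.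
For class C they depend on the parameter `λ₃` of the source equation; the integral is the
antiderivative in `x₂` of `(X₃'' x₂ + X₂') exp (λ₃' (x₂ + X₂ / X₃'))`, which makes sense also where
`λ₃' = 0`. The functions of one variable occurring here are automatically smooth when `φ` is. -/
def IsBaseEquivalence : (X : WebClass) → WebParam X → (R3 → R3) → Set R3 → Prop
  | .A, _, φ, W => ∃ X₁ X₂ X₃ : ℝ → ℝ, ∀ x ∈ W, φ x = ![X₁ (x 0), X₂ (x 1), X₃ (x 2)]
  | .B, _, φ, W => ∃ X₁ X₂ X₃ : ℝ → ℝ, ∀ x ∈ W,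
      φ x = ![deriv X₂ (x 1) * x 0 + X₁ (x 1), X₂ (x 1), X₃ (x 2)]
  | .C, l₃, φ, W => ∃ X₁ X₂ X₃ : ℝ → ℝ, ∀ x ∈ W,
      φ x = ![deriv X₃ (x 2) * Real.exp (deriv l₃ (x 2) * (X₂ (x 2) / deriv X₃ (x 2))) * x 0
          + (∫ s in (0 : ℝ)..(x 1), (deriv (deriv X₃) (x 2) * s + deriv X₂ (x 2)) *
              Real.exp (deriv l₃ (x 2) * (s + X₂ (x 2) / deriv X₃ (x 2))))
          + X₁ (x 2),
        deriv X₃ (x 2) * x 1 + X₂ (x 2), X₃ (x 2)]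
  | .D, _, φ, W => ∃ (Z : ℂ → ℂ) (X₃ : ℝ → ℝ), ∀ x ∈ W,
      AnalyticAt ℂ Z (zCoord x) ∧
        φ x = ![(Z (zCoord x)).re, (Z (zCoord x)).im, X₃ (x 2)]

/-- `Φ`, over the open set `W` of independent variables, belongs to the equivalence pseudogroup of
class `X`: it is the contact transformation that prolongs `(x, f) ↦ (φ(x), F(f))`, with `φ` as in
`IsBaseEquivalence`. -/
def InEquivalencePseudogroup (X : WebClass) (l : WebParam X) (Φ : Jet1 → Jet1) (W : Set R3) :
    Prop :=
  IsContactTransformation Φ {θ | θ.1 ∈ W} ∧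
    ∃ (φ : R3 → R3) (F : ℝ → ℝ), IsBaseEquivalence X l φ W ∧
      ∀ θ : Jet1, θ.1 ∈ W → (Φ θ).1 = φ θ.1 ∧ (Φ θ).2.1 = F θ.2.1

/-- The equation of class `X` with parameters `l` near the point `x ∈ Ω`, and the one with
parameters `m` near the point `y ∈ Ω'`, are identified by an element of the equivalence pseudogroup
of class `X` defined near `x` and sending `x` to `y`. -/
def PseudogroupEquivalent (X : WebClass) (Ω : Set R3) (l : WebParam X) (x : R3)
    (Ω' : Set R3) (m : WebParam X) (y : R3) : Prop :=
  ∃ (W : Set R3) (Φ : Jet1 → Jet1), IsOpen W ∧ x ∈ W ∧ W ⊆ Ω ∧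
    InEquivalencePseudogroup X l Φ W ∧
    (∀ θ : Jet1, θ.1 ∈ W → (Φ θ).1 ∈ Ω') ∧ (∀ θ : Jet1, θ.1 = x → (Φ θ).1 = y) ∧
    MapsEquation Φ {θ | θ.1 ∈ W} (webPDE X l) (webPDE X m)

/-! ### Strata and normal forms -/

/-- Near `t` the function is constant, or some derivative of positive order at `t` is nonzero. -/
def NonflatAt (g : ℝ → ℝ) (t : ℝ) : Prop :=
  (∀ᶠ s in nhds t, g s = g t) ∨ ∃ k : ℕ, 1 ≤ k ∧ iteratedDeriv k g t ≠ 0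

/-- All real functional parameters are nonflat at the point `x` (a holomorphic one always is). -/
def ParamNonflatAt : (X : WebClass) → WebParam X → R3 → Prop
  | .A, (l₁, l₂, l₃), x => NonflatAt l₁ (x 0) ∧ NonflatAt l₂ (x 1) ∧ NonflatAt l₃ (x 2)
  | .B, (l₂, l₃), x => NonflatAt l₂ (x 1) ∧ NonflatAt l₃ (x 2)
  | .C, l₃, x => NonflatAt l₃ (x 2)
  | .D, (_, l₃), x => NonflatAt l₃ (x 2)

/-- The functions `c` and `c ± t ^ k`, `k ≥ 1`. -/
def IsMonomialForm (g : ℝ → ℝ) : Prop :=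
  ∃ c ε : ℝ, ∃ k : ℕ, 1 ≤ k ∧ (ε = 0 ∨ ε = 1 ∨ ε = -1) ∧ g = fun t => c + ε * t ^ k

/-- The functions `c` and `c + z ^ k`, `k ≥ 1`. -/
def IsComplexMonomialForm (g : ℂ → ℂ) : Prop :=
  ∃ c : ℂ, (g = fun _ => c) ∨ ∃ k : ℕ, 1 ≤ k ∧ g = fun z => c + z ^ k

/-- All parameters are of monomial form; these depend on finitely many numbers only. -/
def ParamMonomial : (X : WebClass) → WebParam X → Prop
  | .A, (l₁, l₂, l₃) => IsMonomialForm l₁ ∧ IsMonomialForm l₂ ∧ IsMonomialForm l₃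
  | .B, (l₂, l₃) => IsMonomialForm l₂ ∧ IsMonomialForm l₃
  | .C, l₃ => IsMonomialForm l₃
  | .D, (L, l₃) => IsComplexMonomialForm L ∧ IsMonomialForm l₃

/-- The identity function or a constant function. -/
def IsIdOrConst {K : Type} (g : K → K) : Prop :=
  g = id ∨ ∃ c : K, g = fun _ => c

/-- The specifications `A_i`, `B_j`, `C_k`, `D_l`: every parameter is the coordinate function or
a constant. -/
def ParamBasic : (X : WebClass) → WebParam X → Prop
  | .A, (l₁, l₂, l₃) => IsIdOrConst l₁ ∧ IsIdOrConst l₂ ∧ IsIdOrConst l₃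
  | .B, (l₂, l₃) => IsIdOrConst l₂ ∧ IsIdOrConst l₃
  | .C, l₃ => IsIdOrConst l₃
  | .D, (L, l₃) => IsIdOrConst L ∧ IsIdOrConst l₃

/-- The generic stratum: no functional parameter is critical at the point `x`. -/
def ParamGenericAt : (X : WebClass) → WebParam X → R3 → Prop
  | .A, (l₁, l₂, l₃), x => deriv l₁ (x 0) ≠ 0 ∧ deriv l₂ (x 1) ≠ 0 ∧ deriv l₃ (x 2) ≠ 0
  | .B, (l₂, l₃), x => deriv l₂ (x 1) ≠ 0 ∧ deriv l₃ (x 2) ≠ 0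
  | .C, l₃, x => deriv l₃ (x 2) ≠ 0
  | .D, (L, l₃), x => deriv L (zCoord x) ≠ 0 ∧ deriv l₃ (x 2) ≠ 0

/-- The parameters of `A₀`, `B₀`, `C₀`, `D₀`: `λᵢ(xᵢ) = xᵢ` and `Λ(z) = z`. -/
def stdParam : (X : WebClass) → WebParam X
  | .A => (id, id, id)
  | .B => (id, id)
  | .C => id
  | .D => (id, id)

end

/-! Separation of the classes. At a 1-jet, the differential of a contact transformation acts on
Hessians by a fractional linear map `h ↦ (c + d h)(a + b h)⁻¹`
(`IsContactTransformation.exists_hessianAction`). All four equations are affine in the Hessian.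
Where the momenta are nonzero, the symbol `S` is nondegenerate and has a real isotropic vector.
Differentiating along the equation gives `S' = σ M S Mᵀ` with `M = a + b h`, for every `h` on the
equation with `M` invertible. Adding `t ξ ξᵀ` with `ξ` isotropic to `h` stays on the equation, but
alters `S` in this formula by a matrix of rank at most two. That matrix can be a multiple of `S`
only if it is zero, and this forces `b = 0` (`HessianAction.eq_zero`). So an equivalence is locally
the prolongation of a transformation of the space of `(x, u)`.

The differential of that transformation at one point is a single linear map `L` of `ℝ⁴` serving all
momenta over the point. Carried to `ℝ⁴`, the symbol becomes a matrix `conormalForm` quadratic in the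
conormal `n = (p, -1)`, and `L` matches the two families up to scalars, for all `n` by analyticity
(`SymbolMatch`). The adjugate of this matrix is a nonzero constant times `singularPoly` times `n
nᵀ`. The quartic `singularPoly` is `n₀n₁n₂n₃`, `n₀²n₂n₃`, `n₀³n₃` or `(n₀² + n₁²)n₂n₃`. Its zero set
contains 4, 3, 2 and 2 real hyperplanes respectively, and these hyperplanes correspond under `L`.
The count leaves only C against D. There the real plane `n₀ = n₁ = 0` of D would have to enter one
of the two hyperplanes of C, which are already the images of the other two of D
(`not_symbolMatch_D_C`).

Normal forms. If the parameters are `λ = m ∘ χ` for local coordinate changes `χ`, then the `χ`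
assemble into an element of the pseudogroup that carries the equation with parameters `λ` to the one
with parameters `m`; this is checked class by class in `pseudogroupEquivalent_A` to
`pseudogroupEquivalent_D`. What remains concerns single functions: a noncritical function is its own
coordinate, a nonflat one is a constant plus a signed power of a coordinate, and in every interval
there is a point near which the function is noncritical or constant. -/

noncomputable section

/-! ### Prolongation of base transformations to 1-jets and 2-jets -/

/-- The Jacobian matrix of `φ` at `x`. -/
def jacobian (φ : R3 → R3) (x : R3) : Matrix (Fin 3) (Fin 3) ℝ :=
  Matrix.of fun k i => fderiv ℝ φ x (Pi.single i 1) k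

/-- The second partial derivatives `∂ⱼ∂ᵢφₖ` of `φ` at `x`. -/
def secondPartial (φ : R3 → R3) (x : R3) (k i j : Fin 3) : ℝ :=
  fderiv ℝ (fun y => jacobian φ y k i) x (Pi.single j 1)

/-- The 1-jet momentum transported by `φ`. -/
def pushMomentum (φ : R3 → R3) (x p : R3) : R3 :=
  ((jacobian φ x)⁻¹).transpose.mulVec p

/-- The prolongation to 1-jets of `(x, f) ↦ (φ(x), f)`. -/
def prolong (φ : R3 → R3) (θ : Jet1) : Jet1 :=
  (φ θ.1, θ.2.1, pushMomentum φ θ.1 θ.2.2)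

theorem fderiv_apply_eq_jacobian (φ : R3 → R3) (x v : R3) :
    fderiv ℝ φ x v = (jacobian φ x).mulVec v := by
  have hv : v = ∑ i, v i • (Pi.single i (1 : ℝ) : R3) := by
    ext k
    simp [Finset.sum_apply, Pi.single_apply]
  conv_lhs => rw [hv]
  ext k
  simp [map_sum, Matrix.mulVec, dotProduct, jacobian, Finset.sum_apply, mul_comm]

theorem fderiv_real_apply_eq_sum (f : R3 → ℝ) (x v : R3) :
    fderiv ℝ f x v = ∑ j, fderiv ℝ f x (Pi.single j 1) * v j := by
  have hv : v = ∑ i, v i • (Pi.single i (1 : ℝ) : R3) := by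
    ext k
    simp [Finset.sum_apply, Pi.single_apply]
  conv_lhs => rw [hv]
  simp [map_sum, mul_comm]

/-- Once differentiability is known, Jacobian entries may be computed along coordinate lines;
explicit `φ` are then handled by one-variable calculus. -/
theorem jacobian_eq_of_hasDerivAt {φ : R3 → R3} {x : R3} (hφ : DifferentiableAt ℝ φ x)
    {k i : Fin 3} {v : ℝ}
    (h : HasDerivAt (fun s => φ (Function.update x i s) k) v (x i)) :
    jacobian φ x k i = v := by
  have h1 : HasDerivAt (fun s => φ (Function.update x i s)) (fderiv ℝ φ x (Pi.single i 1)) (x i) :=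
    HasFDerivAt.comp_hasDerivAt (x i) (by simpa using hφ.hasFDerivAt) (hasDerivAt_update x i (x i))
  exact ((hasDerivAt_pi.1 h1) k).unique h

theorem fderiv_single_eq_of_hasDerivAt {f : R3 → ℝ} {x : R3} (hf : DifferentiableAt ℝ f x)
    {j : Fin 3} {v : ℝ} (h : HasDerivAt (fun s => f (Function.update x j s)) v (x j)) :
    fderiv ℝ f x (Pi.single j 1) = v := by
  have h1 : HasDerivAt (fun s => f (Function.update x j s)) (fderiv ℝ f x (Pi.single j 1)) (x j) :=
    HasFDerivAt.comp_hasDerivAt (x j) (by simpa using hf.hasFDerivAt) (hasDerivAt_update x j (x j))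
  exact h1.unique h

section Smooth

variable {φ : R3 → R3} {W : Set R3}

theorem contDiffOn_jacobian (hW : IsOpen W) (hφ : ContDiffOn ℝ ∞ φ W) (k i : Fin 3) :
    ContDiffOn ℝ ∞ (fun y => jacobian φ y k i) W := by
  have h1 : ContDiffOn ℝ ∞ (fderiv ℝ φ) W := hφ.fderiv_of_isOpen hW (by simp)
  have h2 : ContDiffOn ℝ ∞ (fun y => fderiv ℝ φ y (Pi.single i 1)) W :=
    h1.clm_apply contDiffOn_const
  exact (contDiffOn_pi.1 h2) k

theorem differentiableAt_jacobian (hW : IsOpen W) (hφ : ContDiffOn ℝ ∞ φ W) {x : R3} (hx : x ∈ W)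
    (k i : Fin 3) : DifferentiableAt ℝ (fun y => jacobian φ y k i) x :=
  ((contDiffOn_jacobian hW hφ k i).contDiffAt (hW.mem_nhds hx)).differentiableAt (by simp)

theorem secondPartial_eq_of_hasDerivAt (hW : IsOpen W) (hφ : ContDiffOn ℝ ∞ φ W) {x : R3}
    (hx : x ∈ W) {k i j : Fin 3} {G : R3 → ℝ} (hG : ∀ y ∈ W, jacobian φ y k i = G y) {v : ℝ}
    (h : HasDerivAt (fun s => G (Function.update x j s)) v (x j)) :
    secondPartial φ x k i j = v := by
  refine fderiv_single_eq_of_hasDerivAt (differentiableAt_jacobian hW hφ hx k i) ?_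
  refine h.congr_of_eventuallyEq ?_
  have hc : Continuous (Function.update x j) := continuous_const.update j continuous_id
  have : ∀ᶠ s in nhds (x j), Function.update x j s ∈ W :=
    hc.continuousAt.eventually_mem (hW.mem_nhds (by simpa using hx))
  filter_upwards [this] with s hs using hG _ hs

theorem contDiffOn_det_jacobian (hW : IsOpen W) (hφ : ContDiffOn ℝ ∞ φ W) :
    ContDiffOn ℝ ∞ (fun y => (jacobian φ y).det) W := by
  have h := contDiffOn_jacobian hW hφ
  simp only [Matrix.det_fin_three]
  fun_prop (disch := simp)

theorem contDiffOn_inv_jacobian (hW : IsOpen W) (hφ : ContDiffOn ℝ ∞ φ W)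
    (hdet : ∀ x ∈ W, (jacobian φ x).det ≠ 0) (i j : Fin 3) :
    ContDiffOn ℝ ∞ (fun y => (jacobian φ y)⁻¹ i j) W := by
  have h := contDiffOn_jacobian hW hφ
  have hd := (contDiffOn_det_jacobian hW hφ).inv hdet
  have ha : ContDiffOn ℝ ∞ (fun y => (jacobian φ y).adjugate i j) W := by
    simp only [Matrix.adjugate_fin_three]
    fin_cases i <;> fin_cases j <;> simp <;> fun_prop
  refine (hd.mul ha).congr fun y _ => ?_
  simp [Matrix.inv_def, Ring.inverse_eq_inv']

theorem contDiffOn_prolong (hW : IsOpen W) (hφ : ContDiffOn ℝ ∞ φ W)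
    (hdet : ∀ x ∈ W, (jacobian φ x).det ≠ 0) :
    ContDiffOn ℝ ∞ (prolong φ) {θ | θ.1 ∈ W} := by
  have hfst : ContDiffOn ℝ ∞ (fun θ : Jet1 => θ.1) {θ | θ.1 ∈ W} := contDiff_fst.contDiffOn
  refine ContDiffOn.prodMk (hφ.comp hfst fun _ h => h) (ContDiffOn.prodMk ?_ ?_)
  · exact (contDiff_fst.comp contDiff_snd).contDiffOn
  · refine contDiffOn_pi.2 fun i => ?_
    have : ∀ j, ContDiffOn ℝ ∞ (fun θ : Jet1 => (jacobian φ θ.1)⁻¹ j i * θ.2.2 j)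
        {θ | θ.1 ∈ W} := by
      intro j
      refine ((contDiffOn_inv_jacobian hW hφ hdet j i).comp hfst fun _ h => h).mul ?_
      exact (by fun_prop : ContDiff ℝ ∞ fun θ : Jet1 => θ.2.2 j).contDiffOn
    simpa [pushMomentum, Matrix.mulVec, dotProduct] using ContDiffOn.sum fun j _ => this j

theorem jacobian_transpose_mulVec_pushMomentum {x : R3} (h : (jacobian φ x).det ≠ 0) (p : R3) :
    (jacobian φ x).transpose.mulVec (pushMomentum φ x p) = p := by
  rw [pushMomentum, Matrix.mulVec_mulVec, ← Matrix.transpose_mul,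
    Matrix.nonsing_inv_mul _ (Ne.isUnit h)]
  simp

theorem hasFDerivAt_prolong (hW : IsOpen W) (hφ : ContDiffOn ℝ ∞ φ W)
    (hdet : ∀ x ∈ W, (jacobian φ x).det ≠ 0) {θ : Jet1} (hθ : θ.1 ∈ W) :
    HasFDerivAt (prolong φ) (fderiv ℝ (prolong φ) θ) θ := by
  have hU : IsOpen {θ : Jet1 | θ.1 ∈ W} := hW.preimage continuous_fst
  exact (((contDiffOn_prolong hW hφ hdet).contDiffAt (hU.mem_nhds hθ)).differentiableAt
    (by simp)).hasFDerivAt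

theorem fderiv_prolong_fst (hW : IsOpen W) (hφ : ContDiffOn ℝ ∞ φ W)
    (hdet : ∀ x ∈ W, (jacobian φ x).det ≠ 0) {θ : Jet1} (hθ : θ.1 ∈ W) (v : Jet1) :
    (fderiv ℝ (prolong φ) θ v).1 = (jacobian φ θ.1).mulVec v.1 := by
  have h := hasFDerivAt_prolong hW hφ hdet hθ
  have h1 := (hasFDerivAt_fst (𝕜 := ℝ) (p := prolong φ θ)).comp θ h
  have hd : HasFDerivAt φ (fderiv ℝ φ θ.1) θ.1 :=
    ((hφ.contDiffAt (hW.mem_nhds hθ)).differentiableAt (by simp)).hasFDerivAt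
  have h2 := hd.comp θ (hasFDerivAt_fst (𝕜 := ℝ) (p := θ))
  have := congrArg (fun f : Jet1 →L[ℝ] R3 => f v) (h1.unique h2)
  rw [← fderiv_apply_eq_jacobian]
  simpa using this

theorem fderiv_prolong_snd_fst (hW : IsOpen W) (hφ : ContDiffOn ℝ ∞ φ W)
    (hdet : ∀ x ∈ W, (jacobian φ x).det ≠ 0) {θ : Jet1} (hθ : θ.1 ∈ W) (v : Jet1) :
    (fderiv ℝ (prolong φ) θ v).2.1 = v.2.1 := by
  have h := hasFDerivAt_prolong hW hφ hdet hθ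
  have h1 := ((ContinuousLinearMap.fst ℝ ℝ R3).comp
    (ContinuousLinearMap.snd ℝ R3 (ℝ × R3))).hasFDerivAt (x := prolong φ θ) |>.comp θ h
  have h2 := ((ContinuousLinearMap.fst ℝ ℝ R3).comp
    (ContinuousLinearMap.snd ℝ R3 (ℝ × R3))).hasFDerivAt (x := θ)
  have := congrArg (fun f : Jet1 →L[ℝ] ℝ => f v) (h1.unique h2)
  simpa using this

/-- The differential of the relation `p = Jᵀ q` between the old and the new momenta. -/
theorem fderiv_prolong_snd_snd (hW : IsOpen W) (hφ : ContDiffOn ℝ ∞ φ W)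
    (hdet : ∀ x ∈ W, (jacobian φ x).det ≠ 0) {θ : Jet1} (hθ : θ.1 ∈ W) (v : Jet1) (i : Fin 3) :
    v.2.2 i = ∑ k, ((∑ j, secondPartial φ θ.1 k i j * v.1 j) * pushMomentum φ θ.1 θ.2.2 k
      + jacobian φ θ.1 k i * (fderiv ℝ (prolong φ) θ v).2.2 k) := by
  have h := hasFDerivAt_prolong hW hφ hdet hθ
  have hq : ∀ k, HasFDerivAt (fun θ' : Jet1 => pushMomentum φ θ'.1 θ'.2.2 k)
      (((ContinuousLinearMap.proj k).comp ((ContinuousLinearMap.snd ℝ ℝ R3).comp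
        (ContinuousLinearMap.snd ℝ R3 (ℝ × R3)))).comp (fderiv ℝ (prolong φ) θ)) θ := fun k =>
    ((ContinuousLinearMap.proj k).comp ((ContinuousLinearMap.snd ℝ ℝ R3).comp
      (ContinuousLinearMap.snd ℝ R3 (ℝ × R3)))).hasFDerivAt (x := prolong φ θ) |>.comp θ h
  have hJ : ∀ k, HasFDerivAt (fun θ' : Jet1 => jacobian φ θ'.1 k i)
      ((fderiv ℝ (fun y => jacobian φ y k i) θ.1).comp (ContinuousLinearMap.fst ℝ R3 (ℝ × R3))) θ :=
    fun k => (differentiableAt_jacobian hW hφ hθ k i).hasFDerivAt.comp θ hasFDerivAt_fst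
  have hs := HasFDerivAt.fun_sum (u := Finset.univ) fun k _ => (hJ k).mul (hq k)
  have hp : HasFDerivAt (fun θ' : Jet1 => θ'.2.2 i)
      ((ContinuousLinearMap.proj i).comp ((ContinuousLinearMap.snd ℝ ℝ R3).comp
      (ContinuousLinearMap.snd ℝ R3 (ℝ × R3)))) θ :=
    ((ContinuousLinearMap.proj i).comp ((ContinuousLinearMap.snd ℝ ℝ R3).comp
      (ContinuousLinearMap.snd ℝ R3 (ℝ × R3)))).hasFDerivAt
  have hU : IsOpen {θ : Jet1 | θ.1 ∈ W} := hW.preimage continuous_fst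
  -- The inverse Jacobian is never differentiated: the product rule is applied to `p = Jᵀ q`
  -- instead, which is linear in the new momentum.
  have he : (fun θ' : Jet1 => θ'.2.2 i) =ᶠ[nhds θ]
      fun θ' => ∑ k, jacobian φ θ'.1 k i * pushMomentum φ θ'.1 θ'.2.2 k := by
    filter_upwards [hU.mem_nhds hθ] with θ' hθ'
    have := congrFun (jacobian_transpose_mulVec_pushMomentum (hdet _ hθ') θ'.2.2) i
    rw [← this]
    simp [Matrix.mulVec, dotProduct]
  have := congrArg (fun f : Jet1 →L[ℝ] ℝ => f v) (hp.unique (hs.congr_of_eventuallyEq he))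
  simp only [ContinuousLinearMap.comp_apply, _root_.sum_apply,
    _root_.add_apply, _root_.smul_apply, ContinuousLinearMap.proj_apply,
    ContinuousLinearMap.coe_snd', ContinuousLinearMap.coe_fst', smul_eq_mul] at this
  rw [this]
  refine Finset.sum_congr rfl fun k _ => ?_
  rw [fderiv_real_apply_eq_sum]
  simp only [secondPartial]
  ring

/-- The conformal factor is one because `q · J v = Jᵀ q · v = p · v`. The differential is injective
because the base part is recovered through `J` and the momentum part through the differentiated
relation `p = Jᵀ q`. -/
theorem isContactTransformation_prolong (hW : IsOpen W) (hφ : ContDiffOn ℝ ∞ φ W)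
    (hinj : Set.InjOn φ W) (hdet : ∀ x ∈ W, (jacobian φ x).det ≠ 0) :
    IsContactTransformation (prolong φ) {θ | θ.1 ∈ W} where
  isOpen := hW.preimage continuous_fst
  contDiffOn := contDiffOn_prolong hW hφ hdet
  injOn := by
    rintro ⟨x, u, p⟩ hx ⟨y, w, q⟩ hy h
    simp only [prolong, Prod.mk.injEq] at h
    obtain ⟨h1, h2, h3⟩ := h
    obtain rfl := hinj hx hy h1
    have := congrArg (jacobian φ x).transpose.mulVec h3
    rw [jacobian_transpose_mulVec_pushMomentum (hdet _ hx),
      jacobian_transpose_mulVec_pushMomentum (hdet _ hx)] at this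
    rw [h2, this]
  bijective_fderiv := by
    intro θ hθ
    have hi : Function.Injective (fderiv ℝ (prolong φ) θ : Jet1 →ₗ[ℝ] Jet1) := by
      rw [← LinearMap.ker_eq_bot, LinearMap.ker_eq_bot']
      intro v hv
      have hv' : fderiv ℝ (prolong φ) θ v = 0 := hv
      have h1 := fderiv_prolong_fst hW hφ hdet hθ v
      have h2 := fderiv_prolong_snd_fst hW hφ hdet hθ v
      have h3 := fderiv_prolong_snd_snd hW hφ hdet hθ v
      rw [hv'] at h1 h2
      simp only [hv'] at h3
      have hv1 : v.1 = 0 := by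
        by_contra hne
        exact hdet _ hθ (Matrix.exists_mulVec_eq_zero_iff.1 ⟨v.1, hne, h1.symm⟩)
      refine Prod.ext hv1 (Prod.ext h2.symm (funext fun i => ?_))
      rw [h3 i]
      simp [hv1]
    exact ⟨hi, LinearMap.injective_iff_surjective.1 hi⟩
  contact := by
    intro θ hθ
    refine ⟨1, one_ne_zero, fun v => ?_⟩
    have h := jacobian_transpose_mulVec_pushMomentum (hdet _ hθ) θ.2.2
    rw [contactForm, contactForm, fderiv_prolong_fst hW hφ hdet hθ,
      fderiv_prolong_snd_fst hW hφ hdet hθ, one_mul]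
    congr 1
    change pushMomentum φ θ.1 θ.2.2 ⬝ᵥ (jacobian φ θ.1).mulVec v.1 = θ.2.2 ⬝ᵥ v.1
    rw [Matrix.dotProduct_mulVec, ← Matrix.mulVec_transpose, h]

/-- The pullback by `φ` of the second order part of a 2-jet. -/
def pullHessian (φ : R3 → R3) (x q : R3) (h : Matrix (Fin 3) (Fin 3) ℝ) :
    Matrix (Fin 3) (Fin 3) ℝ :=
  Matrix.of fun i j => ∑ k, (secondPartial φ x k i j * q k
    + jacobian φ x k i * ∑ l, h k l * jacobian φ x l j)

/-- By the chain rule, only the pulled-back Hessian can have its plane carried to that of `h'`. The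
criterion is phrased in the target data `q`, `h'`, so that the source data are polynomial in the
derivatives of `φ`. -/
theorem mapsEquation_prolong (hW : IsOpen W) (hφ : ContDiffOn ℝ ∞ φ W)
    (hdet : ∀ x ∈ W, (jacobian φ x).det ≠ 0) {E E' : PDE2}
    (hE : ∀ x ∈ W, ∀ (u : ℝ) (q : R3) (h' : Matrix (Fin 3) (Fin 3) ℝ), h'.IsSymm →
      ∃ c : ℝ, c ≠ 0 ∧ E (x, u, (jacobian φ x).transpose.mulVec q) (pullHessian φ x q h')
        = c * E' (φ x, u, q) h') :
    MapsEquation (prolong φ) {θ | θ.1 ∈ W} E E' := by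
  rintro ⟨x, u, p⟩ hθ h h' _ hh' hmap
  have hx : x ∈ W := hθ
  have key : h = pullHessian φ x (pushMomentum φ x p) h' := by
    ext i j
    have hmem : fderiv ℝ (prolong φ) (x, u, p) (jetLift (x, u, p) h (Pi.single j 1)) ∈
        jetPlane (prolong φ (x, u, p)) h' := by
      rw [← hmap]
      exact Submodule.mem_map_of_mem (LinearMap.mem_range_self _ _)
    obtain ⟨w, hw⟩ := hmem
    have h1 := fderiv_prolong_fst hW hφ hdet hθ (jetLift (x, u, p) h (Pi.single j 1))
    have h3 := fderiv_prolong_snd_snd hW hφ hdet hθ (jetLift (x, u, p) h (Pi.single j 1)) i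
    rw [← hw] at h1 h3
    have hw' : w = (jacobian φ x).mulVec (Pi.single j 1) := h1
    subst hw'
    simpa [jetLift, pullHessian, Matrix.mulVec, dotProduct, Pi.single_apply] using h3
  obtain ⟨c, hc, hEc⟩ := hE x hx u (pushMomentum φ x p) h' hh'
  rw [jacobian_transpose_mulVec_pushMomentum (hdet _ hx), ← key] at hEc
  change E (x, u, p) h = 0 ↔ E' (φ x, u, pushMomentum φ x p) h' = 0
  rw [hEc, mul_eq_zero, or_iff_right hc]

end Smooth

theorem IsBaseEquivalence.mono {X : WebClass} {l : WebParam X} {φ : R3 → R3} {W W' : Set R3}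
    (h : IsBaseEquivalence X l φ W) (hW : W' ⊆ W) : IsBaseEquivalence X l φ W' := by
  cases X
  · obtain ⟨X₁, X₂, X₃, h⟩ := h
    exact ⟨X₁, X₂, X₃, fun x hx => h x (hW hx)⟩
  · obtain ⟨X₁, X₂, X₃, h⟩ := h
    exact ⟨X₁, X₂, X₃, fun x hx => h x (hW hx)⟩
  · obtain ⟨X₁, X₂, X₃, h⟩ := h
    exact ⟨X₁, X₂, X₃, fun x hx => h x (hW hx)⟩
  · obtain ⟨Z, X₃, h⟩ := h
    exact ⟨Z, X₃, fun x hx => h x (hW hx)⟩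

/-- A base transformation with invertible Jacobian at `x` that pulls the second equation back to
a nonzero multiple of the first one prolongs, near `x`, to an element of the pseudogroup. -/
theorem pseudogroupEquivalent_of_pullback {X : WebClass} {Ω Ω' : Set R3} {l m : WebParam X}
    {x y : R3} {W : Set R3} {φ : R3 → R3} (hW : IsOpen W) (hx : x ∈ W) (hWΩ : W ⊆ Ω)
    (hφ : ContDiffOn ℝ ∞ φ W) (hbase : IsBaseEquivalence X l φ W)
    (hdet : (jacobian φ x).det ≠ 0) (hΩ' : Set.MapsTo φ W Ω') (hy : φ x = y)
    (hE : ∀ x ∈ W, ∀ (u : ℝ) (q : R3) (h' : Matrix (Fin 3) (Fin 3) ℝ), h'.IsSymm →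
      (jacobian φ x).det ≠ 0 →
      ∃ c : ℝ, c ≠ 0 ∧ webPDE X l (x, u, (jacobian φ x).transpose.mulVec q) (pullHessian φ x q h')
        = c * webPDE X m (φ x, u, q) h') :
    PseudogroupEquivalent X Ω l x Ω' m y := by
  have hφx : ContDiffAt ℝ ∞ φ x := hφ.contDiffAt (hW.mem_nhds hx)
  have hstrict : HasStrictFDerivAt φ (fderiv ℝ φ x) x := hφx.hasStrictFDerivAt (by simp)
  have hinj : Function.Injective (fderiv ℝ φ x : R3 →ₗ[ℝ] R3) := by
    rw [← LinearMap.ker_eq_bot, LinearMap.ker_eq_bot']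
    intro v hv
    by_contra hne
    refine hdet (Matrix.exists_mulVec_eq_zero_iff.1 ⟨v, hne, ?_⟩)
    rw [← fderiv_apply_eq_jacobian]
    exact hv
  let e : R3 ≃L[ℝ] R3 := (LinearEquiv.ofInjectiveEndo (fderiv ℝ φ x : R3 →ₗ[ℝ] R3)
    hinj).toContinuousLinearEquiv
  have he : (e : R3 →L[ℝ] R3) = fderiv ℝ φ x := by ext v; rfl
  have hstrict' : HasStrictFDerivAt φ (e : R3 →L[ℝ] R3) x := by rw [he]; exact hstrict
  -- The inverse function theorem serves only to make `φ` injective near `x`.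
  let Ψ := hstrict'.toOpenPartialHomeomorph φ
  have hxΨ : x ∈ Ψ.source := hstrict'.mem_toOpenPartialHomeomorph_source
  have hdetc : ∀ᶠ z in nhds x, (jacobian φ z).det ≠ 0 :=
    (((contDiffOn_det_jacobian hW hφ).contDiffAt (hW.mem_nhds hx)).continuousAt).eventually_ne hdet
  have hev : ∀ᶠ z in nhds x, z ∈ W ∧ z ∈ Ψ.source ∧ (jacobian φ z).det ≠ 0 :=
    Filter.Eventually.and (hW.mem_nhds hx)
      (Filter.Eventually.and (Ψ.open_source.mem_nhds hxΨ) hdetc)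
  obtain ⟨V, hV, hVo, hxV⟩ := eventually_nhds_iff.1 hev
  have hVW : V ⊆ W := fun z hz => (hV z hz).1
  have hVinj : Set.InjOn φ V := fun z hz w hw h => Ψ.injOn (hV z hz).2.1 (hV w hw).2.1 h
  have hVdet : ∀ z ∈ V, (jacobian φ z).det ≠ 0 := fun z hz => (hV z hz).2.2
  refine ⟨V, prolong φ, hVo, hxV, hVW.trans hWΩ,
    ⟨isContactTransformation_prolong hVo (hφ.mono hVW) hVinj hVdet, φ, id, hbase.mono hVW,
      fun _ _ => ⟨rfl, rfl⟩⟩, fun θ hθ => hΩ' (hVW hθ), ?_, ?_⟩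
  · rintro ⟨_, _⟩ rfl
    exact hy
  · exact mapsEquation_prolong hVo (hφ.mono hVW) hVdet
      fun z hz u q h' hh' => hE z (hVW hz) u q h' hh' (hVdet z hz)

end

noncomputable section

/-! ### Smooth functions of one variable -/

/-- Each differentiation under the integral sign brings out a factor `r`. The weight `r ^ k` keeps
the family closed under differentiation, which drives the induction for smoothness. -/
theorem hasDerivAt_integral_dilation {f : ℝ → ℝ} (hf : ContDiff ℝ 1 f) (t : ℝ) (k : ℕ) (s : ℝ) :
    HasDerivAt (fun s => ∫ r in (0 : ℝ)..1, r ^ k * f (t + r * (s - t)))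
      (∫ r in (0 : ℝ)..1, r ^ (k + 1) * deriv f (t + r * (s - t))) s := by
  have hf' : Continuous (deriv f) := hf.continuous_deriv le_rfl
  have hfc : Continuous f := hf.continuous
  have hcont : Continuous fun z : ℝ × ℝ => z.2 ^ (k + 1) * deriv f (t + z.2 * (z.1 - t)) := by
    fun_prop
  obtain ⟨C, hC⟩ := ((isCompact_closedBall s 1).prod
    (isCompact_Icc (a := (0 : ℝ)) (b := 1))).exists_bound_of_continuousOn hcont.continuousOn
  refine (intervalIntegral.hasDerivAt_integral_of_dominated_loc_of_deriv_le (𝕜 := ℝ) (E := ℝ)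
    (F := fun x r => r ^ k * f (t + r * (x - t)))
    (F' := fun x r => r ^ (k + 1) * deriv f (t + r * (x - t))) (bound := fun _ => C)
    (Metric.closedBall_mem_nhds s one_pos) ?_ ?_ ?_ ?_ ?_ ?_).2
  · exact Filter.Eventually.of_forall fun x =>
      (by fun_prop : Continuous fun r : ℝ => r ^ k * f (t + r * (x - t))).aestronglyMeasurable
  · exact (by fun_prop : Continuous fun r : ℝ => r ^ k * f (t + r * (s - t))).intervalIntegrable _ _
  · exact (by fun_prop : Continuous fun r : ℝ =>
      r ^ (k + 1) * deriv f (t + r * (s - t))).aestronglyMeasurable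
  · refine Filter.Eventually.of_forall fun r hr x hx => hC (x, r) ⟨hx, ?_⟩
    rw [Set.uIoc_of_le zero_le_one] at hr
    exact ⟨hr.1.le, hr.2⟩
  · exact continuous_const.intervalIntegrable _ _
  · refine Filter.Eventually.of_forall fun r _ x _ => ?_
    have h1 : HasDerivAt (fun x => t + r * (x - t)) r x := by
      simpa using (((hasDerivAt_id x).sub_const t).const_mul r).const_add t
    have h2 : HasDerivAt f (deriv f (t + r * (x - t))) (t + r * (x - t)) :=
      ((hf.differentiable one_ne_zero) _).hasDerivAt
    exact ((h2.comp x h1).const_mul (r ^ k)).congr_deriv (by ring)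

/-- Used twice: for Hadamard's lemma, and with `f = exp`, `k = 1` for the integral in the
pseudogroup of class C. -/
theorem contDiff_integral_dilation {f : ℝ → ℝ} (hf : ContDiff ℝ ∞ f) (t : ℝ) (k : ℕ) :
    ContDiff ℝ ∞ (fun s => ∫ r in (0 : ℝ)..1, r ^ k * f (t + r * (s - t))) := by
  rw [contDiff_infty]
  intro n
  induction n generalizing f k with
  | zero =>
    have := fun s => (hasDerivAt_integral_dilation (hf.of_le (by simp)) t k s).continuousAt
    exact contDiff_zero.2 (continuous_iff_continuousAt.2 this)
  | succ n ih =>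
    have h := hasDerivAt_integral_dilation (hf.of_le (by simp)) t k
    rw [show ((n + 1 : ℕ) : WithTop ℕ∞) = (n : WithTop ℕ∞) + 1 by simp, contDiff_succ_iff_deriv]
    refine ⟨fun s => (h s).differentiableAt, by simp, ?_⟩
    rw [funext fun s => (h s).deriv]
    exact ih (contDiff_infty_iff_deriv.1 hf).2 (k + 1)

/-- Hadamard's lemma in one variable. -/
theorem exists_contDiff_eq_add_sub_mul {f : ℝ → ℝ} (hf : ContDiff ℝ ∞ f) (t : ℝ) :
    ∃ g : ℝ → ℝ, ContDiff ℝ ∞ g ∧ ∀ s, f s = f t + (s - t) * g s := by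
  have hf' : ContDiff ℝ ∞ (deriv f) := (contDiff_infty_iff_deriv.1 hf).2
  refine ⟨_, contDiff_integral_dilation hf' t 0, fun s => ?_⟩
  have h : ∀ r ∈ Set.uIcc (0 : ℝ) 1, HasDerivAt (fun r => f (t + r * (s - t)))
      ((s - t) * (r ^ 0 * deriv f (t + r * (s - t)))) r := by
    intro r _
    have h1 : HasDerivAt (fun r => t + r * (s - t)) (s - t) r := by
      simpa using ((hasDerivAt_id r).mul_const (s - t)).const_add t
    have h2 : HasDerivAt f (deriv f (t + r * (s - t))) (t + r * (s - t)) :=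
      ((hf.differentiable (by simp)) _).hasDerivAt
    exact (h2.comp r h1).congr_deriv (by ring)
  have hc := hf'.continuous
  have := intervalIntegral.integral_eq_sub_of_hasDerivAt h
    ((by fun_prop : Continuous fun r : ℝ =>
      (s - t) * (r ^ 0 * deriv f (t + r * (s - t)))).intervalIntegrable _ _)
  rw [intervalIntegral.integral_const_mul] at this
  rw [this]
  simp

/-- One derivative of `(s - t) ^ (k + 1) * g` is again `(s - t) ^ k` times a smooth function. -/
theorem iteratedDeriv_sub_pow_mul_eq_zero {g : ℝ → ℝ} (hg : ContDiff ℝ ∞ g) (t : ℝ) {j k : ℕ}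
    (hjk : j < k) : iteratedDeriv j (fun s => (s - t) ^ k * g s) t = 0 := by
  induction j generalizing g k with
  | zero => simp [Nat.pos_iff_ne_zero.1 hjk]
  | succ j ih =>
    obtain ⟨k, rfl⟩ : ∃ k', k = k' + 1 := ⟨k - 1, by omega⟩
    have hd : deriv (fun s => (s - t) ^ (k + 1) * g s) =
        fun s => (s - t) ^ k * (((k + 1 : ℕ) : ℝ) * g s + (s - t) * deriv g s) := by
      funext s
      have h1 : HasDerivAt (fun s => (s - t) ^ (k + 1)) (((k + 1 : ℕ) : ℝ) * (s - t) ^ k * 1) s :=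
        ((hasDerivAt_id s).sub_const t).pow (k + 1)
      have h2 : HasDerivAt g (deriv g s) s := ((hg.differentiable (by simp)) s).hasDerivAt
      rw [(h1.fun_mul h2).deriv]
      ring
    rw [iteratedDeriv_succ', hd]
    have hg' : ContDiff ℝ ∞ (deriv g) := (contDiff_infty_iff_deriv.1 hg).2
    exact ih (by fun_prop) (by omega)

/-- A smooth function with a nonvanishing derivative of positive order at `t` is a constant plus
a power of `s - t` times a nonvanishing smooth function. -/
theorem exists_eq_add_pow_mul_of_iteratedDeriv_ne_zero {f : ℝ → ℝ} (hf : ContDiff ℝ ∞ f) {t : ℝ}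
    {k : ℕ} (hk : 1 ≤ k) (h : iteratedDeriv k f t ≠ 0) :
    ∃ (n : ℕ) (g : ℝ → ℝ), 1 ≤ n ∧ ContDiff ℝ ∞ g ∧ g t ≠ 0 ∧
      ∀ s, f s = f t + (s - t) ^ n * g s := by
  -- If no quotient were nonzero at `t`, Hadamard's lemma could be iterated without end. Then `f - f
  -- t` would be divisible by `(s - t) ^ (k + 1)`, and its `k`-th derivative at `t` would vanish.
  by_contra hcon
  push Not at hcon
  have key : ∀ K : ℕ, ∃ g : ℝ → ℝ, ContDiff ℝ ∞ g ∧ ∀ s, f s = f t + (s - t) ^ (K + 1) * g s := by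
    intro K
    induction K with
    | zero => simpa using exists_contDiff_eq_add_sub_mul hf t
    | succ K ih =>
      obtain ⟨g, hg, hfg⟩ := ih
      have hgt : g t = 0 := by
        by_contra hne
        obtain ⟨s, hs⟩ := hcon (K + 1) g (by omega) hg hne
        exact hs (hfg s)
      obtain ⟨g', hg', hgg'⟩ := exists_contDiff_eq_add_sub_mul hg t
      refine ⟨g', hg', fun s => ?_⟩
      rw [hfg s, hgg' s, hgt]
      ring
  obtain ⟨g, hg, hfg⟩ := key k
  apply h
  rw [funext hfg, iteratedDeriv_const_add (by omega)]
  exact iteratedDeriv_sub_pow_mul_eq_zero hg t (by omega)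

/-- Multiplication by a bump function extends a smooth germ, so the global Hadamard lemma applies to
functions that are smooth only near `t`. -/
theorem exists_contDiff_eventuallyEq {f : ℝ → ℝ} {t : ℝ}
    (hf : ∀ᶠ s in nhds t, ContDiffAt ℝ ∞ f s) :
    ∃ g : ℝ → ℝ, ContDiff ℝ ∞ g ∧ ∀ᶠ s in nhds t, f s = g s := by
  obtain ⟨r, hr, hball⟩ := Metric.eventually_nhds_iff_ball.1 hf
  let b : ContDiffBump t := ⟨r / 3, r / 2, by linarith, by linarith⟩
  refine ⟨fun s => b s * f s, contDiff_iff_contDiffAt.2 fun s => ?_, ?_⟩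
  · by_cases hs : s ∈ Metric.ball t r
    · exact b.contDiff.contDiffAt.mul (hball s hs)
    · have hs' : s ∉ tsupport b := by
        rw [b.tsupport_eq]
        simp only [Metric.mem_ball, Metric.mem_closedBall, not_lt, not_le] at hs ⊢
        change r / 2 < _
        linarith
      have : ∀ᶠ z in nhds s, b z * f z = 0 := by
        filter_upwards [notMem_tsupport_iff_eventuallyEq.1 hs'] with z hz
        rw [hz]
        simp
      exact contDiffAt_const.congr_of_eventuallyEq this
  · filter_upwards [b.eventuallyEq_one] with s hs
    rw [hs]
    simp

theorem continuousAt_deriv_of_eventually_contDiffAt {g : ℝ → ℝ} {t : ℝ}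
    (hg : ∀ᶠ s in nhds t, ContDiffAt ℝ ∞ g s) : ContinuousAt (deriv g) t := by
  obtain ⟨f, hf, hfg⟩ := exists_contDiff_eventuallyEq hg
  exact ((contDiff_infty_iff_deriv.1 hf).2.continuous.continuousAt).congr
    (Filter.EventuallyEq.deriv hfg).symm

/-! ### Reduction of functional parameters -/

/-- On the open set `I` the function `g` is `m` in the coordinate `χ`. -/
structure IsReparametrization (g m χ : ℝ → ℝ) (I : Set ℝ) : Prop where
  isOpen : IsOpen I
  contDiff_model : ContDiff ℝ ∞ m
  contDiffAt : ∀ s ∈ I, ContDiffAt ℝ ∞ χ s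
  deriv_ne_zero : ∀ s ∈ I, deriv χ s ≠ 0
  eq : ∀ s ∈ I, g s = m (χ s)

theorem exists_isReparametrization {g m χ : ℝ → ℝ} {t : ℝ} (hm : ContDiff ℝ ∞ m)
    (hχ : ∀ᶠ s in nhds t, ContDiffAt ℝ ∞ χ s) (hd : deriv χ t ≠ 0)
    (h : ∀ᶠ s in nhds t, g s = m (χ s)) : ∃ I : Set ℝ, t ∈ I ∧ IsReparametrization g m χ I := by
  have hc := continuousAt_deriv_of_eventually_contDiffAt hχ
  obtain ⟨I, hI, hIo, htI⟩ := eventually_nhds_iff.1 (hχ.and ((hc.eventually_ne hd).and h))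
  exact ⟨I, htI, hIo, hm, fun s hs => (hI s hs).1, fun s hs => (hI s hs).2.1,
    fun s hs => (hI s hs).2.2⟩

theorem exists_isReparametrization_id {g : ℝ → ℝ} {t : ℝ}
    (hg : ∀ᶠ s in nhds t, ContDiffAt ℝ ∞ g s) (hd : deriv g t ≠ 0) :
    ∃ I : Set ℝ, t ∈ I ∧ IsReparametrization g id g I :=
  exists_isReparametrization contDiff_id hg hd (Filter.Eventually.of_forall fun _ => rfl)

theorem exists_isReparametrization_const {g : ℝ → ℝ} {t : ℝ} (h : ∀ᶠ s in nhds t, g s = g t) :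
    ∃ I : Set ℝ, t ∈ I ∧ IsReparametrization g (fun _ => g t) (fun s => s - t) I := by
  refine exists_isReparametrization contDiff_const
    (Filter.Eventually.of_forall fun s => by fun_prop) ?_ h
  simp

theorem exists_isReparametrization_basic {g : ℝ → ℝ} {t : ℝ}
    (hg : ∀ᶠ s in nhds t, ContDiffAt ℝ ∞ g s)
    (h : deriv g t ≠ 0 ∨ ∀ᶠ s in nhds t, g s = g t) :
    ∃ (m χ : ℝ → ℝ) (I : Set ℝ), IsIdOrConst m ∧ t ∈ I ∧ IsReparametrization g m χ I := by
  rcases h with h | h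
  · obtain ⟨I, hI⟩ := exists_isReparametrization_id hg h
    exact ⟨_, _, I, Or.inl rfl, hI⟩
  · obtain ⟨I, hI⟩ := exists_isReparametrization_const h
    exact ⟨_, _, I, Or.inr ⟨_, rfl⟩, hI⟩

/-- Write `g = g t + (s - t) ^ n * q` with `q t ≠ 0` and let `ε` be the sign of `q t`. The
coordinate `χ = (s - t) (ε q) ^ (1 / n)` absorbs the unit factor, leaving `g t + ε χ ^ n`. -/
theorem exists_isReparametrization_monomial {g : ℝ → ℝ} {t : ℝ}
    (hg : ∀ᶠ s in nhds t, ContDiffAt ℝ ∞ g s) (h : NonflatAt g t) :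
    ∃ (m χ : ℝ → ℝ) (I : Set ℝ), IsMonomialForm m ∧ χ t = 0 ∧ t ∈ I ∧
      IsReparametrization g m χ I := by
  rcases h with h | ⟨k, hk, h⟩
  · obtain ⟨I, hI⟩ := exists_isReparametrization_const h
    exact ⟨fun _ => g t, fun s => s - t, I, ⟨g t, 0, 1, le_rfl, Or.inl rfl, by simp⟩,
      sub_self t, hI⟩
  · obtain ⟨f, hf, hfg⟩ := exists_contDiff_eventuallyEq hg
    rw [Filter.EventuallyEq.iteratedDeriv_eq k hfg] at h
    obtain ⟨n, q, hn, hq, hqt, hfq⟩ := exists_eq_add_pow_mul_of_iteratedDeriv_ne_zero hf hk h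
    obtain ⟨ε, hε, hεq⟩ : ∃ ε : ℝ, (ε = 1 ∨ ε = -1) ∧ 0 < ε * q t := by
      rcases hqt.lt_or_gt with h | h
      · exact ⟨-1, Or.inr rfl, by linarith⟩
      · exact ⟨1, Or.inl rfl, by linarith⟩
    have hεε : ε * ε = 1 := by rcases hε with rfl | rfl <;> norm_num
    have hpos : ∀ᶠ s in nhds t, 0 < ε * q s :=
      (continuousAt_const.mul hq.continuous.continuousAt).eventually (lt_mem_nhds hεq)
    have hroot : ∀ s, 0 < ε * q s → ContDiffAt ℝ ∞ (fun s => (ε * q s) ^ (1 / n : ℝ)) s :=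
      fun s hs => (contDiffAt_const.mul hq.contDiffAt).rpow_const_of_ne hs.ne'
    have hm : ContDiff ℝ ∞ (fun s : ℝ => f t + ε * s ^ n) := by fun_prop
    have hχ : ∀ᶠ s in nhds t, ContDiffAt ℝ ∞ (fun s => (s - t) * (ε * q s) ^ (1 / n : ℝ)) s := by
      filter_upwards [hpos] with s hs
      have := hroot s hs
      fun_prop
    have hd : deriv (fun s => (s - t) * (ε * q s) ^ (1 / n : ℝ)) t ≠ 0 := by
      have h1 : HasDerivAt (fun s => s - t) 1 t := (hasDerivAt_id t).sub_const t
      have h2 := ((hroot t hεq).differentiableAt (by simp)).hasDerivAt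
      rw [(h1.fun_mul h2).deriv]
      simpa using (Real.rpow_pos_of_pos hεq _).ne'
    have heq : ∀ᶠ s in nhds t, g s = f t + ε * ((s - t) * (ε * q s) ^ (1 / n : ℝ)) ^ n := by
      filter_upwards [hfg, hpos] with s hs hs'
      rw [hs, hfq s, mul_pow, one_div, Real.rpow_inv_natCast_pow hs'.le (by omega)]
      linear_combination (-(s - t) ^ n * q s) * hεε
    obtain ⟨I, hI⟩ := exists_isReparametrization (g := g) hm hχ hd heq
    exact ⟨_, _, I, ⟨f t, ε, n, hn, Or.inr hε, rfl⟩, by simp, hI⟩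

/-- On the open set `I` the holomorphic function `g` is `m` in the coordinate `χ`. -/
structure IsComplexReparametrization (g m χ : ℂ → ℂ) (I : Set ℂ) : Prop where
  isOpen : IsOpen I
  analytic_model : ∀ z, AnalyticAt ℂ m z
  analyticAt : ∀ z ∈ I, AnalyticAt ℂ χ z
  deriv_ne_zero : ∀ z ∈ I, deriv χ z ≠ 0
  eq : ∀ z ∈ I, g z = m (χ z)

theorem exists_isComplexReparametrization {g m χ : ℂ → ℂ} {w : ℂ} (hm : ∀ z, AnalyticAt ℂ m z)
    (hχ : AnalyticAt ℂ χ w) (hd : deriv χ w ≠ 0)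
    (h : ∀ᶠ z in nhds w, g z = m (χ z)) :
    ∃ I : Set ℂ, w ∈ I ∧ IsComplexReparametrization g m χ I := by
  obtain ⟨I, hI, hIo, htI⟩ := eventually_nhds_iff.1
    (hχ.eventually_analyticAt.and ((hχ.deriv.continuousAt.eventually_ne hd).and h))
  exact ⟨I, htI, hIo, hm, fun s hs => (hI s hs).1, fun s hs => (hI s hs).2.1,
    fun s hs => (hI s hs).2.2⟩

theorem exists_isComplexReparametrization_id {g : ℂ → ℂ} {w : ℂ}
    (hg : AnalyticAt ℂ g w) (hd : deriv g w ≠ 0) :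
    ∃ I : Set ℂ, w ∈ I ∧ IsComplexReparametrization g id g I :=
  exists_isComplexReparametrization (fun _ => analyticAt_id) hg hd
    (Filter.Eventually.of_forall fun _ => rfl)

theorem exists_isComplexReparametrization_const {g : ℂ → ℂ} {w : ℂ}
    (h : ∀ᶠ z in nhds w, g z = g w) :
    ∃ I : Set ℂ, w ∈ I ∧ IsComplexReparametrization g (fun _ => g w) (fun z => z - w) I := by
  refine exists_isComplexReparametrization (fun _ => analyticAt_const) (by fun_prop) ?_ h
  simp

theorem exists_isComplexReparametrization_basic {g : ℂ → ℂ} {w : ℂ} (hg : AnalyticAt ℂ g w)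
    (h : deriv g w ≠ 0 ∨ ∀ᶠ z in nhds w, g z = g w) :
    ∃ (m χ : ℂ → ℂ) (I : Set ℂ), IsIdOrConst m ∧ w ∈ I ∧ IsComplexReparametrization g m χ I := by
  rcases h with h | h
  · obtain ⟨I, hI⟩ := exists_isComplexReparametrization_id hg h
    exact ⟨_, _, I, Or.inl rfl, hI⟩
  · obtain ⟨I, hI⟩ := exists_isComplexReparametrization_const h
    exact ⟨_, _, I, Or.inr ⟨_, rfl⟩, hI⟩

theorem exists_isComplexReparametrization_monomial {g : ℂ → ℂ} {w : ℂ} (hg : AnalyticAt ℂ g w) :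
    ∃ (m χ : ℂ → ℂ) (I : Set ℂ), IsComplexMonomialForm m ∧ χ w = 0 ∧ w ∈ I ∧
      IsComplexReparametrization g m χ I := by
  by_cases h : ∀ᶠ z in nhds w, g z = g w
  · obtain ⟨I, hI⟩ := exists_isComplexReparametrization_const h
    exact ⟨fun _ => g w, fun z => z - w, I, ⟨g w, Or.inl rfl⟩, sub_self w, hI⟩
  · have hg' : AnalyticAt ℂ (fun z => g z - g w) w := hg.sub analyticAt_const
    obtain ⟨n, q, hq, hqw, hgq⟩ := hg'.exists_eventuallyEq_pow_smul_nonzero_iff.2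
      (by simpa [sub_eq_zero] using h)
    have hn : n ≠ 0 := by
      rintro rfl
      have := hgq.self_of_nhds
      simp only [sub_self, pow_zero, one_smul] at this
      exact hqw this.symm
    -- The principal root is analytic near `1`, so it is applied to `q / q w`; the constant `b` is a
    -- root of `q w`. Over `ℂ` no sign remains.
    obtain ⟨b, hb⟩ := IsAlgClosed.exists_pow_nat_eq (q w) (Nat.pos_of_ne_zero hn)
    have hb0 : b ≠ 0 := by
      rintro rfl
      exact hqw (by rw [← hb, zero_pow hn])
    have hquot : AnalyticAt ℂ (fun z => q z / q w) w := hq.div analyticAt_const hqw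
    have hroot : AnalyticAt ℂ (fun z => (q z / q w) ^ (1 / n : ℂ)) w :=
      hquot.cpow analyticAt_const (by simp [div_self hqw])
    have hχ : AnalyticAt ℂ (fun z => (z - w) * (b * (q z / q w) ^ (1 / n : ℂ))) w := by
      fun_prop
    have hd : deriv (fun z => (z - w) * (b * (q z / q w) ^ (1 / n : ℂ))) w ≠ 0 := by
      have h1 : HasDerivAt (fun z => z - w) 1 w := (hasDerivAt_id w).sub_const w
      have h2 := hroot.differentiableAt.hasDerivAt.const_mul b
      rw [(h1.fun_mul h2).deriv]
      simp [div_self hqw, hb0]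
    have heq : ∀ᶠ z in nhds w, g z = g w + ((z - w) * (b * (q z / q w) ^ (1 / n : ℂ))) ^ n := by
      filter_upwards [hgq] with z hz
      have : ((q z / q w) ^ (1 / n : ℂ)) ^ n = q z / q w := by
        rw [one_div, Complex.cpow_nat_inv_pow _ hn]
      rw [mul_pow, mul_pow, this, hb]
      rw [smul_eq_mul] at hz
      field_simp
      linear_combination hz
    obtain ⟨I, hI⟩ := exists_isComplexReparametrization (g := g) (m := fun z => g w + z ^ n)
      (fun z => by fun_prop) hχ hd heq
    exact ⟨_, _, I, ⟨g w, Or.inr ⟨n, Nat.one_le_iff_ne_zero.2 hn, rfl⟩⟩, by simp, hI⟩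

end

noncomputable section

/-! ### Elements of the equivalence pseudogroups -/

theorem IsReparametrization.contDiffOn {g m χ : ℝ → ℝ} {I : Set ℝ}
    (h : IsReparametrization g m χ I) : ContDiffOn ℝ ∞ χ I :=
  fun s hs => (h.contDiffAt s hs).contDiffWithinAt

theorem IsReparametrization.contDiffOn_deriv {g m χ : ℝ → ℝ} {I : Set ℝ}
    (h : IsReparametrization g m χ I) : ContDiffOn ℝ ∞ (deriv χ) I :=
  h.contDiffOn.deriv_of_isOpen h.isOpen (by simp)

theorem IsReparametrization.hasDerivAt {g m χ : ℝ → ℝ} {I : Set ℝ}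
    (h : IsReparametrization g m χ I) {s : ℝ} (hs : s ∈ I) : HasDerivAt χ (deriv χ s) s :=
  ((h.contDiffAt s hs).differentiableAt (by simp)).hasDerivAt

theorem IsReparametrization.hasDerivAt_deriv {g m χ : ℝ → ℝ} {I : Set ℝ}
    (h : IsReparametrization g m χ I) {s : ℝ} (hs : s ∈ I) :
    HasDerivAt (deriv χ) (deriv (deriv χ) s) s :=
  ((h.contDiffOn_deriv.contDiffAt (h.isOpen.mem_nhds hs)).differentiableAt (by simp)).hasDerivAt

theorem IsReparametrization.deriv_eq {g m χ : ℝ → ℝ} {I : Set ℝ}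
    (h : IsReparametrization g m χ I) {s : ℝ} (hs : s ∈ I) :
    deriv g s = deriv m (χ s) * deriv χ s := by
  have h1 : g =ᶠ[nhds s] fun z => m (χ z) := by
    filter_upwards [h.isOpen.mem_nhds hs] with z hz using h.eq z hz
  rw [h1.deriv_eq]
  exact (((h.contDiff_model.differentiable (by simp)) (χ s)).hasDerivAt.comp s
    (h.hasDerivAt hs)).deriv

theorem isOpen_inter_box {Ω : Set R3} (hΩ : IsOpen Ω) {I₀ I₁ I₂ : Set ℝ} (h₀ : IsOpen I₀)
    (h₁ : IsOpen I₁) (h₂ : IsOpen I₂) : IsOpen (Ω ∩ {y | y 0 ∈ I₀ ∧ y 1 ∈ I₁ ∧ y 2 ∈ I₂}) :=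
  hΩ.inter ((h₀.preimage (continuous_apply 0)).inter
    ((h₁.preimage (continuous_apply 1)).inter (h₂.preimage (continuous_apply 2))))

theorem contDiffOn_comp_coord {f : ℝ → ℝ} {I : Set ℝ} (hf : ContDiffOn ℝ ∞ f I) {W : Set R3}
    {i : Fin 3} (hW : ∀ y ∈ W, y i ∈ I) : ContDiffOn ℝ ∞ (fun y : R3 => f (y i)) W :=
  hf.comp (contDiff_apply ℝ ℝ i).contDiffOn hW

/-- For a diagonal `φ` each of the three terms contains one derivative in each variable, so all of
them scale by `χ₁' χ₂' χ₃'`. Only mixed second derivatives of `f` occur, and mixed partials of `φ`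
vanish. -/
theorem pseudogroupEquivalent_A {Ω : Set R3} (hΩ : IsOpen Ω) {l₁ l₂ l₃ m₁ m₂ m₃ χ₁ χ₂ χ₃ : ℝ → ℝ}
    {I₁ I₂ I₃ : Set ℝ} (h₁ : IsReparametrization l₁ m₁ χ₁ I₁)
    (h₂ : IsReparametrization l₂ m₂ χ₂ I₂) (h₃ : IsReparametrization l₃ m₃ χ₃ I₃)
    (hnd : Ω ⊆ nondegLocus .A (l₁, l₂, l₃)) {x : R3} (hx : x ∈ Ω) (hx₁ : x 0 ∈ I₁)
    (hx₂ : x 1 ∈ I₂) (hx₃ : x 2 ∈ I₃) :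
    PseudogroupEquivalent .A Ω (l₁, l₂, l₃) x (nondegLocus .A (m₁, m₂, m₃)) (m₁, m₂, m₃)
      ![χ₁ (x 0), χ₂ (x 1), χ₃ (x 2)] := by
  set W : Set R3 := Ω ∩ {y | y 0 ∈ I₁ ∧ y 1 ∈ I₂ ∧ y 2 ∈ I₃} with hWdef
  have hW : IsOpen W := isOpen_inter_box hΩ h₁.isOpen h₂.isOpen h₃.isOpen
  have hxW : x ∈ W := ⟨hx, hx₁, hx₂, hx₃⟩
  let φ : R3 → R3 := fun y => ![χ₁ (y 0), χ₂ (y 1), χ₃ (y 2)]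
  have hφ : ContDiffOn ℝ ∞ φ W := by
    refine contDiffOn_pi.2 fun k => ?_
    fin_cases k
    · exact contDiffOn_comp_coord h₁.contDiffOn fun y hy => hy.2.1
    · exact contDiffOn_comp_coord h₂.contDiffOn fun y hy => hy.2.2.1
    · exact contDiffOn_comp_coord h₃.contDiffOn fun y hy => hy.2.2.2
  have hJ : ∀ y ∈ W, jacobian φ y =
      !![deriv χ₁ (y 0), 0, 0; 0, deriv χ₂ (y 1), 0; 0, 0, deriv χ₃ (y 2)] := by
    intro y hy
    have hd : DifferentiableAt ℝ φ y := (hφ.contDiffAt (hW.mem_nhds hy)).differentiableAt (by simp)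
    have e₁ := h₁.hasDerivAt hy.2.1
    have e₂ := h₂.hasDerivAt hy.2.2.1
    have e₃ := h₃.hasDerivAt hy.2.2.2
    ext k i
    fin_cases k <;> fin_cases i <;> refine jacobian_eq_of_hasDerivAt hd ?_ <;>
      simp [φ, hasDerivAt_const, e₁, e₂, e₃]
  refine pseudogroupEquivalent_of_pullback hW hxW Set.inter_subset_left hφ
    ⟨χ₁, χ₂, χ₃, fun _ _ => rfl⟩ ?_ ?_ rfl ?_
  · rw [hJ x hxW, Matrix.det_fin_three]
    simp [h₁.deriv_ne_zero _ hx₁, h₂.deriv_ne_zero _ hx₂, h₃.deriv_ne_zero _ hx₃]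
  · intro y hy
    have := hnd hy.1
    simpa [nondegLocus, φ, h₁.eq _ hy.2.1, h₂.eq _ hy.2.2.1, h₃.eq _ hy.2.2.2] using this
  · intro y hy u q h' hs _
    have hK : ∀ k i j, i ≠ j → secondPartial φ y k i j = 0 := by
      intro k i j hij
      refine secondPartial_eq_of_hasDerivAt hW hφ hy (fun z hz => by rw [hJ z hz]) ?_
      fin_cases k <;> fin_cases i <;> fin_cases j <;> simp at hij ⊢ <;> exact hasDerivAt_const _ _
    refine ⟨deriv χ₁ (y 0) * deriv χ₂ (y 1) * deriv χ₃ (y 2),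
      mul_ne_zero (mul_ne_zero (h₁.deriv_ne_zero _ hy.2.1) (h₂.deriv_ne_zero _ hy.2.2.1))
        (h₃.deriv_ne_zero _ hy.2.2.2), ?_⟩
    have e₁ := h₁.eq _ hy.2.1
    have e₂ := h₂.eq _ hy.2.2.1
    have e₃ := h₃.eq _ hy.2.2.2
    simp only [webPDE, pullHessian, Matrix.of_apply, Fin.sum_univ_three, hJ y hy, Matrix.mulVec,
      dotProduct, Matrix.transpose_apply, e₁, e₂, e₃, φ,
      hK _ 1 2 (by decide), hK _ 2 0 (by decide), hK _ 0 1 (by decide)]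
    simp
    ring

/-- The factor `χ₂'` on `x₁` gives the terms with and without `λ₂ - λ₃` the same weight `χ₂'² χ₃'`,
while `λ₂'` contributes the `χ₂'` needed in the lower order term. The contributions of `χ₂''` cancel
in `f₁ f₂₃ - f₂ f₁₃`. -/
theorem pseudogroupEquivalent_B {Ω : Set R3} (hΩ : IsOpen Ω) {l₂ l₃ m₂ m₃ χ₂ χ₃ : ℝ → ℝ}
    {I₂ I₃ : Set ℝ} (h₂ : IsReparametrization l₂ m₂ χ₂ I₂) (h₃ : IsReparametrization l₃ m₃ χ₃ I₃)
    (hnd : Ω ⊆ nondegLocus .B (l₂, l₃)) {x : R3} (hx : x ∈ Ω)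
    (hx₂ : x 1 ∈ I₂) (hx₃ : x 2 ∈ I₃) :
    PseudogroupEquivalent .B Ω (l₂, l₃) x (nondegLocus .B (m₂, m₃)) (m₂, m₃)
      ![0, χ₂ (x 1), χ₃ (x 2)] := by
  set W : Set R3 := Ω ∩ {y | y 0 ∈ Set.univ ∧ y 1 ∈ I₂ ∧ y 2 ∈ I₃} with hWdef
  have hW : IsOpen W := isOpen_inter_box hΩ isOpen_univ h₂.isOpen h₃.isOpen
  have hxW : x ∈ W := ⟨hx, Set.mem_univ _, hx₂, hx₃⟩
  let φ : R3 → R3 := fun y =>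
    ![deriv χ₂ (y 1) * y 0 + -(deriv χ₂ (x 1) * x 0), χ₂ (y 1), χ₃ (y 2)]
  have hφ : ContDiffOn ℝ ∞ φ W := by
    refine contDiffOn_pi.2 fun k => ?_
    fin_cases k
    · exact ((contDiffOn_comp_coord h₂.contDiffOn_deriv fun y hy => hy.2.2.1).mul
        (contDiff_apply ℝ ℝ 0).contDiffOn).add contDiffOn_const
    · exact contDiffOn_comp_coord h₂.contDiffOn fun y hy => hy.2.2.1
    · exact contDiffOn_comp_coord h₃.contDiffOn fun y hy => hy.2.2.2
  have hJ : ∀ y ∈ W, jacobian φ y =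
      !![deriv χ₂ (y 1), deriv (deriv χ₂) (y 1) * y 0, 0; 0, deriv χ₂ (y 1), 0;
        0, 0, deriv χ₃ (y 2)] := by
    intro y hy
    have hd : DifferentiableAt ℝ φ y := (hφ.contDiffAt (hW.mem_nhds hy)).differentiableAt (by simp)
    have e₁ : HasDerivAt (fun s => deriv χ₂ (y 1) * s) (deriv χ₂ (y 1)) (y 0) := by
      simpa using (hasDerivAt_id (y 0)).const_mul (deriv χ₂ (y 1))
    have e₁' := (h₂.hasDerivAt_deriv hy.2.2.1).mul_const (y 0)
    have e₂ := h₂.hasDerivAt hy.2.2.1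
    have e₃ := h₃.hasDerivAt hy.2.2.2
    ext k i
    fin_cases k <;> fin_cases i <;> refine jacobian_eq_of_hasDerivAt hd ?_ <;>
      simp [φ, hasDerivAt_const, e₁, e₁', e₂, e₃]
  refine pseudogroupEquivalent_of_pullback hW hxW Set.inter_subset_left hφ
    ⟨fun _ => -(deriv χ₂ (x 1) * x 0), χ₂, χ₃, fun _ _ => rfl⟩ ?_ ?_ (by simp [φ]) ?_
  · rw [hJ x hxW, Matrix.det_fin_three]
    simp [h₂.deriv_ne_zero _ hx₂, h₃.deriv_ne_zero _ hx₃]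
  · intro y hy
    have := hnd hy.1
    simpa [nondegLocus, φ, h₂.eq _ hy.2.2.1, h₃.eq _ hy.2.2.2] using this
  · intro y hy u q h' hs _
    have hK : ∀ k i j, (i = 0 ∧ j = 0 ∨ i = 0 ∧ j = 2 ∨ i = 1 ∧ j = 2) →
        secondPartial φ y k i j = 0 := by
      rintro k i j hij
      refine secondPartial_eq_of_hasDerivAt hW hφ hy (fun z hz => by rw [hJ z hz]) ?_
      rcases hij with ⟨rfl, rfl⟩ | ⟨rfl, rfl⟩ | ⟨rfl, rfl⟩ <;> fin_cases k <;> simp <;>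
        exact hasDerivAt_const _ _
    refine ⟨deriv χ₂ (y 1) ^ 2 * deriv χ₃ (y 2),
      mul_ne_zero (pow_ne_zero _ (h₂.deriv_ne_zero _ hy.2.2.1)) (h₃.deriv_ne_zero _ hy.2.2.2), ?_⟩
    have e₂ := h₂.eq _ hy.2.2.1
    have e₃ := h₃.eq _ hy.2.2.2
    simp only [webPDE, pullHessian, Matrix.of_apply, Fin.sum_univ_three, hJ y hy, Matrix.mulVec,
      dotProduct, Matrix.transpose_apply, e₂, e₃, φ, h₂.deriv_eq hy.2.2.1,
      hK _ 0 0 (by decide), hK _ 0 2 (by decide), hK _ 1 2 (by decide)]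
    simp
    ring

theorem hasDerivAt_comp_zCoord {Z : ℂ → ℂ} {y : R3} (hZ : AnalyticAt ℂ Z (zCoord y)) (i : Fin 3) :
    HasDerivAt (fun s => Z (zCoord (Function.update y i s)))
      (deriv Z (zCoord y) * ![1, Complex.I, 0] i) (y i) := by
  have hz : HasDerivAt (fun s => zCoord (Function.update y i s)) (![1, Complex.I, 0] i) (y i) := by
    have h0 : HasDerivAt (fun s : ℝ => (s : ℂ)) 1 (y i) := Complex.ofRealCLM.hasDerivAt
    have hzc : ∀ w : R3, zCoord w = w 0 + w 1 * Complex.I := fun w => Complex.mk_eq_add_mul_I _ _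
    simp only [hzc]
    fin_cases i
    · simpa using h0.add_const ((y 1 : ℂ) * Complex.I)
    · simpa using (h0.mul_const Complex.I).const_add (y 0 : ℂ)
    · simpa using hasDerivAt_const (y 2) ((y 0 : ℂ) + y 1 * Complex.I)
  have hZ' := hZ.differentiableAt.hasDerivAt.hasFDerivAt.restrictScalars ℝ
  have := HasFDerivAt.comp_hasDerivAt (y i) (f := fun s => zCoord (Function.update y i s))
    (by simpa using hZ') hz
  simpa [Function.comp_def, mul_comm] using this

theorem contDiff_zCoord : ContDiff ℝ ∞ zCoord := by
  have hzc : zCoord = fun w : R3 => (w 0 : ℂ) + w 1 * Complex.I :=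
    funext fun w => Complex.mk_eq_add_mul_I _ _
  have h : ∀ i : Fin 3, ContDiff ℝ ∞ fun w : R3 => (w i : ℂ) := fun i =>
    Complex.ofRealCLM.contDiff.comp (contDiff_apply ℝ ℝ i)
  rw [hzc]
  exact (h 0).add ((h 1).mul contDiff_const)

/-- The equation is built from `f₁² + f₂²`-like and area-like pairings in the first two variables,
and a conformal map scales both by `|Z'|²`. -/
theorem pseudogroupEquivalent_D {Ω : Set R3} (hΩ : IsOpen Ω) {L M Z : ℂ → ℂ} {l₃ m₃ χ₃ : ℝ → ℝ}
    {I : Set ℂ} {I₃ : Set ℝ} (hL : IsComplexReparametrization L M Z I)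
    (h₃ : IsReparametrization l₃ m₃ χ₃ I₃)
    (hnd : Ω ⊆ nondegLocus .D (L, l₃)) {x : R3} (hx : x ∈ Ω)
    (hxz : zCoord x ∈ I) (hx₃ : x 2 ∈ I₃) :
    PseudogroupEquivalent .D Ω (L, l₃) x (nondegLocus .D (M, m₃)) (M, m₃)
      ![(Z (zCoord x)).re, (Z (zCoord x)).im, χ₃ (x 2)] := by
  set W : Set R3 := Ω ∩ (zCoord ⁻¹' I ∩ {y | y 2 ∈ I₃}) with hWdef
  have hW : IsOpen W := hΩ.inter ((hL.isOpen.preimage contDiff_zCoord.continuous).inter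
    (h₃.isOpen.preimage (continuous_apply 2)))
  have hxW : x ∈ W := ⟨hx, hxz, hx₃⟩
  let φ : R3 → R3 := fun y => ![(Z (zCoord y)).re, (Z (zCoord y)).im, χ₃ (y 2)]
  have hZ : ContDiffOn ℝ ∞ (fun y => Z (zCoord y)) W := fun y hy =>
    (((hL.analyticAt _ hy.2.1).restrictScalars (𝕜 := ℝ)).contDiffAt.comp y
      contDiff_zCoord.contDiffAt).contDiffWithinAt
  have hφ : ContDiffOn ℝ ∞ φ W := by
    refine contDiffOn_pi.2 fun k => ?_
    fin_cases k
    · exact Complex.reCLM.contDiff.comp_contDiffOn hZ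
    · exact Complex.imCLM.contDiff.comp_contDiffOn hZ
    · exact contDiffOn_comp_coord h₃.contDiffOn fun y hy => hy.2.2
  have hre : ∀ {F : ℂ → ℂ} {y : R3} (_ : AnalyticAt ℂ F (zCoord y)) (i : Fin 3),
      HasDerivAt (fun s => (F (zCoord (Function.update y i s))).re)
        (deriv F (zCoord y) * ![1, Complex.I, 0] i).re (y i) := fun hF i =>
    Complex.reCLM.hasFDerivAt.comp_hasDerivAt _ (hasDerivAt_comp_zCoord hF i)
  have him : ∀ {F : ℂ → ℂ} {y : R3} (_ : AnalyticAt ℂ F (zCoord y)) (i : Fin 3),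
      HasDerivAt (fun s => (F (zCoord (Function.update y i s))).im)
        (deriv F (zCoord y) * ![1, Complex.I, 0] i).im (y i) := fun hF i =>
    Complex.imCLM.hasFDerivAt.comp_hasDerivAt _ (hasDerivAt_comp_zCoord hF i)
  have hJ : ∀ y ∈ W, jacobian φ y =
      !![(deriv Z (zCoord y)).re, -(deriv Z (zCoord y)).im, 0;
        (deriv Z (zCoord y)).im, (deriv Z (zCoord y)).re, 0; 0, 0, deriv χ₃ (y 2)] := by
    intro y hy
    have hd : DifferentiableAt ℝ φ y := (hφ.contDiffAt (hW.mem_nhds hy)).differentiableAt (by simp)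
    have e₃ := h₃.hasDerivAt hy.2.2
    have hZy := hL.analyticAt _ hy.2.1
    ext k i
    fin_cases k
    · refine jacobian_eq_of_hasDerivAt hd ((hre hZy i).congr_deriv ?_)
      fin_cases i <;> simp
    · refine jacobian_eq_of_hasDerivAt hd ((him hZy i).congr_deriv ?_)
      fin_cases i <;> simp
    · fin_cases i <;> refine jacobian_eq_of_hasDerivAt hd ?_ <;> simp [φ, hasDerivAt_const, e₃]
  have hnorm : ∀ y ∈ W, (deriv Z (zCoord y)).re ^ 2 + (deriv Z (zCoord y)).im ^ 2 ≠ 0 := by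
    intro y hy h0
    apply hL.deriv_ne_zero _ hy.2.1
    apply Complex.ext
    · exact pow_eq_zero_iff two_ne_zero |>.1
        (by nlinarith [sq_nonneg (deriv Z (zCoord y)).re, sq_nonneg (deriv Z (zCoord y)).im])
    · exact pow_eq_zero_iff two_ne_zero |>.1
        (by nlinarith [sq_nonneg (deriv Z (zCoord y)).re, sq_nonneg (deriv Z (zCoord y)).im])
  have hcoord : ∀ y, zCoord (φ y) = Z (zCoord y) := fun y => Complex.ext rfl rfl
  refine pseudogroupEquivalent_of_pullback hW hxW Set.inter_subset_left hφ
    ⟨Z, χ₃, fun y hy => ⟨hL.analyticAt _ hy.2.1, rfl⟩⟩ ?_ ?_ rfl ?_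
  · rw [hJ x hxW, Matrix.det_fin_three]
    have := mul_ne_zero (hnorm x hxW) (h₃.deriv_ne_zero _ hx₃)
    intro h0
    apply this
    simp at h0
    linear_combination h0
  · intro y hy
    have := hnd hy.1
    simpa [nondegLocus, hcoord, hL.eq _ hy.2.1] using this
  · intro y hy u q h' hs _
    have hZy := (hL.analyticAt _ hy.2.1).deriv
    have hK : ∀ k i, (i = 0 ∨ i = 1) → secondPartial φ y k i 2 = 0 := by
      intro k i hi
      refine secondPartial_eq_of_hasDerivAt hW hφ hy (fun z hz => by rw [hJ z hz]) ?_
      rcases hi with rfl | rfl <;> fin_cases k <;> simp [zCoord] <;> exact hasDerivAt_const _ _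
    -- The components of `Z` are harmonic, so these second partials come in opposite pairs and drop
    -- out of `f₁₁ + f₂₂`.
    have hK₀ : secondPartial φ y 0 0 0 = (deriv (deriv Z) (zCoord y)).re :=
      secondPartial_eq_of_hasDerivAt hW hφ hy (fun z hz => by rw [hJ z hz])
        (by simpa using hre hZy 0)
    have hK₁ : secondPartial φ y 1 0 0 = (deriv (deriv Z) (zCoord y)).im :=
      secondPartial_eq_of_hasDerivAt hW hφ hy (fun z hz => by rw [hJ z hz])
        (by simpa using him hZy 0)
    have hK₂ : secondPartial φ y 2 0 0 = 0 :=
      secondPartial_eq_of_hasDerivAt hW hφ hy (fun z hz => by rw [hJ z hz])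
        (by simpa using hasDerivAt_const _ _)
    have hK₃ : secondPartial φ y 0 1 1 = -(deriv (deriv Z) (zCoord y)).re :=
      secondPartial_eq_of_hasDerivAt hW hφ hy (fun z hz => by rw [hJ z hz])
        (by simpa using (him hZy 1).fun_neg)
    have hK₄ : secondPartial φ y 1 1 1 = -(deriv (deriv Z) (zCoord y)).im :=
      secondPartial_eq_of_hasDerivAt hW hφ hy (fun z hz => by rw [hJ z hz])
        (by simpa using hre hZy 1)
    have hK₅ : secondPartial φ y 2 1 1 = 0 :=
      secondPartial_eq_of_hasDerivAt hW hφ hy (fun z hz => by rw [hJ z hz])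
        (by simpa using hasDerivAt_const _ _)
    refine ⟨((deriv Z (zCoord y)).re ^ 2 + (deriv Z (zCoord y)).im ^ 2) * deriv χ₃ (y 2),
      mul_ne_zero (hnorm y hy) (h₃.deriv_ne_zero _ hy.2.2), ?_⟩
    have e₁ := hL.eq _ hy.2.1
    have e₃ := h₃.eq _ hy.2.2
    have s₁ := hs.apply 0 1
    simp only [webPDE, hcoord, pullHessian, Matrix.of_apply, Fin.sum_univ_three, hJ y hy,
      Matrix.mulVec, dotProduct, Matrix.transpose_apply, e₁, e₃, hK _ 0 (Or.inl rfl),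
      hK _ 1 (Or.inr rfl), hK₀, hK₁, hK₂, hK₃, hK₄, hK₅]
    simp [φ, s₁]
    ring

/-! The integral in class C is `x₂² G(λ x₂)` with the smooth function
`G(y) = ∫₀¹ r exp (r y) dr`. -/

theorem integral_mul_exp_eq (a b : ℝ) :
    ∫ s in (0 : ℝ)..b, s * Real.exp (a * s) =
      b ^ 2 * ∫ r in (0 : ℝ)..1, r ^ 1 * Real.exp (0 + r * (a * b - 0)) := by
  have h := intervalIntegral.mul_integral_comp_mul_left (a := 0) (b := 1)
    (f := fun s => s * Real.exp (a * s)) b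
  rw [mul_zero, mul_one] at h
  rw [← h, sq, mul_assoc]
  congr 1
  rw [← intervalIntegral.integral_const_mul]
  congr 1
  funext r
  ring_nf

/-- The pseudogroup element has `X₃ = χ` and constant `X₁`, `X₂`. The integral in its first
component produces the `χ''` terms that compensate `λ₃'' = m₃'' χ'² + m₃' χ''`. -/
theorem pseudogroupEquivalent_C {Ω : Set R3} (hΩ : IsOpen Ω) {l₃ m₃ χ : ℝ → ℝ}
    {I : Set ℝ} (h : IsReparametrization l₃ m₃ χ I) {x : R3} (hx : x ∈ Ω) (hx₃ : x 2 ∈ I) :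
    PseudogroupEquivalent .C Ω l₃ x (nondegLocus .C m₃) m₃ ![0, 0, χ (x 2)] := by
  set W : Set R3 := Ω ∩ {y | y 0 ∈ Set.univ ∧ y 1 ∈ Set.univ ∧ y 2 ∈ I} with hWdef
  have hW : IsOpen W := isOpen_inter_box hΩ isOpen_univ isOpen_univ h.isOpen
  have hxW : x ∈ W := ⟨hx, Set.mem_univ _, Set.mem_univ _, hx₃⟩
  -- `X₂ = c` moves the second coordinate of `x` to `0`; `X₁ = -ψ x` does the same for the first.
  obtain ⟨c, hc⟩ : ∃ c : ℝ, deriv χ (x 2) * x 1 + c = 0 := ⟨_, add_neg_cancel _⟩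
  let ψ : R3 → ℝ := fun y =>
    deriv χ (y 2) * Real.exp (deriv l₃ (y 2) * (c / deriv χ (y 2))) * y 0
      + ∫ s in (0 : ℝ)..(y 1), (deriv (deriv χ) (y 2) * s) *
          Real.exp (deriv l₃ (y 2) * (s + c / deriv χ (y 2)))
  let φ : R3 → R3 := fun y => ![ψ y + -ψ x, deriv χ (y 2) * y 1 + c, χ (y 2)]
  have hτ : ∀ s ∈ I, deriv χ s ≠ 0 := h.deriv_ne_zero
  have hl : ∀ s ∈ I, deriv l₃ s = deriv m₃ (χ s) * deriv χ s := fun s hs => h.deriv_eq hs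
  have hm' : ContDiff ℝ ∞ (deriv m₃) := (contDiff_infty_iff_deriv.1 h.contDiff_model).2
  -- With `λ₃' = m₃' χ'` the quotient by `χ'` cancels, and rescaling to a fixed interval makes joint
  -- smoothness in `x₂` and `x₃` visible.
  have hψ : ∀ y ∈ W, ψ y = deriv χ (y 2) * Real.exp (deriv m₃ (χ (y 2)) * c) * y 0
      + deriv (deriv χ) (y 2) * Real.exp (deriv m₃ (χ (y 2)) * c) * (y 1 ^ 2 *
        ∫ r in (0 : ℝ)..1, r ^ 1 *
          Real.exp (0 + r * (deriv m₃ (χ (y 2)) * deriv χ (y 2) * y 1 - 0))) := by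
    intro y hy
    have hτy := hτ _ hy.2.2.2
    simp only [ψ, hl _ hy.2.2.2]
    rw [← integral_mul_exp_eq, ← intervalIntegral.integral_const_mul]
    congr 2
    · field_simp
    · funext s
      rw [show deriv m₃ (χ (y 2)) * deriv χ (y 2) * (s + c / deriv χ (y 2))
        = deriv m₃ (χ (y 2)) * c + deriv m₃ (χ (y 2)) * deriv χ (y 2) * s by field_simp; ring,
        Real.exp_add]
      ring
  have hχ₀ : ContDiffOn ℝ ∞ (fun y : R3 => χ (y 2)) W :=
    contDiffOn_comp_coord h.contDiffOn fun y hy => hy.2.2.2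
  have hχ₁ : ContDiffOn ℝ ∞ (fun y : R3 => deriv χ (y 2)) W :=
    contDiffOn_comp_coord h.contDiffOn_deriv fun y hy => hy.2.2.2
  have hχ₂ : ContDiffOn ℝ ∞ (fun y : R3 => deriv (deriv χ) (y 2)) W :=
    contDiffOn_comp_coord (h.contDiffOn_deriv.deriv_of_isOpen h.isOpen (by simp))
      fun y hy => hy.2.2.2
  have hμ : ContDiffOn ℝ ∞ (fun y : R3 => deriv m₃ (χ (y 2))) W := hm'.comp_contDiffOn hχ₀
  have hcoord : ∀ i, ContDiffOn ℝ ∞ (fun y : R3 => y i) W := fun i =>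
    (contDiff_apply ℝ ℝ i).contDiffOn
  have hE : ContDiffOn ℝ ∞ (fun y : R3 => Real.exp (deriv m₃ (χ (y 2)) * c)) W :=
    (hμ.mul contDiffOn_const).exp
  have hG : ContDiffOn ℝ ∞ (fun y : R3 => ∫ r in (0 : ℝ)..1, r ^ 1 *
      Real.exp (0 + r * (deriv m₃ (χ (y 2)) * deriv χ (y 2) * y 1 - 0))) W :=
    (contDiff_integral_dilation Real.contDiff_exp 0 1).comp_contDiffOn
      ((hμ.mul hχ₁).mul (hcoord 1))
  have hψs : ContDiffOn ℝ ∞ ψ W :=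
    (((hχ₁.mul hE).mul (hcoord 0)).add ((hχ₂.mul hE).mul (((hcoord 1).pow 2).mul hG))).congr hψ
  have hφ : ContDiffOn ℝ ∞ φ W := by
    refine contDiffOn_pi.2 fun k => ?_
    fin_cases k
    · exact hψs.add contDiffOn_const
    · exact (hχ₁.mul (hcoord 1)).add contDiffOn_const
    · exact hχ₀
  -- The entry `∂₃φ₁` is left unevaluated: it enters both `f₃` and `f₁₃` and cancels in `f₁ f₁₃ - f₃
  -- f₁₁`.
  have hJ : ∀ y ∈ W, jacobian φ y =
      !![deriv χ (y 2) * Real.exp (deriv m₃ (χ (y 2)) * c),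
        deriv (deriv χ) (y 2) * y 1 * Real.exp (deriv m₃ (χ (y 2)) * (deriv χ (y 2) * y 1 + c)),
        jacobian φ y 0 2;
        0, deriv χ (y 2), deriv (deriv χ) (y 2) * y 1; 0, 0, deriv χ (y 2)] := by
    intro y hy
    have hd : DifferentiableAt ℝ φ y := (hφ.contDiffAt (hW.mem_nhds hy)).differentiableAt (by simp)
    have hτy := hτ _ hy.2.2.2
    have hly := hl _ hy.2.2.2
    have e₀₀ : HasDerivAt (fun s => φ (Function.update y 0 s) 0)
        (deriv χ (y 2) * Real.exp (deriv m₃ (χ (y 2)) * c)) (y 0) := by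
      have e := (((hasDerivAt_id (y 0)).const_mul (deriv χ (y 2) *
        Real.exp (deriv l₃ (y 2) * (c / deriv χ (y 2))))).add_const
        (∫ s in (0 : ℝ)..(y 1), (deriv (deriv χ) (y 2) * s) *
          Real.exp (deriv l₃ (y 2) * (s + c / deriv χ (y 2))))).add_const (-ψ x)
      refine HasDerivAt.congr_deriv (f := fun s => φ (Function.update y 0 s) 0)
        (by simpa [φ, ψ] using e) ?_
      rw [hly]
      field_simp
    have e₀₁ : HasDerivAt (fun s => φ (Function.update y 1 s) 0)
        (deriv (deriv χ) (y 2) * y 1 *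
          Real.exp (deriv m₃ (χ (y 2)) * (deriv χ (y 2) * y 1 + c))) (y 1) := by
      have hcont : Continuous fun s => (deriv (deriv χ) (y 2) * s) *
          Real.exp (deriv l₃ (y 2) * (s + c / deriv χ (y 2))) := by fun_prop
      have e := ((hcont.integral_hasStrictDerivAt 0 (y 1)).hasDerivAt.const_add (deriv χ (y 2) *
        Real.exp (deriv l₃ (y 2) * (c / deriv χ (y 2))) * y 0)).add_const (-ψ x)
      refine HasDerivAt.congr_deriv (f := fun s => φ (Function.update y 1 s) 0)
        (by simpa [φ, ψ] using e) ?_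
      rw [hly]
      congr 2
      field_simp
    have e₁₁ : HasDerivAt (fun s => deriv χ (y 2) * s) (deriv χ (y 2)) (y 1) := by
      simpa using (hasDerivAt_id (y 1)).const_mul (deriv χ (y 2))
    have e₁₂ := (h.hasDerivAt_deriv hy.2.2.2).mul_const (y 1)
    have e₂ := h.hasDerivAt hy.2.2.2
    ext k i
    fin_cases k
    · fin_cases i
      · exact jacobian_eq_of_hasDerivAt hd e₀₀
      · exact jacobian_eq_of_hasDerivAt hd e₀₁
      · rfl
    all_goals fin_cases i <;> refine jacobian_eq_of_hasDerivAt hd ?_ <;>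
      simp [φ, hasDerivAt_const, e₁₁, e₁₂, e₂]
  refine pseudogroupEquivalent_of_pullback hW hxW Set.inter_subset_left hφ
    ⟨fun _ => -ψ x, fun _ => c, χ, fun y _ => by simp [φ, ψ]⟩ ?_ (fun _ _ => Set.mem_univ _)
    (by simp [φ, hc]) ?_
  · rw [hJ x hxW, Matrix.det_fin_three]
    simp [hτ _ hx₃]
  · intro y hy u q h' hs _
    have hτy := hτ _ hy.2.2.2
    have hμ' : HasDerivAt (fun s => deriv m₃ (χ s)) (deriv (deriv m₃) (χ (y 2)) * deriv χ (y 2))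
        (y 2) := ((hm'.differentiable (by simp)) _).hasDerivAt.comp _ (h.hasDerivAt hy.2.2.2)
    have hl' : deriv (deriv l₃) (y 2) = deriv (deriv m₃) (χ (y 2)) * deriv χ (y 2) * deriv χ (y 2)
        + deriv m₃ (χ (y 2)) * deriv (deriv χ) (y 2) := by
      have : deriv l₃ =ᶠ[nhds (y 2)] fun s => deriv m₃ (χ s) * deriv χ s := by
        filter_upwards [h.isOpen.mem_nhds hy.2.2.2] with s hs using hl s hs
      rw [this.deriv_eq]
      exact (hμ'.fun_mul (h.hasDerivAt_deriv hy.2.2.2)).deriv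
    have hK : ∀ k i j, (i = 0 ∧ j = 0 ∨ i = 0 ∧ j = 1 ∨ i = 0 ∧ j = 2 ∧ k ≠ 0 ∨
        i = 1 ∧ j = 1 ∧ k ≠ 0) → secondPartial φ y k i j = 0 := by
      rintro k i j hij
      refine secondPartial_eq_of_hasDerivAt hW hφ hy (fun z hz => by rw [hJ z hz]) ?_
      rcases hij with ⟨rfl, rfl⟩ | ⟨rfl, rfl⟩ | ⟨rfl, rfl, hk⟩ | ⟨rfl, rfl, hk⟩
      · fin_cases k <;> simp <;> exact hasDerivAt_const _ _
      · fin_cases k <;> simp <;> exact hasDerivAt_const _ _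
      · fin_cases k <;> simp at hk ⊢ <;> exact hasDerivAt_const _ _
      · fin_cases k <;> simp at hk ⊢ <;> exact hasDerivAt_const _ _
    have hK₀ : secondPartial φ y 0 0 2 =
        deriv (deriv χ) (y 2) * Real.exp (deriv m₃ (χ (y 2)) * c) + deriv χ (y 2) *
          (Real.exp (deriv m₃ (χ (y 2)) * c) *
            (deriv (deriv m₃) (χ (y 2)) * deriv χ (y 2) * c)) := by
      refine secondPartial_eq_of_hasDerivAt hW hφ hy (fun z hz => by rw [hJ z hz]) ?_
      simpa using (h.hasDerivAt_deriv hy.2.2.2).fun_mul (hμ'.mul_const c).exp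
    have hK₁ : secondPartial φ y 0 1 1 =
        deriv (deriv χ) (y 2) * Real.exp (deriv m₃ (χ (y 2)) * (deriv χ (y 2) * y 1 + c))
          + deriv (deriv χ) (y 2) * y 1 *
            (Real.exp (deriv m₃ (χ (y 2)) * (deriv χ (y 2) * y 1 + c)) *
              (deriv m₃ (χ (y 2)) * deriv χ (y 2))) := by
      refine secondPartial_eq_of_hasDerivAt hW hφ hy (fun z hz => by rw [hJ z hz]) ?_
      have e₁ := (hasDerivAt_id (y 1)).const_mul (deriv (deriv χ) (y 2))
      have e₂ := ((((hasDerivAt_id (y 1)).const_mul (deriv χ (y 2))).add_const c).const_mul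
        (deriv m₃ (χ (y 2)))).exp
      simpa using e₁.fun_mul e₂
    refine ⟨(deriv χ (y 2) * Real.exp (deriv m₃ (χ (y 2)) * c)) ^ 2 * deriv χ (y 2),
      mul_ne_zero (pow_ne_zero _ (mul_ne_zero hτy (Real.exp_ne_zero _))) hτy, ?_⟩
    obtain ⟨g, hJg⟩ : ∃ g : ℝ, jacobian φ y =
        !![deriv χ (y 2) * Real.exp (deriv m₃ (χ (y 2)) * c),
          deriv (deriv χ) (y 2) * y 1 * Real.exp (deriv m₃ (χ (y 2)) * (deriv χ (y 2) * y 1 + c)),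
          g; 0, deriv χ (y 2), deriv (deriv χ) (y 2) * y 1; 0, 0, deriv χ (y 2)] :=
      ⟨_, hJ y hy⟩
    have s₁ := hs.apply 0 1
    -- Splitting the exponential leaves two independent nonzero quantities, so the final identity is
    -- one of rational functions.
    have x₁ : Real.exp (deriv m₃ (χ (y 2)) * (deriv χ (y 2) * y 1 + c)) =
        Real.exp (deriv m₃ (χ (y 2)) * deriv χ (y 2) * y 1) *
          Real.exp (deriv m₃ (χ (y 2)) * c) := by
      rw [← Real.exp_add]
      ring_nf
    simp only [webPDE, hl', hl _ hy.2.2.2, pullHessian, Matrix.of_apply, Fin.sum_univ_three,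
      hJg, Matrix.mulVec, dotProduct, Matrix.transpose_apply, hK _ 0 0 (by simp),
      hK _ 0 1 (by simp), hK 1 0 2 (by simp), hK 2 0 2 (by simp), hK 1 1 1 (by simp),
      hK 2 1 1 (by simp), hK₀, hK₁]
    simp only [φ, Matrix.cons_val_zero, Matrix.cons_val_one, Matrix.cons_val,
      Matrix.cons_val', Real.exp_neg, x₁, s₁]
    have hne := Real.exp_ne_zero (deriv m₃ (χ (y 2)) * deriv χ (y 2) * y 1)
    have hne' := Real.exp_ne_zero (deriv m₃ (χ (y 2)) * c)
    field_simp
    ring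

end

noncomputable section

/-! ### Normal forms -/

/-- Either `t` is not critical for `g`, or `g` is constant near `t`. -/
def RegularAt {𝕜 : Type} [RCLike 𝕜] (g : 𝕜 → 𝕜) (t : 𝕜) : Prop :=
  deriv g t ≠ 0 ∨ ∀ᶠ s in nhds t, g s = g t

theorem RegularAt.eventually {𝕜 : Type} [RCLike 𝕜] {g : 𝕜 → 𝕜} {t : 𝕜} (h : RegularAt g t)
    (hc : ContinuousAt (deriv g) t) : ∀ᶠ s in nhds t, RegularAt g s := by
  rcases h with h | h
  · filter_upwards [hc.eventually_ne h] with s hs using Or.inl hs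
  · filter_upwards [eventually_eventually_nhds.2 h, h] with s hs hs'
    right
    filter_upwards [hs] with r hr
    rw [hr, hs']

/-- On a small ball either the derivative is nonzero somewhere, or it vanishes identically and the
function is constant there. -/
theorem exists_regularAt {𝕜 : Type} [RCLike 𝕜] {g : 𝕜 → 𝕜} {t : 𝕜}
    (hg : ∀ᶠ s in nhds t, DifferentiableAt 𝕜 g s) {ε : ℝ} (hε : 0 < ε) :
    ∃ s, dist s t < ε ∧ RegularAt g s := by
  obtain ⟨r, hr, hball⟩ := Metric.eventually_nhds_iff_ball.1 hg
  by_cases h : ∃ s ∈ Metric.ball t (min r ε), deriv g s ≠ 0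
  · obtain ⟨s, hs, hd⟩ := h
    exact ⟨s, (Metric.mem_ball.1 hs).trans_le (min_le_right _ _), Or.inl hd⟩
  · push Not at h
    refine ⟨t, by simpa using hε, Or.inr ?_⟩
    have ht : 0 < min r ε := lt_min hr hε
    filter_upwards [Metric.ball_mem_nhds t ht] with s hs
    refine Metric.isOpen_ball.is_const_of_deriv_eq_zero (𝕜 := 𝕜)
      (Metric.isPreconnected_ball (x := t) (r := min r ε)) (fun z hz => ?_) h hs
      (Metric.mem_ball_self ht)
    exact (hball z (Metric.ball_subset_ball (min_le_left _ _) hz)).differentiableWithinAt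

theorem exists_regularAt_of_contDiffAt {g : ℝ → ℝ} {t : ℝ}
    (hg : ∀ᶠ s in nhds t, ContDiffAt ℝ ∞ g s) {ε : ℝ} (hε : 0 < ε) :
    ∃ s, dist s t < ε ∧ RegularAt g s :=
  exists_regularAt (hg.mono fun _ h => h.differentiableAt (by simp)) hε

theorem eventually_update_mem {Ω : Set R3} (hΩ : IsOpen Ω) {x : R3} (hx : x ∈ Ω) (i : Fin 3) :
    ∀ᶠ s in nhds (x i), Function.update x i s ∈ Ω := by
  have hc : Continuous (Function.update x i) := continuous_const.update i continuous_id
  exact hc.continuousAt.eventually_mem (hΩ.mem_nhds (by simpa using hx))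

theorem eventually_contDiffAt_coord {Ω : Set R3} (hΩ : IsOpen Ω) {g : ℝ → ℝ} {i : Fin 3}
    (h : ∀ x ∈ Ω, ContDiffAt ℝ ∞ g (x i)) {x : R3} (hx : x ∈ Ω) :
    ∀ᶠ s in nhds (x i), ContDiffAt ℝ ∞ g s := by
  filter_upwards [eventually_update_mem hΩ hx i] with s hs
  simpa using h _ hs

theorem eventually_regularAt_coord {Ω : Set R3} (hΩ : IsOpen Ω) {g : ℝ → ℝ} {i : Fin 3}
    (h : ∀ x ∈ Ω, ContDiffAt ℝ ∞ g (x i)) {x : R3} (hx : x ∈ Ω) (hr : RegularAt g (x i)) :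
    ∀ᶠ y in nhds x, RegularAt g (y i) :=
  (continuous_apply i).continuousAt.eventually (hr.eventually
    (continuousAt_deriv_of_eventually_contDiffAt (eventually_contDiffAt_coord hΩ h hx)))

theorem PseudogroupEquivalent.target_mem {X : WebClass} {Ω Ω' : Set R3} {l m : WebParam X}
    {x y : R3} (h : PseudogroupEquivalent X Ω l x Ω' m y) : y ∈ Ω' := by
  obtain ⟨W, Φ, -, hx, -, -, h1, h2, -⟩ := h
  rw [← h2 (x, 0, 0) rfl]
  exact h1 (x, 0, 0) hx

theorem subset_closure_of_forall_ball {Ω V : Set R3} (hΩ : IsOpen Ω)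
    (h : ∀ x ∈ Ω, ∀ ε > 0, Metric.ball x ε ⊆ Ω → ∃ y ∈ Metric.ball x ε, y ∈ V) :
    Ω ⊆ closure V := by
  intro x hx
  rw [Metric.mem_closure_iff]
  intro ε hε
  obtain ⟨r, hr, hball⟩ := Metric.isOpen_iff.1 hΩ x hx
  obtain ⟨y, hy, hyV⟩ := h x hx (min ε r) (lt_min hε hr)
    ((Metric.ball_subset_ball (min_le_right _ _)).trans hball)
  refine ⟨y, hyV, ?_⟩
  rw [dist_comm]
  exact (Metric.mem_ball.1 hy).trans_le (min_le_left _ _)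

theorem vec3_mem_ball {x : R3} {ε s₀ s₁ s₂ : ℝ} (hε : 0 < ε) (h₀ : dist s₀ (x 0) < ε)
    (h₁ : dist s₁ (x 1) < ε) (h₂ : dist s₂ (x 2) < ε) : (![s₀, s₁, s₂] : R3) ∈ Metric.ball x ε := by
  rw [Metric.mem_ball, dist_pi_lt_iff hε]
  intro i
  fin_cases i
  · exact h₀
  · exact h₁
  · exact h₂

/-- The models are globally smooth, so their full nondegeneracy locus can serve as target domain,
and nondegeneracy is then automatic. -/
theorem isWebParam_nondegLocus_A {m₁ m₂ m₃ : ℝ → ℝ} (h₁ : ContDiff ℝ ∞ m₁)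
    (h₂ : ContDiff ℝ ∞ m₂) (h₃ : ContDiff ℝ ∞ m₃) :
    IsWebParam .A (nondegLocus .A (m₁, m₂, m₃)) (m₁, m₂, m₃) where
  isOpen := by
    have c₁ := h₁.continuous
    have c₂ := h₂.continuous
    have c₃ := h₃.continuous
    have o₁ : IsOpen {x : R3 | m₁ (x 0) ≠ m₂ (x 1)} := isOpen_ne_fun (by fun_prop) (by fun_prop)
    have o₂ : IsOpen {x : R3 | m₂ (x 1) ≠ m₃ (x 2)} := isOpen_ne_fun (by fun_prop) (by fun_prop)
    have o₃ : IsOpen {x : R3 | m₁ (x 0) ≠ m₃ (x 2)} := isOpen_ne_fun (by fun_prop) (by fun_prop)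
    exact o₁.inter (o₂.inter o₃)
  smooth := fun _ _ => ⟨h₁.contDiffAt, h₂.contDiffAt, h₃.contDiffAt⟩
  nondeg := subset_rfl

theorem isWebParam_nondegLocus_B {m₂ m₃ : ℝ → ℝ} (h₂ : ContDiff ℝ ∞ m₂) (h₃ : ContDiff ℝ ∞ m₃) :
    IsWebParam .B (nondegLocus .B (m₂, m₃)) (m₂, m₃) where
  isOpen := by
    have c₂ := h₂.continuous
    have c₃ := h₃.continuous
    exact (isOpen_ne_fun (by fun_prop) (by fun_prop) : IsOpen {x : R3 | m₂ (x 1) ≠ m₃ (x 2)})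
  smooth := fun _ _ => ⟨h₂.contDiffAt, h₃.contDiffAt⟩
  nondeg := subset_rfl

theorem isWebParam_nondegLocus_C {m₃ : ℝ → ℝ} (h₃ : ContDiff ℝ ∞ m₃) :
    IsWebParam .C (nondegLocus .C m₃) m₃ where
  isOpen := isOpen_univ
  smooth := fun _ _ => h₃.contDiffAt
  nondeg := subset_rfl

theorem isWebParam_nondegLocus_D {M : ℂ → ℂ} {m₃ : ℝ → ℝ} (hM : ∀ z, AnalyticAt ℂ M z)
    (h₃ : ContDiff ℝ ∞ m₃) : IsWebParam .D (nondegLocus .D (M, m₃)) (M, m₃) where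
  isOpen := by
    have c : Continuous M := continuous_iff_continuousAt.2 fun z => (hM z).continuousAt
    have c' : Continuous zCoord := contDiff_zCoord.continuous
    exact (isOpen_ne_fun (by fun_prop) (by fun_prop) : IsOpen {x : R3 | (M (zCoord x)).im ≠ 0})
  smooth := fun _ _ => ⟨hM _, h₃.contDiffAt⟩
  nondeg := subset_rfl

/-- The normal forms of one equation at nonflat points, on an open dense set, and at generic
points. -/
def HasNormalForms (X : WebClass) (Ω : Set R3) (l : WebParam X) : Prop :=
  (∀ x ∈ Ω, ParamNonflatAt X l x →
    ∃ (Ω' : Set R3) (m : WebParam X), IsWebParam X Ω' m ∧ (0 : R3) ∈ Ω' ∧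
      ParamMonomial X m ∧ PseudogroupEquivalent X Ω l x Ω' m 0) ∧
  (∃ V : Set R3, IsOpen V ∧ V ⊆ Ω ∧ Ω ⊆ closure V ∧ ∀ x ∈ V,
    ∃ (Ω' : Set R3) (m : WebParam X) (y : R3), IsWebParam X Ω' m ∧ y ∈ Ω' ∧
      ParamBasic X m ∧ PseudogroupEquivalent X Ω l x Ω' m y) ∧
  (∀ x ∈ Ω, ParamGenericAt X l x →
    ∃ y ∈ nondegLocus X (stdParam X),
      PseudogroupEquivalent X Ω l x (nondegLocus X (stdParam X)) (stdParam X) y)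

theorem vec3_zero {a b c : ℝ} (ha : a = 0) (hb : b = 0) (hc : c = 0) : (![a, b, c] : R3) = 0 := by
  subst ha hb hc
  ext i
  fin_cases i <;> rfl

/-- Each parameter depends on its own coordinate, so reparametrizations and nearby regular points
can be chosen independently and combined. -/
theorem hasNormalForms_A {Ω : Set R3} {l₁ l₂ l₃ : ℝ → ℝ} (hl : IsWebParam .A Ω (l₁, l₂, l₃)) :
    HasNormalForms .A Ω (l₁, l₂, l₃) := by
  have s₁ : ∀ x ∈ Ω, ContDiffAt ℝ ∞ l₁ (x 0) := fun x hx => (hl.smooth x hx).1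
  have s₂ : ∀ x ∈ Ω, ContDiffAt ℝ ∞ l₂ (x 1) := fun x hx => (hl.smooth x hx).2.1
  have s₃ : ∀ x ∈ Ω, ContDiffAt ℝ ∞ l₃ (x 2) := fun x hx => (hl.smooth x hx).2.2
  have e₁ := fun x hx => eventually_contDiffAt_coord hl.isOpen s₁ (x := x) hx
  have e₂ := fun x hx => eventually_contDiffAt_coord hl.isOpen s₂ (x := x) hx
  have e₃ := fun x hx => eventually_contDiffAt_coord hl.isOpen s₃ (x := x) hx
  refine ⟨?_, ⟨{x ∈ Ω | RegularAt l₁ (x 0) ∧ RegularAt l₂ (x 1) ∧ RegularAt l₃ (x 2)},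
    ?_, fun x hx => hx.1, ?_, ?_⟩, ?_⟩
  · rintro x hx ⟨n₁, n₂, n₃⟩
    obtain ⟨m₁, χ₁, I₁, f₁, z₁, i₁, r₁⟩ := exists_isReparametrization_monomial (e₁ x hx) n₁
    obtain ⟨m₂, χ₂, I₂, f₂, z₂, i₂, r₂⟩ := exists_isReparametrization_monomial (e₂ x hx) n₂
    obtain ⟨m₃, χ₃, I₃, f₃, z₃, i₃, r₃⟩ := exists_isReparametrization_monomial (e₃ x hx) n₃
    have h := pseudogroupEquivalent_A hl.isOpen r₁ r₂ r₃ hl.nondeg hx i₁ i₂ i₃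
    rw [vec3_zero z₁ z₂ z₃] at h
    exact ⟨_, _, isWebParam_nondegLocus_A r₁.contDiff_model r₂.contDiff_model r₃.contDiff_model,
      h.target_mem, ⟨f₁, f₂, f₃⟩, h⟩
  · rw [isOpen_iff_eventually]
    rintro x ⟨hx, h₁, h₂, h₃⟩
    filter_upwards [hl.isOpen.mem_nhds hx, eventually_regularAt_coord hl.isOpen s₁ hx h₁,
      eventually_regularAt_coord hl.isOpen s₂ hx h₂, eventually_regularAt_coord hl.isOpen s₃ hx h₃]
      with y hΩ h₀ h₁ h₂ using ⟨hΩ, h₀, h₁, h₂⟩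
  · refine subset_closure_of_forall_ball hl.isOpen fun x hx ε hε hball => ?_
    obtain ⟨t₁, d₁, r₁⟩ := exists_regularAt_of_contDiffAt (e₁ x hx) hε
    obtain ⟨t₂, d₂, r₂⟩ := exists_regularAt_of_contDiffAt (e₂ x hx) hε
    obtain ⟨t₃, d₃, r₃⟩ := exists_regularAt_of_contDiffAt (e₃ x hx) hε
    have hy := vec3_mem_ball hε d₁ d₂ d₃
    exact ⟨_, hy, hball hy, r₁, r₂, r₃⟩
  · rintro x ⟨hx, n₁, n₂, n₃⟩
    obtain ⟨m₁, χ₁, I₁, f₁, i₁, r₁⟩ := exists_isReparametrization_basic (e₁ x hx) n₁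
    obtain ⟨m₂, χ₂, I₂, f₂, i₂, r₂⟩ := exists_isReparametrization_basic (e₂ x hx) n₂
    obtain ⟨m₃, χ₃, I₃, f₃, i₃, r₃⟩ := exists_isReparametrization_basic (e₃ x hx) n₃
    have h := pseudogroupEquivalent_A hl.isOpen r₁ r₂ r₃ hl.nondeg hx i₁ i₂ i₃
    exact ⟨_, _, _, isWebParam_nondegLocus_A r₁.contDiff_model r₂.contDiff_model r₃.contDiff_model,
      h.target_mem, ⟨f₁, f₂, f₃⟩, h⟩
  · rintro x hx ⟨n₁, n₂, n₃⟩
    obtain ⟨I₁, i₁, r₁⟩ := exists_isReparametrization_id (e₁ x hx) n₁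
    obtain ⟨I₂, i₂, r₂⟩ := exists_isReparametrization_id (e₂ x hx) n₂
    obtain ⟨I₃, i₃, r₃⟩ := exists_isReparametrization_id (e₃ x hx) n₃
    have h := pseudogroupEquivalent_A hl.isOpen r₁ r₂ r₃ hl.nondeg hx i₁ i₂ i₃
    exact ⟨_, h.target_mem, h⟩

theorem hasNormalForms_B {Ω : Set R3} {l₂ l₃ : ℝ → ℝ} (hl : IsWebParam .B Ω (l₂, l₃)) :
    HasNormalForms .B Ω (l₂, l₃) := by
  have s₂ : ∀ x ∈ Ω, ContDiffAt ℝ ∞ l₂ (x 1) := fun x hx => (hl.smooth x hx).1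
  have s₃ : ∀ x ∈ Ω, ContDiffAt ℝ ∞ l₃ (x 2) := fun x hx => (hl.smooth x hx).2
  have e₂ := fun x hx => eventually_contDiffAt_coord hl.isOpen s₂ (x := x) hx
  have e₃ := fun x hx => eventually_contDiffAt_coord hl.isOpen s₃ (x := x) hx
  refine ⟨?_, ⟨{x ∈ Ω | RegularAt l₂ (x 1) ∧ RegularAt l₃ (x 2)},
    ?_, fun x hx => hx.1, ?_, ?_⟩, ?_⟩
  · rintro x hx ⟨n₂, n₃⟩
    obtain ⟨m₂, χ₂, I₂, f₂, z₂, i₂, r₂⟩ := exists_isReparametrization_monomial (e₂ x hx) n₂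
    obtain ⟨m₃, χ₃, I₃, f₃, z₃, i₃, r₃⟩ := exists_isReparametrization_monomial (e₃ x hx) n₃
    have h := pseudogroupEquivalent_B hl.isOpen r₂ r₃ hl.nondeg hx i₂ i₃
    rw [vec3_zero rfl z₂ z₃] at h
    exact ⟨_, _, isWebParam_nondegLocus_B r₂.contDiff_model r₃.contDiff_model,
      h.target_mem, ⟨f₂, f₃⟩, h⟩
  · rw [isOpen_iff_eventually]
    rintro x ⟨hx, h₂, h₃⟩
    filter_upwards [hl.isOpen.mem_nhds hx,
      eventually_regularAt_coord hl.isOpen s₂ hx h₂, eventually_regularAt_coord hl.isOpen s₃ hx h₃]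
      with y h h' h'' using ⟨h, h', h''⟩
  · refine subset_closure_of_forall_ball hl.isOpen fun x hx ε hε hball => ?_
    obtain ⟨t₂, d₂, r₂⟩ := exists_regularAt_of_contDiffAt (e₂ x hx) hε
    obtain ⟨t₃, d₃, r₃⟩ := exists_regularAt_of_contDiffAt (e₃ x hx) hε
    have hy := vec3_mem_ball (s₀ := x 0) hε (by simpa using hε) d₂ d₃
    exact ⟨_, hy, hball hy, r₂, r₃⟩
  · rintro x ⟨hx, n₂, n₃⟩
    obtain ⟨m₂, χ₂, I₂, f₂, i₂, r₂⟩ := exists_isReparametrization_basic (e₂ x hx) n₂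
    obtain ⟨m₃, χ₃, I₃, f₃, i₃, r₃⟩ := exists_isReparametrization_basic (e₃ x hx) n₃
    have h := pseudogroupEquivalent_B hl.isOpen r₂ r₃ hl.nondeg hx i₂ i₃
    exact ⟨_, _, _, isWebParam_nondegLocus_B r₂.contDiff_model r₃.contDiff_model,
      h.target_mem, ⟨f₂, f₃⟩, h⟩
  · rintro x hx ⟨n₂, n₃⟩
    obtain ⟨I₂, i₂, r₂⟩ := exists_isReparametrization_id (e₂ x hx) n₂
    obtain ⟨I₃, i₃, r₃⟩ := exists_isReparametrization_id (e₃ x hx) n₃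
    have h := pseudogroupEquivalent_B hl.isOpen r₂ r₃ hl.nondeg hx i₂ i₃
    exact ⟨_, h.target_mem, h⟩

theorem hasNormalForms_C {Ω : Set R3} {l₃ : ℝ → ℝ} (hl : IsWebParam .C Ω l₃) :
    HasNormalForms .C Ω l₃ := by
  have s₃ : ∀ x ∈ Ω, ContDiffAt ℝ ∞ l₃ (x 2) := fun x hx => hl.smooth x hx
  have e₃ := fun x hx => eventually_contDiffAt_coord hl.isOpen s₃ (x := x) hx
  refine ⟨?_, ⟨{x ∈ Ω | RegularAt l₃ (x 2)}, ?_, fun x hx => hx.1, ?_, ?_⟩, ?_⟩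
  · intro x hx n₃
    obtain ⟨m₃, χ₃, I₃, f₃, z₃, i₃, r₃⟩ := exists_isReparametrization_monomial (e₃ x hx) n₃
    have h := pseudogroupEquivalent_C hl.isOpen r₃ hx i₃
    rw [vec3_zero rfl rfl z₃] at h
    exact ⟨_, _, isWebParam_nondegLocus_C r₃.contDiff_model, h.target_mem, f₃, h⟩
  · rw [isOpen_iff_eventually]
    rintro x ⟨hx, h₃⟩
    filter_upwards [hl.isOpen.mem_nhds hx, eventually_regularAt_coord hl.isOpen s₃ hx h₃]
      with y h h' using ⟨h, h'⟩
  · refine subset_closure_of_forall_ball hl.isOpen fun x hx ε hε hball => ?_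
    obtain ⟨t₃, d₃, r₃⟩ := exists_regularAt_of_contDiffAt (e₃ x hx) hε
    have hy := vec3_mem_ball (s₀ := x 0) (s₁ := x 1) hε (by simpa using hε) (by simpa using hε) d₃
    exact ⟨_, hy, hball hy, r₃⟩
  · rintro x ⟨hx, n₃⟩
    obtain ⟨m₃, χ₃, I₃, f₃, i₃, r₃⟩ := exists_isReparametrization_basic (e₃ x hx) n₃
    have h := pseudogroupEquivalent_C hl.isOpen r₃ hx i₃
    exact ⟨_, _, _, isWebParam_nondegLocus_C r₃.contDiff_model, h.target_mem, f₃, h⟩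
  · intro x hx n₃
    obtain ⟨I₃, i₃, r₃⟩ := exists_isReparametrization_id (e₃ x hx) n₃
    have h := pseudogroupEquivalent_C hl.isOpen r₃ hx i₃
    exact ⟨_, h.target_mem, h⟩

theorem hasNormalForms_D {Ω : Set R3} {L : ℂ → ℂ} {l₃ : ℝ → ℝ} (hl : IsWebParam .D Ω (L, l₃)) :
    HasNormalForms .D Ω (L, l₃) := by
  have s₁ : ∀ x ∈ Ω, AnalyticAt ℂ L (zCoord x) := fun x hx => (hl.smooth x hx).1
  have s₃ : ∀ x ∈ Ω, ContDiffAt ℝ ∞ l₃ (x 2) := fun x hx => (hl.smooth x hx).2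
  have e₃ := fun x hx => eventually_contDiffAt_coord hl.isOpen s₃ (x := x) hx
  refine ⟨?_, ⟨{x ∈ Ω | RegularAt L (zCoord x) ∧ RegularAt l₃ (x 2)},
    ?_, fun x hx => hx.1, ?_, ?_⟩, ?_⟩
  · intro x hx n₃
    obtain ⟨M, Z, I, f, z, i, r⟩ := exists_isComplexReparametrization_monomial (s₁ x hx)
    obtain ⟨m₃, χ₃, I₃, f₃, z₃, i₃, r₃⟩ := exists_isReparametrization_monomial (e₃ x hx) n₃
    have h := pseudogroupEquivalent_D hl.isOpen r r₃ hl.nondeg hx i i₃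
    rw [vec3_zero (by rw [z]; rfl) (by rw [z]; rfl) z₃] at h
    exact ⟨_, _, isWebParam_nondegLocus_D r.analytic_model r₃.contDiff_model,
      h.target_mem, ⟨f, f₃⟩, h⟩
  · rw [isOpen_iff_eventually]
    rintro x ⟨hx, h₁, h₃⟩
    have h₁' := contDiff_zCoord.continuous.continuousAt.eventually
      (h₁.eventually (s₁ x hx).deriv.continuousAt)
    filter_upwards [hl.isOpen.mem_nhds hx, h₁', eventually_regularAt_coord hl.isOpen s₃ hx h₃]
      with y h h' h'' using ⟨h, h', h''⟩
  · refine subset_closure_of_forall_ball hl.isOpen fun x hx ε hε hball => ?_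
    obtain ⟨w, d, r⟩ := exists_regularAt ((s₁ x hx).eventually_analyticAt.mono
      fun _ h => h.differentiableAt) hε
    obtain ⟨t₃, d₃, r₃⟩ := exists_regularAt_of_contDiffAt (e₃ x hx) hε
    -- A complex point near `zCoord x` has real and imaginary parts at least as near to the first
    -- two coordinates.
    rw [Complex.dist_eq] at d
    have hy := vec3_mem_ball (x := x) (s₀ := w.re) (s₁ := w.im) hε
      ((Complex.abs_re_le_norm (w - zCoord x)).trans_lt d)
      ((Complex.abs_im_le_norm (w - zCoord x)).trans_lt d) d₃
    exact ⟨_, hy, hball hy, r, r₃⟩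
  · rintro x ⟨hx, n, n₃⟩
    obtain ⟨M, Z, I, f, i, r⟩ := exists_isComplexReparametrization_basic (s₁ x hx) n
    obtain ⟨m₃, χ₃, I₃, f₃, i₃, r₃⟩ := exists_isReparametrization_basic (e₃ x hx) n₃
    have h := pseudogroupEquivalent_D hl.isOpen r r₃ hl.nondeg hx i i₃
    exact ⟨_, _, _, isWebParam_nondegLocus_D r.analytic_model r₃.contDiff_model,
      h.target_mem, ⟨f, f₃⟩, h⟩
  · rintro x hx ⟨n, n₃⟩
    obtain ⟨I, i, r⟩ := exists_isComplexReparametrization_id (s₁ x hx) n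
    obtain ⟨I₃, i₃, r₃⟩ := exists_isReparametrization_id (e₃ x hx) n₃
    have h := pseudogroupEquivalent_D hl.isOpen r r₃ hl.nondeg hx i i₃
    exact ⟨_, h.target_mem, h⟩

theorem hasNormalForms {X : WebClass} {Ω : Set R3} {l : WebParam X} (hl : IsWebParam X Ω l) :
    HasNormalForms X Ω l := by
  cases X
  · exact hasNormalForms_A hl
  · exact hasNormalForms_B hl
  · exact hasNormalForms_C hl
  · exact hasNormalForms_D hl

end

noncomputable section

/-! ### Symbols of quasilinear equations and linear conformal symplectic maps -/

/-- Real square matrices of size three. -/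
abbrev Mat3 : Type := Matrix (Fin 3) (Fin 3) ℝ

open Matrix

/-- Polarization on the standard basis vectors and their pairwise sums. -/
theorem Matrix.IsSymm.eq_zero_of_forall_dotProduct {n : Type*} [Fintype n] [DecidableEq n]
    {B : Matrix n n ℝ} (hB : B.IsSymm) (h : ∀ v, v ⬝ᵥ B *ᵥ v = 0) : B = 0 := by
  have hd : ∀ i, B i i = 0 := fun i => by simpa using h (Pi.single i 1)
  ext i j
  have hij := h (Pi.single i 1 + Pi.single j 1)
  simp only [mulVec_add, dotProduct_add, add_dotProduct, mulVec_single_one,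
    single_one_dotProduct, Matrix.col_apply, hd] at hij
  have := hB.apply i j
  simp only [zero_apply]
  linarith

/-- A symmetrized product of two vectors of `ℝ³` is degenerate. -/
theorem det_vecMulVec_add_eq_zero (v s : R3) : (vecMulVec v s + vecMulVec s v : Mat3).det = 0 := by
  simp only [det_fin_three, Matrix.add_apply, vecMulVec_apply]
  ring

theorem eq_zero_of_vecMulVec_add_eq_zero {v s : R3} (hs : s ≠ 0)
    (h : (vecMulVec v s + vecMulVec s v : Mat3) = 0) : v = 0 := by
  obtain ⟨i, hi⟩ := Function.ne_iff.1 hs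
  have hi' : s i ≠ 0 := hi
  have e : ∀ j k, v j * s k + s j * v k = 0 := fun j k => by
    simpa [vecMulVec_apply] using congrFun (congrFun h j) k
  have hvi : v i = 0 := by
    have : s i * v i = 0 := by linarith [e i i, mul_comm (v i) (s i)]
    exact (mul_eq_zero.1 this).resolve_left hi'
  ext j
  have := e j i
  rw [hvi, mul_zero, add_zero] at this
  exact (mul_eq_zero.1 this).resolve_right hi'

/-- A product of two nonzero real polynomials is a nonzero function. One hypothesis is on a constant
coefficient and the other on a leading one, because these are the values contributed by the two ends
of the pencil `v₁ + t v₂`. -/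
theorem exists_quadratic_ne_zero {a₁ b₁ c₁ a₂ b₂ c₂ : ℝ} (h₁ : a₁ ≠ 0) (h₂ : c₂ ≠ 0) :
    ∃ t : ℝ, a₁ + b₁ * t + c₁ * t ^ 2 ≠ 0 ∧ a₂ + b₂ * t + c₂ * t ^ 2 ≠ 0 := by
  by_contra hcon
  push Not at hcon
  open Polynomial in
  have hP : (C a₁ + C b₁ * X + C c₁ * X ^ 2 : ℝ[X]) * (C a₂ + C b₂ * X + C c₂ * X ^ 2) = 0 := by
    refine Polynomial.funext fun t => ?_
    by_cases h : a₁ + b₁ * t + c₁ * t ^ 2 = 0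
    · simp [h]
    · simp [hcon t h]
  rcases mul_eq_zero.1 hP with h | h
  · exact h₁ (by simpa using congrArg (Polynomial.coeff · 0) h)
  · exact h₂ (by
      simpa [Polynomial.coeff_X, Polynomial.coeff_C] using congrArg (Polynomial.coeff · 2) h)

/-! ### Isotropic vectors of a nondegenerate form and transversal Hessians -/

section Isotropic

variable {S : Mat3} {e : R3}

/-- Isotropic vectors are obtained from one of them by reflection. -/
def isotropicOf (S : Mat3) (e v : R3) : R3 := (v ⬝ᵥ S *ᵥ v) • e - (2 * (e ⬝ᵥ S *ᵥ v)) • v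

theorem dotProduct_mulVec_comm_of_isSymm (hS : S.IsSymm) (v w : R3) :
    v ⬝ᵥ S *ᵥ w = w ⬝ᵥ S *ᵥ v := by
  rw [dotProduct_mulVec, ← mulVec_transpose, hS.eq, dotProduct_comm]

theorem isotropicOf_isotropic (hS : S.IsSymm) (he : e ⬝ᵥ S *ᵥ e = 0) (v : R3) :
    isotropicOf S e v ⬝ᵥ S *ᵥ isotropicOf S e v = 0 := by
  simp only [isotropicOf, mulVec_sub, mulVec_smul, dotProduct_sub, sub_dotProduct,
    smul_dotProduct, dotProduct_smul, he, dotProduct_mulVec_comm_of_isSymm hS v e, smul_eq_mul]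
  ring

/-- If `g` annihilated the whole parametrized cone, then `(g · e) S` would be the symmetrized
product of `S e` and `g`. Such a product is degenerate, so `g · e = 0`; the product then vanishes
and `g = 0`. -/
theorem exists_isotropicOf_dotProduct_ne_zero (hS : S.IsSymm) (hdet : S.det ≠ 0) (he : e ≠ 0)
    {g : R3} (hg : g ≠ 0) : ∃ v, g ⬝ᵥ isotropicOf S e v ≠ 0 := by
  by_contra hcon
  push Not at hcon
  have hs : S *ᵥ e ≠ 0 := fun h => hdet (exists_mulVec_eq_zero_iff.1 ⟨e, he, h⟩)
  have hB : (g ⬝ᵥ e) • S - (vecMulVec (S *ᵥ e) g + vecMulVec g (S *ᵥ e)) = 0 := by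
    refine Matrix.IsSymm.eq_zero_of_forall_dotProduct ?_ fun v => ?_
    · rw [IsSymm, transpose_sub, transpose_smul, hS.eq, transpose_add, transpose_vecMulVec,
        transpose_vecMulVec, add_comm]
    · have := hcon v
      simp only [isotropicOf, dotProduct_sub, dotProduct_smul, smul_eq_mul] at this
      simp only [sub_mulVec, add_mulVec, smul_mulVec, dotProduct_sub, dotProduct_add,
        dotProduct_smul, vecMulVec_mulVec, smul_eq_mul,
        op_smul_eq_smul]
      rw [dotProduct_mulVec_comm_of_isSymm hS v e, dotProduct_comm v g,
        dotProduct_comm (S *ᵥ e) v, dotProduct_mulVec_comm_of_isSymm hS v e]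
      linarith
  rw [sub_eq_zero] at hB
  by_cases hge : g ⬝ᵥ e = 0
  · rw [hge, zero_smul, add_comm] at hB
    exact hg (eq_zero_of_vecMulVec_add_eq_zero hs hB.symm)
  · have := congrArg det hB
    rw [det_vecMulVec_add_eq_zero, det_smul] at this
    exact (mul_ne_zero (pow_ne_zero _ hge) hdet) this

/-- The isotropic vectors are not contained in the union of two planes. -/
theorem exists_isotropic_dotProduct_ne_zero (hS : S.IsSymm) (hdet : S.det ≠ 0) (he : e ≠ 0)
    (hee : e ⬝ᵥ S *ᵥ e = 0) {g₁ g₂ : R3} (h₁ : g₁ ≠ 0) (h₂ : g₂ ≠ 0) :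
    ∃ ξ : R3, ξ ⬝ᵥ S *ᵥ ξ = 0 ∧ g₁ ⬝ᵥ ξ ≠ 0 ∧ g₂ ⬝ᵥ ξ ≠ 0 := by
  obtain ⟨v₁, hv₁⟩ := exists_isotropicOf_dotProduct_ne_zero hS hdet he h₁
  obtain ⟨v₂, hv₂⟩ := exists_isotropicOf_dotProduct_ne_zero hS hdet he h₂
  have hq : ∀ g : R3, ∃ β : ℝ, ∀ t : ℝ, g ⬝ᵥ isotropicOf S e (v₁ + t • v₂) =
      g ⬝ᵥ isotropicOf S e v₁ + β * t + (g ⬝ᵥ isotropicOf S e v₂) * t ^ 2 := by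
    intro g
    refine ⟨2 * (v₁ ⬝ᵥ S *ᵥ v₂) * (g ⬝ᵥ e) - 2 * (e ⬝ᵥ S *ᵥ v₁) * (g ⬝ᵥ v₂)
      - 2 * (e ⬝ᵥ S *ᵥ v₂) * (g ⬝ᵥ v₁), fun t => ?_⟩
    simp only [isotropicOf, mulVec_add, mulVec_smul, dotProduct_add, add_dotProduct,
      dotProduct_sub, smul_dotProduct, dotProduct_smul, smul_eq_mul,
      dotProduct_mulVec_comm_of_isSymm hS v₂ v₁]
    ring
  obtain ⟨β₁, hβ₁⟩ := hq g₁
  obtain ⟨β₂, hβ₂⟩ := hq g₂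
  obtain ⟨t, ht₁, ht₂⟩ := exists_quadratic_ne_zero (b₁ := β₁) (c₁ := g₁ ⬝ᵥ isotropicOf S e v₂)
    (a₂ := g₂ ⬝ᵥ isotropicOf S e v₁) (b₂ := β₂) hv₁ hv₂
  exact ⟨_, isotropicOf_isotropic hS hee (v₁ + t • v₂), by rwa [hβ₁], by rwa [hβ₂]⟩

theorem trace_mul_vecMulVec (S : Mat3) (ξ : R3) : (S * vecMulVec ξ ξ).trace = ξ ⬝ᵥ S *ᵥ ξ := by
  rw [mul_vecMulVec, trace_vecMulVec, dotProduct_comm]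

theorem isSymm_vecMulVec_self (ξ : R3) : (vecMulVec ξ ξ : Mat3).IsSymm := transpose_vecMulVec _ _

/-- A hyperplane of symmetric matrices with nondegenerate isotropic normal contains one which is
transversal to a given Lagrangian plane. -/
theorem exists_isSymm_det_ne_zero (hS : S.IsSymm) (hdet : S.det ≠ 0) (he : e ≠ 0)
    (hee : e ⬝ᵥ S *ᵥ e = 0) {a b : Mat3} (hab : ∀ y : R3, ∃ v w, a *ᵥ v + b *ᵥ w = y) (c : ℝ) :
    ∃ h : Mat3, h.IsSymm ∧ (S * h).trace = c ∧ (a + b * h).det ≠ 0 := by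
  -- Descent on the dimension of the kernel of `a + b h`: adding `ξ ξᵀ` with `ξ` isotropic does not
  -- change the trace against `S`.
  have key : ∀ (n : ℕ) (h : Mat3), h.IsSymm → (S * h).trace = c →
      Module.finrank ℝ (LinearMap.ker (a + b * h).mulVecLin) = n →
      ∃ h : Mat3, h.IsSymm ∧ (S * h).trace = c ∧ (a + b * h).det ≠ 0 := by
    intro n
    induction n using Nat.strong_induction_on with
    | _ n ih =>
      intro h hh hc hn
      by_cases hM : (a + b * h).det = 0
      swap
      · exact ⟨h, hh, hc, hM⟩
      obtain ⟨v, hv, hMv⟩ := exists_mulVec_eq_zero_iff.2 hM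
      obtain ⟨y, hy, hyM⟩ := exists_vecMul_eq_zero_iff.2 hM
      -- Otherwise the left null vector `y` would annihilate the ranges of both `a` and `b`, which
      -- together fill the space.
      have hyb : y ᵥ* b ≠ 0 := by
        intro h0
        have hya : y ᵥ* a = 0 := by
          rw [vecMul_add, ← vecMul_vecMul, h0, zero_vecMul, add_zero] at hyM
          exact hyM
        obtain ⟨v', w', hvw⟩ := hab y
        have : y ⬝ᵥ y = 0 := by
          conv_lhs => rw [← hvw]
          rw [hvw, ← hvw, dotProduct_add, dotProduct_mulVec, dotProduct_mulVec, hvw, hya, h0]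
          simp
        exact hy (dotProduct_self_eq_zero.1 this)
      -- `y · b ξ ≠ 0` keeps the new kernel inside the old one; `ξ · v ≠ 0` removes `v` from it.
      obtain ⟨ξ, hξ, hξv, hξb⟩ := exists_isotropic_dotProduct_ne_zero hS hdet he hee hv hyb
      rw [← dotProduct_mulVec] at hξb
      have hker : ∀ w, (a + b * (h + vecMulVec ξ ξ)) *ᵥ w = 0 →
          (a + b * h) *ᵥ w = 0 ∧ ξ ⬝ᵥ w = 0 := by
        intro w hw
        have hw' : (a + b * h) *ᵥ w + (ξ ⬝ᵥ w) • (b *ᵥ ξ) = 0 := by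
          rw [← hw, mul_add, ← add_assoc, add_mulVec _ (b * vecMulVec ξ ξ), mul_vecMulVec,
            vecMulVec_mulVec, op_smul_eq_smul]
        have h1 : ξ ⬝ᵥ w = 0 := by
          have := congrArg (y ⬝ᵥ ·) hw'
          simp only [dotProduct_add, dotProduct_smul, dotProduct_zero, smul_eq_mul] at this
          rw [dotProduct_mulVec, hyM, zero_dotProduct, zero_add] at this
          exact (mul_eq_zero.1 this).resolve_right hξb
        rw [h1, zero_smul, add_zero] at hw'
        exact ⟨hw', h1⟩
      refine ih _ ?_ (h + vecMulVec ξ ξ) (hh.add (isSymm_vecMulVec_self ξ)) ?_ rfl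
      · rw [← hn]
        refine Submodule.finrank_lt_finrank_of_lt (lt_of_le_of_ne (fun w hw => ?_) fun heq => ?_)
        · exact (hker w hw).1
        · have hvmem : v ∈ LinearMap.ker (a + b * h).mulVecLin := hMv
          rw [← heq] at hvmem
          exact hξv (by rw [dotProduct_comm]; exact (hker v hvmem).2)
      · rw [mul_add, trace_add, hc, trace_mul_vecMulVec, hξ, add_zero]
  -- The identity has trace three, so this symmetric matrix starts the descent with the prescribed
  -- trace.
  refine key _ ((c / 3) • S⁻¹) ?_ ?_ rfl
  · rw [IsSymm, transpose_smul, transpose_nonsing_inv, hS.eq]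
  · rw [mul_smul_comm, mul_nonsing_inv _ (Ne.isUnit hdet), trace_smul, trace_one]
    simp

end Isotropic

/-- The trace of a product is positive definite on symmetric matrices: subtracting from `B` its
projection to `S` leaves a matrix orthogonal to itself. -/
theorem eq_smul_of_forall_trace_mul_eq_zero {S B : Mat3} (hS : S.IsSymm) (hS0 : S ≠ 0)
    (hB : B.IsSymm) (h : ∀ k : Mat3, k.IsSymm → (S * k).trace = 0 → (B * k).trace = 0) :
    ∃ σ : ℝ, B = σ • S := by
  have hpos : ∀ k : Mat3, k.IsSymm → (k * k).trace = 0 → k = 0 := fun k hk h0 => by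
    have : (kᴴ * k).trace = 0 := by rwa [conjTranspose_eq_transpose_of_trivial, hk.eq]
    exact trace_conjTranspose_mul_self_eq_zero_iff.1 this
  have hSS : (S * S).trace ≠ 0 := fun h0 => hS0 (hpos S hS h0)
  set σ := (S * B).trace / (S * S).trace with hσ
  refine ⟨σ, sub_eq_zero.1 (hpos _ ?_ ?_)⟩
  · rw [IsSymm, transpose_sub, transpose_smul, hS.eq, hB.eq]
  · have hk : (B - σ • S).IsSymm := by rw [IsSymm, transpose_sub, transpose_smul, hS.eq, hB.eq]
    have h1 : (S * (B - σ • S)).trace = 0 := by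
      rw [mul_sub, trace_sub, mul_smul_comm, trace_smul, hσ, smul_eq_mul]
      field_simp
      ring
    have h2 := h _ hk h1
    rw [sub_mul, trace_sub, h2, smul_mul_assoc, trace_smul, h1]
    simp

/-- The linear data of a contact transformation at a 1-jet, and its action on Hessians. -/
structure HessianAction (a b : Mat3) (ρ : ℝ) (τ : Mat3 → Mat3) : Prop where
  ne_zero : ρ ≠ 0
  surjective : ∀ y : R3, ∃ v w, a *ᵥ v + b *ᵥ w = y
  isSymm : ∀ h : Mat3, h.IsSymm → (a + b * h).det ≠ 0 → (τ h).IsSymm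
  sub_eq : ∀ h k : Mat3, h.IsSymm → k.IsSymm → (a + b * h).det ≠ 0 → (a + b * k).det ≠ 0 →
    (a + b * k)ᵀ * (τ h - τ k) * (a + b * h) = ρ • (h - k)

/-! ### Action on Hessians and rigidity of the vertical plane -/

section Action

variable {a b : Mat3} {ρ : ℝ} {τ : Mat3 → Mat3} {S S' : Mat3} {c c' : ℝ}

/-- Transformation law of the symbol. -/
theorem HessianAction.symbol_eq (hτ : HessianAction a b ρ τ) (hS : S.IsSymm) (hS0 : S ≠ 0)
    (hS' : S'.IsSymm) (hE : ∀ h : Mat3, h.IsSymm → (a + b * h).det ≠ 0 →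
      ((S * h).trace + c = 0 ↔ (S' * τ h).trace + c' = 0))
    {h : Mat3} (hh : h.IsSymm) (hhE : (S * h).trace + c = 0) (hM : (a + b * h).det ≠ 0) :
    ∃ σ : ℝ, S' = σ • ((a + b * h) * S * (a + b * h)ᵀ) := by
  set M := a + b * h with hMdef
  have hMu : IsUnit M.det := Ne.isUnit hM
  have key : ∀ k : Mat3, k.IsSymm → (S * k).trace = 0 → (M⁻¹ * S' * (M⁻¹)ᵀ * k).trace = 0 := by
    intro k hk hkS
    -- This is the difference quotient along `h + t k`, up to a nonzero factor. With the adjugate in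
    -- place of the inverse it is continuous at `t = 0`, so its vanishing for small `t ≠ 0` passes
    -- to the limit.
    set f : ℝ → ℝ := fun t => (S' * ((M⁻¹)ᵀ * k * (M + t • (b * k)).adjugate)).trace with hf
    have hMt : Continuous fun t : ℝ => M + t • (b * k) :=
      continuous_const.add (continuous_id.smul continuous_const)
    have hfc : Continuous f :=
      (continuous_const.matrix_mul (continuous_const.matrix_mul hMt.matrix_adjugate)).matrix_trace
    have hdet : ∀ᶠ t in nhds (0 : ℝ), (M + t • (b * k)).det ≠ 0 :=
      hMt.matrix_det.continuousAt.eventually_ne (by simpa using hM)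
    have hzero : ∀ᶠ t in nhdsWithin (0 : ℝ) {0}ᶜ, f t = 0 := by
      filter_upwards [hdet.filter_mono nhdsWithin_le_nhds, self_mem_nhdsWithin] with t ht ht0
      have ht0' : t ≠ 0 := ht0
      have hht : (h + t • k).IsSymm := by
        rw [IsSymm, transpose_add, transpose_smul, hh.eq, hk.eq]
      have hMt' : a + b * (h + t • k) = M + t • (b * k) := by
        rw [mul_add, mul_smul_comm, ← add_assoc]
      have hdt : (a + b * (h + t • k)).det ≠ 0 := by rwa [hMt']
      have h1 := hτ.sub_eq (h + t • k) h hht hh hdt hM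
      have h2 : (S' * (τ (h + t • k) - τ h)).trace = 0 := by
        have e1 := (hE _ hht hdt).1 (by
          rw [mul_add, trace_add, mul_smul_comm, trace_smul, hkS, smul_zero, add_zero, hhE])
        have e2 := (hE _ hh hM).1 hhE
        rw [mul_sub, trace_sub]
        linarith
      have hMtu : IsUnit (M + t • (b * k)).det := Ne.isUnit ht
      rw [hMt', ← hMdef] at h1
      have h3 : τ (h + t • k) - τ h = (ρ * t * (M + t • (b * k)).det⁻¹) •
          ((M⁻¹)ᵀ * k * (M + t • (b * k)).adjugate) := by
        have : τ (h + t • k) - τ h = (M⁻¹)ᵀ * (Mᵀ * (τ (h + t • k) - τ h) * (M + t • (b * k))) *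
            (M + t • (b * k))⁻¹ := by
          rw [mul_assoc, mul_assoc, mul_assoc, mul_nonsing_inv _ hMtu, mul_one, ← mul_assoc,
            ← transpose_mul, mul_nonsing_inv _ hMu, transpose_one, one_mul]
        rw [this, h1, inv_def (M + t • (b * k)), Ring.inverse_eq_inv', add_sub_cancel_left]
        simp only [mul_smul_comm, smul_mul_assoc, smul_smul, mul_assoc]
        congr 1
        ring
      rw [h3, mul_smul_comm, trace_smul, smul_eq_mul] at h2
      exact (mul_eq_zero.1 h2).resolve_left
        (mul_ne_zero (mul_ne_zero hτ.ne_zero ht0') (inv_ne_zero ht))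
    have hf0 : f 0 = 0 := by
      have l1 : Filter.Tendsto f (nhdsWithin (0 : ℝ) {0}ᶜ) (nhds (f 0)) :=
        hfc.continuousAt.tendsto.mono_left nhdsWithin_le_nhds
      have l2 : Filter.Tendsto f (nhdsWithin (0 : ℝ) {0}ᶜ) (nhds 0) :=
        tendsto_const_nhds.congr' (hzero.mono fun t ht => ht.symm)
      exact tendsto_nhds_unique l1 l2
    have hadj : M.adjugate = M.det • M⁻¹ := by
      rw [inv_def, Ring.inverse_eq_inv', smul_smul, mul_inv_cancel₀ hM, one_smul]
    rw [hf] at hf0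
    simp only [zero_smul, add_zero, hadj, mul_smul_comm, trace_smul, smul_eq_mul] at hf0
    have := (mul_eq_zero.1 hf0).resolve_left hM
    rw [← mul_assoc, trace_mul_comm, ← mul_assoc, ← mul_assoc] at this
    exact this
  have hBs : (M⁻¹ * S' * (M⁻¹)ᵀ).IsSymm := by
    rw [IsSymm, transpose_mul, transpose_mul, transpose_transpose, hS'.eq, mul_assoc]
  obtain ⟨σ, hσ⟩ := eq_smul_of_forall_trace_mul_eq_zero hS hS0 hBs key
  refine ⟨σ, ?_⟩
  rw [← smul_mul_assoc, ← mul_smul_comm, ← hσ, mul_assoc M⁻¹, ← mul_assoc M,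
    mul_nonsing_inv _ hMu, one_mul, mul_assoc, ← transpose_mul, mul_nonsing_inv _ hMu,
    transpose_one, mul_one]

/-- A conformal symplectic map between quasilinear equations with nondegenerate indefinite symbol
preserves the vertical plane. -/
theorem HessianAction.eq_zero (hτ : HessianAction a b ρ τ) (hS : S.IsSymm) (hdet : S.det ≠ 0)
    {e : R3} (he : e ≠ 0) (hee : e ⬝ᵥ S *ᵥ e = 0) (hS' : S'.IsSymm) (hS'0 : S' ≠ 0)
    (hE : ∀ h : Mat3, h.IsSymm → (a + b * h).det ≠ 0 →
      ((S * h).trace + c = 0 ↔ (S' * τ h).trace + c' = 0)) :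
    b = 0 ∧ ∃ σ : ℝ, σ ≠ 0 ∧ S' = σ • (a * S * aᵀ) := by
  have hS0 : S ≠ 0 := by
    rintro rfl
    exact hdet (by simp)
  obtain ⟨h, hh, hhE, hM⟩ := exists_isSymm_det_ne_zero hS hdet he hee hτ.surjective (-c)
  have hhE' : (S * h).trace + c = 0 := by rw [hhE, neg_add_cancel]
  obtain ⟨σ, hσ⟩ := hτ.symbol_eq hS hS0 hS' hE hh hhE' hM
  have hσ0 : σ ≠ 0 := by
    rintro rfl
    exact hS'0 (by rw [hσ, zero_smul])
  set M := a + b * h with hMdef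
  have hMu : IsUnit M.det := Ne.isUnit hM
  have hb : b = 0 := by
    by_contra hb0
    obtain ⟨i, hi⟩ := Function.ne_iff.1 hb0
    -- Some row of `b` is nonzero, and isotropic vectors are not confined to its kernel; hence `b ξ
    -- ≠ 0`.
    obtain ⟨ξ, hξ, hξb, -⟩ := exists_isotropic_dotProduct_ne_zero hS hdet he hee hi hi
    have hξ0 : ξ ≠ 0 := by
      rintro rfl
      simp at hξb
    set ν := M⁻¹ *ᵥ (b *ᵥ ξ) with hν
    have hMν : M *ᵥ ν = b *ᵥ ξ := by
      rw [hν, mulVec_mulVec, mul_nonsing_inv _ hMu, one_mulVec]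
    have hev : ∀ᶠ t in nhds (0 : ℝ), (M + t • (b * vecMulVec ξ ξ)).det ≠ 0 := by
      have hMt : Continuous fun t : ℝ => M + t • (b * vecMulVec ξ ξ) :=
        continuous_const.add (continuous_id.smul continuous_const)
      exact hMt.matrix_det.continuousAt.eventually_ne (by simpa using hM)
    obtain ⟨t, htd, ht0⟩ := ((hev.filter_mono nhdsWithin_le_nhds).and
      (self_mem_nhdsWithin : {0}ᶜ ∈ nhdsWithin (0 : ℝ) {0}ᶜ)).exists
    have ht0' : t ≠ 0 := ht0
    have hMt : a + b * (h + t • vecMulVec ξ ξ) = M + t • (b * vecMulVec ξ ξ) := by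
      rw [mul_add, mul_smul_comm, ← add_assoc]
    obtain ⟨σ', hσ'⟩ := hτ.symbol_eq hS hS0 hS' hE (h := h + t • vecMulVec ξ ξ)
      (by rw [IsSymm, transpose_add, transpose_smul, hh.eq, (isSymm_vecMulVec_self ξ).eq])
      (by rw [mul_add, trace_add, mul_smul_comm, trace_smul, trace_mul_vecMulVec, hξ, smul_zero,
        add_zero, hhE'])
      (by rwa [hMt])
    have hσ'0 : σ' ≠ 0 := by
      rintro rfl
      exact hS'0 (by rw [hσ', zero_smul])
    -- Comparing the symbol law at `h` and at `h + t ξ ξᵀ`, the common factor `M` cancels: the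
    -- transvection `1 + t ν ξᵀ` must preserve `S` up to scale.
    have hfac : M + t • (b * vecMulVec ξ ξ) = M * (1 + t • vecMulVec ν ξ) := by
      rw [mul_add, mul_one, mul_smul_comm, mul_vecMulVec, mul_vecMulVec, hMν]
    rw [hMt, hfac] at hσ'
    have hcancel : (1 + t • vecMulVec ν ξ) * S * (1 + t • vecMulVec ν ξ)ᵀ = (σ'⁻¹ * σ) • S := by
      have h1 : σ • (M * S * Mᵀ) =
          σ' • (M * ((1 + t • vecMulVec ν ξ) * S * (1 + t • vecMulVec ν ξ)ᵀ) * Mᵀ) := by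
        rw [← hσ, hσ', transpose_mul]
        simp only [mul_assoc]
      have h2 : ∀ B : Mat3, M⁻¹ * (M * B * Mᵀ) * (M⁻¹)ᵀ = B := fun B => by
        rw [mul_assoc, mul_assoc, ← transpose_mul, nonsing_inv_mul _ hMu, transpose_one, mul_one,
          ← mul_assoc, nonsing_inv_mul _ hMu, one_mul]
      have h3 := congrArg (fun B => σ'⁻¹ • (M⁻¹ * B * (M⁻¹)ᵀ)) h1
      simp only [mul_smul_comm, smul_mul_assoc, h2] at h3
      rw [smul_smul, smul_smul, inv_mul_cancel₀ hσ'0, one_smul] at h3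
      exact h3.symm
    have hexp : (1 + t • vecMulVec ν ξ) * S * (1 + t • vecMulVec ν ξ)ᵀ =
        S + t • (vecMulVec ν (S *ᵥ ξ) + vecMulVec (S *ᵥ ξ) ν) := by
      have hξS : ξ ᵥ* S = S *ᵥ ξ := by rw [← mulVec_transpose, hS.eq]
      rw [transpose_add, transpose_one, transpose_smul, transpose_vecMulVec, add_mul, one_mul,
        smul_mul_assoc, vecMulVec_mul, hξS, mul_add, mul_one, add_mul, mul_smul_comm,
        smul_mul_assoc, mul_vecMulVec, smul_add, mul_smul_comm, vecMulVec_mul_vecMulVec]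
      have : (S *ᵥ ξ) ⬝ᵥ ξ = 0 := by rw [dotProduct_comm, hξ]
      simp [this]
      abel
    rw [hexp] at hcancel
    have hrank : t • (vecMulVec ν (S *ᵥ ξ) + vecMulVec (S *ᵥ ξ) ν) = (σ'⁻¹ * σ - 1) • S := by
      rw [sub_smul, one_smul, ← hcancel, add_sub_cancel_left]
    -- The left side of `hrank` has determinant zero while `S` is invertible, so the scale must be
    -- one; then `ν = 0`, contrary to `b ξ ≠ 0`.
    have hκ : σ'⁻¹ * σ - 1 = 0 := by
      by_contra hne
      have := congrArg det hrank
      rw [det_smul, det_vecMulVec_add_eq_zero, mul_zero, det_smul] at this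
      exact mul_ne_zero (pow_ne_zero _ hne) hdet this.symm
    rw [hκ, zero_smul, smul_eq_zero, or_iff_right ht0'] at hrank
    have hν0 := eq_zero_of_vecMulVec_add_eq_zero
      (fun h0 => hdet (exists_mulVec_eq_zero_iff.1 ⟨ξ, hξ0, h0⟩)) hrank
    rw [hν0, mulVec_zero] at hMν
    exact hξb (congrFun hMν.symm i)
  refine ⟨hb, σ, hσ0, ?_⟩
  rw [hσ, hMdef, hb, zero_mul, add_zero]

end Action

end

noncomputable section
open Matrix

/-! ### The differential of a contact transformation -/

theorem contactForm_eq (θ v : Jet1) : contactForm θ v = v.2.1 - θ.2.2 ⬝ᵥ v.1 := rfl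

theorem contactForm_jetLift (θ : Jet1) (h : Mat3) (v : R3) : contactForm θ (jetLift θ h v) = 0 :=
  sub_self _

theorem IsContactTransformation.contDiffAt {Φ : Jet1 → Jet1} {U : Set Jet1}
    (hΦ : IsContactTransformation Φ U) {θ : Jet1} (hθ : θ ∈ U) : ContDiffAt ℝ ∞ Φ θ :=
  hΦ.contDiffOn.contDiffAt (hΦ.isOpen.mem_nhds hθ)

theorem hasDerivAt_contactForm {γ δ : ℝ → Jet1} {γ' δ' : Jet1} {s : ℝ} (hγ : HasDerivAt γ γ' s)
    (hδ : HasDerivAt δ δ' s) : HasDerivAt (fun s => contactForm (γ s) (δ s))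
      (δ'.2.1 - (γ'.2.2 ⬝ᵥ (δ s).1 + (γ s).2.2 ⬝ᵥ δ'.1)) s := by
  have h1 : HasDerivAt (fun s => (δ s).2.1) δ'.2.1 s := hδ.snd.fst
  have h2 : ∀ i, HasDerivAt (fun s => (γ s).2.2 i) (γ'.2.2 i) s := hasDerivAt_pi.1 hγ.snd.snd
  have h3 : ∀ i, HasDerivAt (fun s => (δ s).1 i) (δ'.1 i) s := hasDerivAt_pi.1 hδ.fst
  have h4 := HasDerivAt.fun_sum (u := Finset.univ) fun i _ => (h2 i).fun_mul (h3 i)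
  refine (h1.fun_sub h4).congr_deriv ?_
  rw [Finset.sum_add_distrib]
  rfl

/-- The differential of a contact transformation is conformally symplectic on the contact
hyperplanes. -/
theorem IsContactTransformation.exists_conformal {Φ : Jet1 → Jet1} {U : Set Jet1}
    (hΦ : IsContactTransformation Φ U) {θ : Jet1} (hθ : θ ∈ U) :
    ∃ ρ : ℝ, ρ ≠ 0 ∧ (∀ v, contactForm (Φ θ) (fderiv ℝ Φ θ v) = ρ * contactForm θ v) ∧
      ∀ v w, contactForm θ v = 0 → contactForm θ w = 0 →
        (fderiv ℝ Φ θ w).2.2 ⬝ᵥ (fderiv ℝ Φ θ v).1 - (fderiv ℝ Φ θ v).2.2 ⬝ᵥ (fderiv ℝ Φ θ w).1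
          = ρ * (w.2.2 ⬝ᵥ v.1 - v.2.2 ⬝ᵥ w.1) := by
  obtain ⟨ρ, hρ, hρv⟩ := hΦ.contact θ hθ
  refine ⟨ρ, hρ, hρv, ?_⟩
  -- The contact form equals one on `∂_u` at every jet. This expresses the conformal factor through
  -- `Φ` itself, hence as a differentiable function of the jet.
  let e : Jet1 := (0, 1, 0)
  have he : ∀ θ' : Jet1, contactForm θ' e = 1 := fun θ' => by simp [contactForm, e]
  have hfac : ∀ θ' ∈ U, ∀ v, contactForm (Φ θ') (fderiv ℝ Φ θ' v) =
      contactForm (Φ θ') (fderiv ℝ Φ θ' e) * contactForm θ' v := by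
    intro θ' hθ' v
    obtain ⟨r, -, hr⟩ := hΦ.contact θ' hθ'
    rw [hr v, hr e, he, mul_one]
  have hC := hΦ.contDiffAt hθ
  have hD : HasFDerivAt Φ (fderiv ℝ Φ θ) θ := (hC.differentiableAt (by simp)).hasFDerivAt
  have hD2 : HasFDerivAt (fderiv ℝ Φ) (fderiv ℝ (fderiv ℝ Φ) θ) θ :=
    ((hC.fderiv_right (m := 1) (by norm_cast)).differentiableAt one_ne_zero).hasFDerivAt
  have hsymm : ∀ v w, fderiv ℝ (fderiv ℝ Φ) θ v w = fderiv ℝ (fderiv ℝ Φ) θ w v := fun v w =>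
    (hC.isSymmSndFDerivAt (by
      simpa using WithTop.coe_le_coe.2 (le_top : (2 : ℕ∞) ≤ ⊤))).eq v w
  -- The contact identity is differentiated along `w` with `v` held constant. The derivative of the
  -- conformal factor drops out because it multiplies `contactForm θ v = 0`.
  have key : ∀ v w, contactForm θ v = 0 →
      (fderiv ℝ (fderiv ℝ Φ) θ w v).2.1 - ((fderiv ℝ Φ θ w).2.2 ⬝ᵥ (fderiv ℝ Φ θ v).1
        + (Φ θ).2.2 ⬝ᵥ (fderiv ℝ (fderiv ℝ Φ) θ w v).1) = - (ρ * (w.2.2 ⬝ᵥ v.1)) := by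
    intro v w hv
    have hline : HasDerivAt (fun s : ℝ => θ + s • w) w 0 := by
      simpa using ((hasDerivAt_id (0 : ℝ)).smul_const w).const_add θ
    have h0 : θ + (0 : ℝ) • w = θ := by simp
    have hγ : HasDerivAt (fun s : ℝ => Φ (θ + s • w)) (fderiv ℝ Φ θ w) 0 :=
      HasFDerivAt.comp_hasDerivAt 0 (by rwa [h0]) hline
    have hδ : ∀ v, HasDerivAt (fun s : ℝ => fderiv ℝ Φ (θ + s • w) v)
        (fderiv ℝ (fderiv ℝ Φ) θ w v) 0 := fun v => by
      have : HasDerivAt (fun s : ℝ => fderiv ℝ Φ (θ + s • w)) (fderiv ℝ (fderiv ℝ Φ) θ w) 0 :=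
        HasFDerivAt.comp_hasDerivAt 0 (by rwa [h0]) hline
      simpa using this.clm_apply (hasDerivAt_const (0 : ℝ) v)
    have hl := hasDerivAt_contactForm hγ (hδ v)
    have hr := (hasDerivAt_contactForm hγ (hδ e)).fun_mul
      (hasDerivAt_contactForm hline (hasDerivAt_const (0 : ℝ) v))
    have hev : (fun s : ℝ => contactForm (Φ (θ + s • w)) (fderiv ℝ Φ (θ + s • w) v)) =ᶠ[nhds 0]
        fun s => contactForm (Φ (θ + s • w)) (fderiv ℝ Φ (θ + s • w) e)
          * contactForm (θ + s • w) v := by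
      have : ∀ᶠ s : ℝ in nhds 0, θ + s • w ∈ U :=
        hline.continuousAt.eventually_mem (by rw [h0]; exact hΦ.isOpen.mem_nhds hθ)
      filter_upwards [this] with s hs using hfac _ hs v
    have := hl.unique (hr.congr_of_eventuallyEq hev)
    simp only [h0, hv, hρv e, he, mul_zero, mul_one, zero_add] at this
    rw [this]
    simp
  -- Antisymmetrizing removes the second derivative of `Φ`, which is symmetric, and leaves the
  -- symplectic form on both sides.
  intro v w hv hw
  have h1 := key v w hv
  have h2 := key w v hw
  rw [hsymm v w] at h2
  linarith

theorem jetLift_eq_add (θ : Jet1) (h : Mat3) (v : R3) :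
    jetLift θ h v = jetLift θ 0 v + ((0, 0, h *ᵥ v) : Jet1) := by
  simp [jetLift]

theorem exists_jetLift_eq {θ z : Jet1} (hz : contactForm θ z = 0) :
    z = jetLift θ 0 z.1 + ((0, 0, z.2.2) : Jet1) := by
  have : z.2.1 = ∑ i, θ.2.2 i * z.1 i := sub_eq_zero.1 hz
  simp [jetLift, ← this]

/-- The prolongation of a contact transformation to 2-jets. -/
theorem IsContactTransformation.exists_hessianAction {Φ : Jet1 → Jet1} {U : Set Jet1}
    (hΦ : IsContactTransformation Φ U) {θ : Jet1} (hθ : θ ∈ U) :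
    ∃ (a b : Mat3) (ρ : ℝ) (τ : Mat3 → Mat3), HessianAction a b ρ τ ∧
      (∀ v, a *ᵥ v = (fderiv ℝ Φ θ (jetLift θ 0 v)).1) ∧
      (∀ w, b *ᵥ w = (fderiv ℝ Φ θ (0, 0, w)).1) ∧
      ∀ h : Mat3, h.IsSymm → (a + b * h).det ≠ 0 →
        (jetPlane θ h).map (fderiv ℝ Φ θ : Jet1 →ₗ[ℝ] Jet1) = jetPlane (Φ θ) (τ h) := by
  obtain ⟨ρ, hρ, hcon, hsym⟩ := hΦ.exists_conformal hθ
  set D : Jet1 →ₗ[ℝ] Jet1 := (fderiv ℝ Φ θ : Jet1 →ₗ[ℝ] Jet1) with hDdef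
  have hDv : ∀ v, fderiv ℝ Φ θ v = D v := fun _ => rfl
  have hsurj : Function.Surjective D := (hΦ.bijective_fderiv θ hθ).2
  simp only [hDv] at hcon hsym ⊢
  let vert : R3 →ₗ[ℝ] Jet1 := LinearMap.inr ℝ R3 (ℝ × R3) ∘ₗ LinearMap.inr ℝ ℝ R3
  let base : Jet1 →ₗ[ℝ] R3 := LinearMap.fst ℝ R3 (ℝ × R3)
  let mom : Jet1 →ₗ[ℝ] R3 := LinearMap.snd ℝ ℝ R3 ∘ₗ LinearMap.snd ℝ R3 (ℝ × R3)
  let a : Mat3 := LinearMap.toMatrix' (base ∘ₗ D ∘ₗ jetLift θ 0)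
  let b : Mat3 := LinearMap.toMatrix' (base ∘ₗ D ∘ₗ vert)
  let c : Mat3 := LinearMap.toMatrix' (mom ∘ₗ D ∘ₗ jetLift θ 0)
  let d : Mat3 := LinearMap.toMatrix' (mom ∘ₗ D ∘ₗ vert)
  have ha : ∀ v, a *ᵥ v = (D (jetLift θ 0 v)).1 := fun v => LinearMap.toMatrix'_mulVec _ _
  have hb : ∀ v, b *ᵥ v = (D (0, 0, v)).1 := fun v => LinearMap.toMatrix'_mulVec _ _
  have hc : ∀ v, c *ᵥ v = (D (jetLift θ 0 v)).2.2 := fun v => LinearMap.toMatrix'_mulVec _ _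
  have hd : ∀ v, d *ᵥ v = (D (0, 0, v)).2.2 := fun v => LinearMap.toMatrix'_mulVec _ _
  have hM : ∀ (h : Mat3) v, (D (jetLift θ h v)).1 = (a + b * h) *ᵥ v := fun h v => by
    rw [jetLift_eq_add, map_add, add_mulVec, ← mulVec_mulVec, ha, hb]
    rfl
  have hQ : ∀ (h : Mat3) v, (D (jetLift θ h v)).2.2 = (c + d * h) *ᵥ v := fun h v => by
    rw [jetLift_eq_add, map_add, add_mulVec, ← mulVec_mulVec, hc, hd]
    rfl
  -- Conformality is tested on lifts for two different Hessians at once. The case `h = k` yields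
  -- symmetry of `τ h`, the general case the difference formula.
  have hMQ : ∀ h k : Mat3, k.IsSymm →
      (a + b * k)ᵀ * (c + d * h) - (c + d * k)ᵀ * (a + b * h) = ρ • (h - k) := by
    intro h k hk
    have hvw : ∀ v w : R3, v ⬝ᵥ ((a + b * k)ᵀ * (c + d * h) - (c + d * k)ᵀ * (a + b * h)) *ᵥ w =
        v ⬝ᵥ (ρ • (h - k)) *ᵥ w := by
      intro v w
      have := hsym (jetLift θ k v) (jetLift θ h w) (contactForm_jetLift _ _ _)
        (contactForm_jetLift _ _ _)
      rw [hM, hM, hQ, hQ] at this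
      change _ = ρ * ((h *ᵥ w) ⬝ᵥ v - (k *ᵥ v) ⬝ᵥ w) at this
      have e1 : ∀ (A B : Mat3), v ⬝ᵥ (Aᵀ * B) *ᵥ w = (A *ᵥ v) ⬝ᵥ (B *ᵥ w) := fun A B => by
        rw [← mulVec_mulVec, dotProduct_mulVec, vecMul_transpose]
      have e2 : (k *ᵥ v) ⬝ᵥ w = v ⬝ᵥ k *ᵥ w := by
        rw [dotProduct_mulVec, ← mulVec_transpose, hk.eq]
      rw [sub_mulVec, dotProduct_sub, e1, e1, smul_mulVec, dotProduct_smul, sub_mulVec,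
        dotProduct_sub, smul_eq_mul, dotProduct_comm v (h *ᵥ w), ← e2, ← this,
        dotProduct_comm ((a + b * k) *ᵥ v)]
    ext i j
    simpa using hvw (Pi.single i 1) (Pi.single j 1)
  -- The image plane consists of the pairs `((a + b h) v, (c + d h) v)`; it is a graph over the base
  -- when `a + b h` is invertible.
  let τ : Mat3 → Mat3 := fun h => (c + d * h) * (a + b * h)⁻¹
  have hτM : ∀ h : Mat3, (a + b * h).det ≠ 0 → τ h * (a + b * h) = c + d * h := fun h hdet => by
    rw [mul_assoc, nonsing_inv_mul _ (Ne.isUnit hdet), mul_one]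
  have hτs : ∀ h : Mat3, h.IsSymm → (a + b * h).det ≠ 0 → (τ h).IsSymm := by
    intro h hh hdet
    have h1 : (a + b * h)ᵀ * (c + d * h) = (c + d * h)ᵀ * (a + b * h) := by
      have := hMQ h h hh
      rwa [sub_self, smul_zero, sub_eq_zero] at this
    have hu : IsUnit (a + b * h).det := Ne.isUnit hdet
    rw [IsSymm, transpose_mul]
    have h2 := congrArg (fun B => ((a + b * h)⁻¹)ᵀ * B * (a + b * h)⁻¹) h1
    rw [← mul_assoc, ← transpose_mul, mul_nonsing_inv _ hu, transpose_one, one_mul,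
      mul_assoc, mul_assoc, mul_nonsing_inv _ hu, mul_one] at h2
    exact h2.symm
  refine ⟨a, b, ρ, τ, ⟨hρ, ?_, hτs, ?_⟩, ha, hb, ?_⟩
  · intro y
    -- A preimage of a contact vector is a contact vector since `ρ ≠ 0`, hence splits into a lift
    -- and a vertical part.
    obtain ⟨z, hz⟩ := hsurj (jetLift (Φ θ) 0 y)
    have hz0 : contactForm θ z = 0 := by
      have := hcon z
      rw [hz, contactForm_jetLift] at this
      exact (mul_eq_zero.1 this.symm).resolve_left hρ
    refine ⟨z.1, z.2.2, ?_⟩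
    have := congrArg D (exists_jetLift_eq hz0)
    rw [map_add, hz] at this
    rw [ha, hb]
    exact (congrArg Prod.fst this).symm
  · intro h k hh hk hdh hdk
    have e : (a + b * k)ᵀ * τ k = (c + d * k)ᵀ := by
      rw [← hτM k hdk, transpose_mul, (hτs k hk hdk).eq]
    rw [mul_sub, sub_mul, mul_assoc, hτM h hdh, e, hMQ h k hk]
  · intro h hh hdet
    have hcomp : D ∘ₗ jetLift θ h = jetLift (Φ θ) (τ h) ∘ₗ (a + b * h).mulVecLin := by
      refine LinearMap.ext fun v => ?_
      have h1 := hM h v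
      have h3 := hQ h v
      have h2 : (D (jetLift θ h v)).2.1 = (Φ θ).2.2 ⬝ᵥ (D (jetLift θ h v)).1 := by
        have := hcon (jetLift θ h v)
        rw [contactForm_jetLift, mul_zero, contactForm_eq, sub_eq_zero] at this
        exact this
      refine Prod.ext h1 (Prod.ext ?_ ?_)
      · rw [LinearMap.comp_apply, h2, h1]
        rfl
      · rw [LinearMap.comp_apply, h3, ← hτM h hdet, ← mulVec_mulVec]
        rfl
    rw [jetPlane, jetPlane, ← LinearMap.range_comp, hcomp, LinearMap.range_comp_of_range_eq_top]
    rw [LinearMap.range_eq_top]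
    exact mulVec_surjective_iff_isUnit.2 ((isUnit_iff_isUnit_det _).2 (Ne.isUnit hdet))

/-! ### Symbols of the four classes -/

/-- Twice the principal symbol at the momentum `p` over the point `x`. -/
def principalSymbol : (X : WebClass) → WebParam X → R3 → R3 → Mat3
  | .A, (l₁, l₂, l₃), x, p =>
      !![0, (l₁ (x 0) - l₂ (x 1)) * p 2, (l₃ (x 2) - l₁ (x 0)) * p 1;
        (l₁ (x 0) - l₂ (x 1)) * p 2, 0, (l₂ (x 1) - l₃ (x 2)) * p 0;
        (l₃ (x 2) - l₁ (x 0)) * p 1, (l₂ (x 1) - l₃ (x 2)) * p 0, 0]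
  | .B, (l₂, l₃), x, p =>
      !![-2 * p 2, 0, p 0 - (l₂ (x 1) - l₃ (x 2)) * p 1;
        0, 0, (l₂ (x 1) - l₃ (x 2)) * p 0;
        p 0 - (l₂ (x 1) - l₃ (x 2)) * p 1, (l₂ (x 1) - l₃ (x 2)) * p 0, 0]
  | .C, l₃, x, p =>
      !![-2 * p 2, Real.exp (-(deriv l₃ (x 2) * x 1)) * p 1, p 0;
        Real.exp (-(deriv l₃ (x 2) * x 1)) * p 1, -2 * Real.exp (-(deriv l₃ (x 2) * x 1)) * p 0, 0;
        p 0, 0, 0]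
  | .D, (L, l₃), x, p =>
      !![2 * (L (zCoord x)).im * p 2, 0,
          -((L (zCoord x)).re - l₃ (x 2)) * p 1 - (L (zCoord x)).im * p 0;
        0, 2 * (L (zCoord x)).im * p 2,
          ((L (zCoord x)).re - l₃ (x 2)) * p 0 - (L (zCoord x)).im * p 1;
        -((L (zCoord x)).re - l₃ (x 2)) * p 1 - (L (zCoord x)).im * p 0,
          ((L (zCoord x)).re - l₃ (x 2)) * p 0 - (L (zCoord x)).im * p 1, 0]

theorem principalSymbol_isSymm (X : WebClass) (l : WebParam X) (x p : R3) :
    (principalSymbol X l x p).IsSymm := by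
  cases X <;> ext i j <;> fin_cases i <;> fin_cases j <;> rfl

/-- The equations are affine in the Hessian with the given symbol. -/
theorem exists_two_mul_webPDE_eq (X : WebClass) (l : WebParam X) (θ : Jet1) :
    ∃ c : ℝ, ∀ h : Mat3, h.IsSymm →
      2 * webPDE X l θ h = (principalSymbol X l θ.1 θ.2.2 * h).trace + c := by
  obtain ⟨x, u, p⟩ := θ
  cases X
  · obtain ⟨l₁, l₂, l₃⟩ := l
    refine ⟨0, fun h hh => ?_⟩
    simp only [webPDE, principalSymbol, trace, diag_apply, mul_apply, Fin.sum_univ_three]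
    simp [hh.apply 0 1, hh.apply 0 2, hh.apply 1 2]
    ring
  · obtain ⟨l₂, l₃⟩ := l
    refine ⟨2 * (deriv l₂ (x 1) * p 0 * p 2), fun h hh => ?_⟩
    simp only [webPDE, principalSymbol, trace, diag_apply, mul_apply, Fin.sum_univ_three]
    simp [hh.apply 0 1, hh.apply 0 2, hh.apply 1 2]
    ring
  · refine ⟨2 * (deriv (deriv l) (x 2) * x 1 * p 0 ^ 2), fun h hh => ?_⟩
    simp only [webPDE, principalSymbol, trace, diag_apply, mul_apply, Fin.sum_univ_three]
    simp [hh.apply 0 1, hh.apply 0 2, hh.apply 1 2]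
    ring
  · obtain ⟨L, l₃⟩ := l
    refine ⟨0, fun h hh => ?_⟩
    simp only [webPDE, principalSymbol, trace, diag_apply, mul_apply, Fin.sum_univ_three]
    simp [hh.apply 0 1, hh.apply 0 2, hh.apply 1 2]
    ring

/-- No equation of the four classes contains `f₃₃`. This supplies the isotropic vector required by
`HessianAction.eq_zero`. -/
theorem principalSymbol_isotropic (X : WebClass) (l : WebParam X) (x p : R3) :
    (Pi.single 2 1 : R3) ⬝ᵥ principalSymbol X l x p *ᵥ Pi.single 2 1 = 0 := by
  cases X <;> simp <;> rfl

theorem principalSymbol_det_ne_zero {X : WebClass} {l : WebParam X} {x p : R3}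
    (hx : x ∈ nondegLocus X l) (hp : ∀ i, p i ≠ 0) : (principalSymbol X l x p).det ≠ 0 := by
  have h0 := hp 0
  have h1 := hp 1
  have h2 := hp 2
  cases X
  · obtain ⟨l₁, l₂, l₃⟩ := l
    obtain ⟨a₁, a₂, a₃⟩ := hx
    have : (principalSymbol .A (l₁, l₂, l₃) x p).det = 2 * ((l₁ (x 0) - l₂ (x 1)) *
        (l₂ (x 1) - l₃ (x 2)) * (l₃ (x 2) - l₁ (x 0)) * (p 0 * p 1 * p 2)) := by
      simp [principalSymbol, det_fin_three]
      ring
    rw [this]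
    exact mul_ne_zero two_ne_zero (mul_ne_zero (mul_ne_zero (mul_ne_zero (sub_ne_zero.2 a₁)
      (sub_ne_zero.2 a₂)) (sub_ne_zero.2 a₃.symm)) (mul_ne_zero (mul_ne_zero h0 h1) h2))
  · obtain ⟨l₂, l₃⟩ := l
    have : (principalSymbol .B (l₂, l₃) x p).det =
        2 * (p 2 * ((l₂ (x 1) - l₃ (x 2)) * p 0) ^ 2) := by
      simp [principalSymbol, det_fin_three]
      ring
    rw [this]
    exact mul_ne_zero two_ne_zero (mul_ne_zero h2 (pow_ne_zero _
      (mul_ne_zero (sub_ne_zero.2 hx) h0)))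
  · have : (principalSymbol .C l x p).det =
        2 * (Real.exp (-(deriv l (x 2) * x 1)) * p 0 ^ 3) := by
      simp [principalSymbol, det_fin_three]
      ring
    rw [this]
    exact mul_ne_zero two_ne_zero (mul_ne_zero (Real.exp_ne_zero _) (pow_ne_zero _ h0))
  · obtain ⟨L, l₃⟩ := l
    have hb : (L (zCoord x)).im ≠ 0 := hx
    have : (principalSymbol .D (L, l₃) x p).det = -(2 * ((L (zCoord x)).im * p 2 *
        ((((L (zCoord x)).re - l₃ (x 2)) ^ 2 + (L (zCoord x)).im ^ 2) * (p 0 ^ 2 + p 1 ^ 2)))) := by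
      simp [principalSymbol, det_fin_three]
      ring
    rw [this]
    have := sq_pos_of_ne_zero hb
    have := sq_pos_of_ne_zero h0
    refine neg_ne_zero.2 (mul_ne_zero two_ne_zero (mul_ne_zero (mul_ne_zero hb h2)
      (mul_ne_zero ?_ ?_))) <;> positivity

/-- At a 1-jet with nonzero momenta, an equivalence of two equations maps the vertical plane to
the vertical plane and the symbol to a multiple of the symbol. -/
theorem IsContactTransformation.vertical_and_symbol {Φ : Jet1 → Jet1} {U : Set Jet1}
    (hΦ : IsContactTransformation Φ U) {X Y : WebClass} {l : WebParam X} {m : WebParam Y}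
    (hE : MapsEquation Φ U (webPDE X l) (webPDE Y m)) {θ : Jet1} (hθ : θ ∈ U)
    (hx : θ.1 ∈ nondegLocus X l) (hy : (Φ θ).1 ∈ nondegLocus Y m) (hp : ∀ i, θ.2.2 i ≠ 0)
    (hq : ∀ i, (Φ θ).2.2 i ≠ 0) :
    (∀ w, (fderiv ℝ Φ θ (0, 0, w)).1 = 0) ∧
      ∃ (a : Mat3) (σ : ℝ), σ ≠ 0 ∧ (∀ v, a *ᵥ v = (fderiv ℝ Φ θ (jetLift θ 0 v)).1) ∧
        principalSymbol Y m (Φ θ).1 (Φ θ).2.2 = σ • (a * principalSymbol X l θ.1 θ.2.2 * aᵀ) := by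
  obtain ⟨a, b, ρ, τ, hτ, ha, hb, hmap⟩ := hΦ.exists_hessianAction hθ
  obtain ⟨c, hc⟩ := exists_two_mul_webPDE_eq X l θ
  obtain ⟨c', hc'⟩ := exists_two_mul_webPDE_eq Y m (Φ θ)
  have hdet' := principalSymbol_det_ne_zero hy hq
  obtain ⟨hb0, σ, hσ, hS⟩ := hτ.eq_zero (c := c) (c' := c') (principalSymbol_isSymm X l θ.1 θ.2.2)
    (principalSymbol_det_ne_zero hx hp) (e := Pi.single 2 1) (by simp)
    (principalSymbol_isotropic X l _ _) (principalSymbol_isSymm Y m (Φ θ).1 (Φ θ).2.2)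
    (fun h0 => hdet' (by rw [h0]; simp)) (fun h hh hdet => by
      rw [← hc h hh, ← hc' _ (hτ.isSymm h hh hdet), mul_eq_zero, mul_eq_zero,
        or_iff_right two_ne_zero, or_iff_right two_ne_zero]
      exact hE θ hθ h (τ h) hh (hτ.isSymm h hh hdet) (hmap h hh hdet))
  refine ⟨fun w => ?_, a, σ, hσ, ha, hS⟩
  rw [← hb, hb0, zero_mulVec]

end

noncomputable section
open Matrix

/-! ### The symbol as a function of the conormal in the space of dependent and independent
variables -/

/-- Vectors and covectors in the four-dimensional space of dependent and independent variables. -/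
abbrev R4 : Type := Fin 4 → ℝ

/-- Real square matrices of size four. -/
abbrev Mat4 : Type := Matrix (Fin 4) (Fin 4) ℝ

/-- The family of symbols of class A with coefficients `α, β, γ`, `α + β + γ = 0`. -/
def conormalFormA (α β γ : ℝ) (n : R4) : Mat4 :=
  !![0, -(γ * n 2 * n 3), -(β * n 1 * n 3), -(α * n 1 * n 2);
    -(γ * n 2 * n 3), 0, -(α * n 0 * n 3), -(β * n 0 * n 2);
    -(β * n 1 * n 3), -(α * n 0 * n 3), 0, -(γ * n 0 * n 1);
    -(α * n 1 * n 2), -(β * n 0 * n 2), -(γ * n 0 * n 1), 0]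

/-- The family of symbols of class B. -/
def conormalFormB (μ : ℝ) (n : R4) : Mat4 :=
  !![2 * n 2 * n 3, 0, -(n 0 - μ * n 1) * n 3, -(n 0 * n 2) - μ * n 1 * n 2;
    0, 0, -(μ * n 0 * n 3), μ * n 0 * n 2;
    -(n 0 - μ * n 1) * n 3, -(μ * n 0 * n 3), 0, n 0 ^ 2;
    -(n 0 * n 2) - μ * n 1 * n 2, μ * n 0 * n 2, n 0 ^ 2, 0]

/-- The family of symbols of class C. -/
def conormalFormC (ε : ℝ) (n : R4) : Mat4 :=
  !![2 * n 2 * n 3, -(ε * n 1 * n 3), -(n 0 * n 3), -(n 0 * n 2) + ε * n 1 ^ 2;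
    -(ε * n 1 * n 3), 2 * ε * n 0 * n 3, 0, -(ε * n 0 * n 1);
    -(n 0 * n 3), 0, 0, n 0 ^ 2;
    -(n 0 * n 2) + ε * n 1 ^ 2, -(ε * n 0 * n 1), n 0 ^ 2, 0]

/-- The family of symbols of class D. -/
def conormalFormD (κ b : ℝ) (n : R4) : Mat4 :=
  !![-(2 * b * n 2 * n 3), 0, (κ * n 1 + b * n 0) * n 3, b * n 0 * n 2 - κ * n 1 * n 2;
    0, -(2 * b * n 2 * n 3), -(κ * n 0 - b * n 1) * n 3, b * n 1 * n 2 + κ * n 0 * n 2;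
    (κ * n 1 + b * n 0) * n 3, -(κ * n 0 - b * n 1) * n 3, 0, -(b * (n 0 ^ 2 + n 1 ^ 2));
    b * n 0 * n 2 - κ * n 1 * n 2, b * n 1 * n 2 + κ * n 0 * n 2, -(b * (n 0 ^ 2 + n 1 ^ 2)), 0]

/-- The symbol as a quadratic function of the conormal `n`, which is `(p, -1)` at the momentum
`p`. -/
def conormalForm : (X : WebClass) → WebParam X → R3 → R4 → Mat4
  | .A, (l₁, l₂, l₃), x => conormalFormA (l₂ (x 1) - l₃ (x 2)) (l₃ (x 2) - l₁ (x 0))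
      (l₁ (x 0) - l₂ (x 1))
  | .B, (l₂, l₃), x => conormalFormB (l₂ (x 1) - l₃ (x 2))
  | .C, l₃, x => conormalFormC (Real.exp (-(deriv l₃ (x 2) * x 1)))
  | .D, (L, l₃), x => conormalFormD ((L (zCoord x)).re - l₃ (x 2)) (L (zCoord x)).im

/-- The conormal of the hyperplane `du = p dx`. -/
def conormal (p : R3) : R4 := ![p 0, p 1, p 2, -1]

/-- The parametrization of the hyperplane `du = p dx` by `dx`. -/
def graphMatrix (p : R3) : Matrix (Fin 4) (Fin 3) ℝ :=
  !![1, 0, 0; 0, 1, 0; 0, 0, 1; p 0, p 1, p 2]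

/-- The pushed-forward symbol could be cubic in `p`, but its last diagonal entry `p · S p` vanishes
for all four classes. What remains is homogeneous quadratic in `(p, -1)`. -/
theorem conormalForm_conormal (X : WebClass) (l : WebParam X) (x p : R3) :
    conormalForm X l x (conormal p) =
      graphMatrix p * principalSymbol X l x p * (graphMatrix p)ᵀ := by
  cases X
  · obtain ⟨l₁, l₂, l₃⟩ := l
    ext i j
    fin_cases i <;> fin_cases j <;>
      simp [conormalForm, conormalFormA, conormal, graphMatrix, principalSymbol, mul_apply,
        Fin.sum_univ_three] <;> ring
  · obtain ⟨l₂, l₃⟩ := l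
    ext i j
    fin_cases i <;> fin_cases j <;>
      simp [conormalForm, conormalFormB, conormal, graphMatrix, principalSymbol, mul_apply,
        Fin.sum_univ_three] <;> ring
  · ext i j
    fin_cases i <;> fin_cases j <;>
      simp [conormalForm, conormalFormC, conormal, graphMatrix, principalSymbol, mul_apply,
        Fin.sum_univ_three] <;> ring
  · obtain ⟨L, l₃⟩ := l
    ext i j
    fin_cases i <;> fin_cases j <;>
      simp [conormalForm, conormalFormD, conormal, graphMatrix, principalSymbol, mul_apply,
        Fin.sum_univ_three] <;> ring

/-- A contact transformation carries the normalized conormal to a normalized one only up to its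
conformal factor; homogeneity absorbs that factor. -/
theorem conormalForm_smul (X : WebClass) (l : WebParam X) (x : R3) (c : ℝ) (n : R4) :
    conormalForm X l x (c • n) = c ^ 2 • conormalForm X l x n := by
  cases X
  · obtain ⟨l₁, l₂, l₃⟩ := l
    ext i j
    fin_cases i <;> fin_cases j <;> simp [conormalForm, conormalFormA] <;> ring
  · obtain ⟨l₂, l₃⟩ := l
    ext i j
    fin_cases i <;> fin_cases j <;> simp [conormalForm, conormalFormB] <;> ring
  · ext i j
    fin_cases i <;> fin_cases j <;> simp [conormalForm, conormalFormC] <;> ring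
  · obtain ⟨L, l₃⟩ := l
    ext i j
    fin_cases i <;> fin_cases j <;> simp [conormalForm, conormalFormD] <;> ring

theorem contDiff_conormalForm (X : WebClass) (l : WebParam X) (x : R3) (i j : Fin 4) :
    ContDiff ℝ ω (fun n => conormalForm X l x n i j) := by
  cases X
  · obtain ⟨l₁, l₂, l₃⟩ := l
    fin_cases i <;> fin_cases j <;> simp [conormalForm, conormalFormA] <;> fun_prop
  · obtain ⟨l₂, l₃⟩ := l
    fin_cases i <;> fin_cases j <;> simp [conormalForm, conormalFormB] <;> fun_prop
  · fin_cases i <;> fin_cases j <;> simp [conormalForm, conormalFormC] <;> fun_prop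
  · obtain ⟨L, l₃⟩ := l
    fin_cases i <;> fin_cases j <;> simp [conormalForm, conormalFormD] <;> fun_prop

/-! ### Equivalences are point transformations -/

theorem dense_momentum_ne_zero : Dense {θ : Jet1 | ∀ i, θ.2.2 i ≠ 0} := by
  intro θ
  rw [Metric.mem_closure_iff]
  intro ε hε
  refine ⟨(θ.1, θ.2.1, fun i => if θ.2.2 i = 0 then ε / 2 else θ.2.2 i), fun i => ?_, ?_⟩
  · by_cases h : θ.2.2 i = 0
    · simp [h, hε.ne']
    · simp [h]
  · simp only [Prod.dist_eq, dist_self]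
    refine max_lt hε (max_lt hε ((dist_pi_lt_iff hε).2 fun i => ?_))
    by_cases h : θ.2.2 i = 0
    · simp [h, abs_of_pos hε]
      exact hε
    · simpa [h] using hε

theorem isOpen_momentum_ne_zero : IsOpen {θ : Jet1 | ∀ i, θ.2.2 i ≠ 0} := by
  simp only [Set.ofPred_forall]
  exact isOpen_iInter_of_finite fun i => isOpen_ne_fun (by fun_prop) (by fun_prop)

/-- Symbols are known to be nondegenerate only where no momentum vanishes. That set is open and
dense and `Φ` is open, so the condition can be met at source and target simultaneously. -/
theorem IsContactTransformation.exists_ball {Φ : Jet1 → Jet1} {U : Set Jet1}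
    (hΦ : IsContactTransformation Φ U) (hU : U.Nonempty) :
    ∃ (θ₀ : Jet1) (r : ℝ), 0 < r ∧ ∀ θ ∈ Metric.ball θ₀ r,
      θ ∈ U ∧ (∀ i, θ.2.2 i ≠ 0) ∧ ∀ i, (Φ θ).2.2 i ≠ 0 := by
  have hopen : IsOpen (U ∩ Φ ⁻¹' {θ : Jet1 | ∀ i, θ.2.2 i ≠ 0}) :=
    hΦ.contDiffOn.continuousOn.isOpen_inter_preimage hΦ.isOpen isOpen_momentum_ne_zero
  have hne : (U ∩ Φ ⁻¹' {θ : Jet1 | ∀ i, θ.2.2 i ≠ 0}).Nonempty := by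
    obtain ⟨θ, hθ⟩ := hU
    have hs : HasStrictFDerivAt Φ (fderiv ℝ Φ θ) θ :=
      (hΦ.contDiffAt hθ).hasStrictFDerivAt (by simp)
    have hmap := hs.map_nhds_eq_of_surj (LinearMap.range_eq_top.2 (hΦ.bijective_fderiv θ hθ).2)
    have himg : Φ '' U ∈ nhds (Φ θ) := by
      rw [← hmap]
      exact Filter.image_mem_map (hΦ.isOpen.mem_nhds hθ)
    obtain ⟨_, h, θ', hθ', rfl⟩ := dense_momentum_ne_zero.inter_nhds_nonempty himg
    exact ⟨θ', hθ', h⟩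
  obtain ⟨θ₀, hθ₀, hθ₀'⟩ := dense_momentum_ne_zero.inter_open_nonempty _ hopen hne
  obtain ⟨r, hr, hball⟩ := Metric.isOpen_iff.1 (hopen.inter isOpen_momentum_ne_zero) θ₀
    ⟨hθ₀, hθ₀'⟩
  exact ⟨θ₀, r, hr, fun θ hθ => ⟨(hball hθ).1.1, (hball hθ).2, (hball hθ).1.2⟩⟩

/-- The projection of 1-jets, or of their tangent vectors, to the space of dependent and
independent variables. -/
def projJ0 : Jet1 →L[ℝ] R3 × ℝ :=
  (ContinuousLinearMap.fst ℝ R3 (ℝ × R3)).prod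
    ((ContinuousLinearMap.fst ℝ ℝ R3).comp (ContinuousLinearMap.snd ℝ R3 (ℝ × R3)))

/-- Freezing the momentum. -/
def freezeMomentum (p : R3) (θ : Jet1) : Jet1 := (θ.1, θ.2.1, p)

theorem hasFDerivAt_freezeMomentum (p : R3) (θ : Jet1) :
    HasFDerivAt (freezeMomentum p) ((ContinuousLinearMap.fst ℝ R3 (ℝ × R3)).prod
      (((ContinuousLinearMap.fst ℝ ℝ R3).comp (ContinuousLinearMap.snd ℝ R3 (ℝ × R3))).prod
        (0 : Jet1 →L[ℝ] R3))) θ := by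
  refine HasFDerivAt.prodMk hasFDerivAt_fst (HasFDerivAt.prodMk ?_ (hasFDerivAt_const _ _))
  exact hasFDerivAt_fst.comp θ hasFDerivAt_snd

theorem freezeMomentum_mem_ball {θ₀ θ : Jet1} {r : ℝ} (hθ : θ ∈ Metric.ball θ₀ r) {p : R3}
    (hp : p ∈ Metric.ball θ₀.2.2 r) : freezeMomentum p θ ∈ Metric.ball θ₀ r := by
  rw [Metric.mem_ball, Prod.dist_eq, max_lt_iff, Prod.dist_eq, max_lt_iff] at hθ ⊢
  exact ⟨hθ.1, hθ.2.1, hp⟩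

section Point

variable {Φ : Jet1 → Jet1} {θ₀ : Jet1} {r : ℝ}

/-- The `(x, u)` part of `Φ` has zero derivative in the momentum, and the momentum slice of a ball
in the maximum metric is again a ball, hence connected. -/
theorem projJ0_eq_of_vertical (hd : ∀ θ ∈ Metric.ball θ₀ r, DifferentiableAt ℝ Φ θ)
    (hv : ∀ θ ∈ Metric.ball θ₀ r, ∀ w, projJ0 (fderiv ℝ Φ θ (0, 0, w)) = 0)
    {θ : Jet1} (hθ : θ ∈ Metric.ball θ₀ r) {p : R3} (hp : p ∈ Metric.ball θ₀.2.2 r) :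
    projJ0 (Φ θ) = projJ0 (Φ (freezeMomentum p θ)) := by
  have hlift : ∀ q, HasFDerivAt (fun q : R3 => ((θ.1, θ.2.1, q) : Jet1))
      ((0 : R3 →L[ℝ] R3).prod ((0 : R3 →L[ℝ] ℝ).prod (ContinuousLinearMap.id ℝ R3))) q := fun q =>
    (hasFDerivAt_const _ _).prodMk ((hasFDerivAt_const _ _).prodMk (hasFDerivAt_id q))
  have hmem : ∀ q ∈ Metric.ball θ₀.2.2 r, ((θ.1, θ.2.1, q) : Jet1) ∈ Metric.ball θ₀ r :=
    fun q hq => freezeMomentum_mem_ball hθ hq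
  have hder : ∀ q ∈ Metric.ball θ₀.2.2 r,
      HasFDerivAt (fun q : R3 => projJ0 (Φ (θ.1, θ.2.1, q))) (0 : R3 →L[ℝ] R3 × ℝ) q := by
    intro q hq
    have h1 := (projJ0.hasFDerivAt.comp _ (hd _ (hmem q hq)).hasFDerivAt).comp q (hlift q)
    exact h1.congr_fderiv (ContinuousLinearMap.ext fun w => hv _ (hmem q hq) w)
  have hθp : θ.2.2 ∈ Metric.ball θ₀.2.2 r := by
    rw [Metric.mem_ball, Prod.dist_eq, max_lt_iff, Prod.dist_eq, max_lt_iff] at hθ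
    exact hθ.2.2
  exact Metric.isOpen_ball.is_const_of_fderiv_eq_zero (𝕜 := ℝ)
    (Metric.isPreconnected_ball (x := θ₀.2.2) (r := r))
    (fun q hq => (hder q hq).differentiableAt.differentiableWithinAt)
    (fun q hq => (hder q hq).fderiv) hθp hp

theorem projJ0_fderiv_eq_of_vertical (hd : ∀ θ ∈ Metric.ball θ₀ r, DifferentiableAt ℝ Φ θ)
    (hv : ∀ θ ∈ Metric.ball θ₀ r, ∀ w, projJ0 (fderiv ℝ Φ θ (0, 0, w)) = 0)
    {θ : Jet1} (hθ : θ ∈ Metric.ball θ₀ r) {p : R3} (hp : p ∈ Metric.ball θ₀.2.2 r) (v : Jet1) :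
    projJ0 (fderiv ℝ Φ θ v) =
      projJ0 (fderiv ℝ Φ (freezeMomentum p θ) (v.1, v.2.1, 0)) := by
  have h1 := projJ0.hasFDerivAt.comp θ (hd θ hθ).hasFDerivAt
  have h2 := (projJ0.hasFDerivAt.comp _ (hd _ (freezeMomentum_mem_ball hθ hp)).hasFDerivAt).comp θ
    (hasFDerivAt_freezeMomentum p θ)
  have hev : (fun θ => projJ0 (Φ θ)) =ᶠ[nhds θ] fun θ => projJ0 (Φ (freezeMomentum p θ)) := by
    filter_upwards [Metric.isOpen_ball.mem_nhds hθ] with θ' hθ'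
    exact projJ0_eq_of_vertical hd hv hθ' hp
  exact congrArg (fun f : Jet1 →L[ℝ] R3 × ℝ => f v) (h1.unique (h2.congr_of_eventuallyEq hev))

end Point

/-- Coordinates on the space of dependent and independent variables. -/
def toR4 : R3 × ℝ →ₗ[ℝ] R4 where
  toFun z := ![z.1 0, z.1 1, z.1 2, z.2]
  map_add' z w := by ext i; fin_cases i <;> simp
  map_smul' c z := by ext i; fin_cases i <;> simp

/-- The horizontal tangent vector with the given coordinates. -/
def ofR4 : R4 →ₗ[ℝ] Jet1 where
  toFun n := (![n 0, n 1, n 2], n 3, 0)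
  map_add' z w := by simp
  map_smul' c z := by simp

theorem toR4_projJ0_ofR4 (n : R4) : toR4 (projJ0 (ofR4 n)) = n := by
  ext i
  fin_cases i <;> rfl

theorem ofR4_toR4_projJ0 (z : Jet1) : ofR4 (toR4 (projJ0 z)) = (z.1, z.2.1, 0) := by
  refine Prod.ext ?_ rfl
  ext i
  fin_cases i <;> rfl

theorem conormal_dotProduct_toR4 (θ z : Jet1) :
    conormal θ.2.2 ⬝ᵥ toR4 (projJ0 z) = -contactForm θ z := by
  simp [conormal, toR4, projJ0, contactForm, dotProduct, Fin.sum_univ_four, Fin.sum_univ_three]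
  ring

theorem graphMatrix_mulVec (p v : R3) : graphMatrix p *ᵥ v = toR4 (v, p ⬝ᵥ v) := by
  ext i
  fin_cases i <;> simp [graphMatrix, toR4, mulVec, dotProduct, Fin.sum_univ_three]

/-- An equivalence of equations of two classes induces a linear map of four-dimensional spaces that
matches their families of symbols. -/
theorem ContactEquivalent.exists_linear {X Y : WebClass} {Ω Ω' : Set R3} {l : WebParam X}
    {m : WebParam Y} (hl : IsWebParam X Ω l) (hm : IsWebParam Y Ω' m)
    (h : ContactEquivalent Ω (webPDE X l) Ω' (webPDE Y m)) :
    ∃ x ∈ nondegLocus X l, ∃ y ∈ nondegLocus Y m, ∃ L : Mat4, L.det ≠ 0 ∧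
      ∃ (p₀ : R3) (r : ℝ), 0 < r ∧ ∀ p ∈ Metric.ball p₀ r, ∃ κ : ℝ,
        conormalForm Y m y (conormal p ᵥ* L⁻¹) =
          κ • (L * conormalForm X l x (conormal p) * Lᵀ) := by
  obtain ⟨U, Φ, hU, hΦ, hUΩ, hUΩ', hE⟩ := h
  obtain ⟨θ₀, r, hr, hball⟩ := hΦ.exists_ball hU
  have hθ₀ : θ₀ ∈ Metric.ball θ₀ r := Metric.mem_ball_self hr
  have hp₀ : θ₀.2.2 ∈ Metric.ball θ₀.2.2 r := Metric.mem_ball_self hr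
  have hd : ∀ θ ∈ Metric.ball θ₀ r, DifferentiableAt ℝ Φ θ := fun θ hθ =>
    (hΦ.contDiffAt (hball θ hθ).1).differentiableAt (by simp)
  have hvs := fun θ hθ => hΦ.vertical_and_symbol hE (hball θ hθ).1
    (hl.nondeg (hUΩ θ (hball θ hθ).1)) (hm.nondeg (hUΩ' θ (hball θ hθ).1))
    (hball θ hθ).2.1 (hball θ hθ).2.2
  -- The `x` part vanishes by rigidity of the vertical plane; the `u` part then vanishes because
  -- vertical vectors are contact vectors.
  have hv : ∀ θ ∈ Metric.ball θ₀ r, ∀ w, projJ0 (fderiv ℝ Φ θ (0, 0, w)) = 0 := by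
    intro θ hθ w
    have h1 := (hvs θ hθ).1 w
    obtain ⟨ρ, -, hρ⟩ := hΦ.contact θ (hball θ hθ).1
    have h2 := hρ (0, 0, w)
    rw [contactForm_eq, h1] at h2
    have h3 : (fderiv ℝ Φ θ (0, 0, w)).2.1 = 0 := by simpa [contactForm] using h2
    exact Prod.ext h1 h3
  have hDp := fun θ (hθ : θ ∈ Metric.ball θ₀ r) v =>
    projJ0_fderiv_eq_of_vertical hd hv hθ hp₀ v
  have hΦp := fun θ (hθ : θ ∈ Metric.ball θ₀ r) => projJ0_eq_of_vertical hd hv hθ hp₀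
  have hU₀ := (hball θ₀ hθ₀).1
  let D : Jet1 →ₗ[ℝ] Jet1 := (fderiv ℝ Φ θ₀ : Jet1 →ₗ[ℝ] Jet1)
  have hDinj : Function.Injective D := (hΦ.bijective_fderiv θ₀ hU₀).1
  let vert : R3 →ₗ[ℝ] Jet1 := LinearMap.inr ℝ R3 (ℝ × R3) ∘ₗ LinearMap.inr ℝ ℝ R3
  let mom : Jet1 →ₗ[ℝ] R3 := LinearMap.snd ℝ ℝ R3 ∘ₗ LinearMap.snd ℝ R3 (ℝ × R3)
  let L : Mat4 := LinearMap.toMatrix' (toR4 ∘ₗ (projJ0 : Jet1 →ₗ[ℝ] R3 × ℝ) ∘ₗ D ∘ₗ ofR4)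
  have hL : ∀ n, L *ᵥ n = toR4 (projJ0 (fderiv ℝ Φ θ₀ (ofR4 n))) := fun n =>
    LinearMap.toMatrix'_mulVec _ _
  -- The point of the construction: the same `L` describes the differential at every jet over the
  -- base point.
  have hLz : ∀ θ ∈ Metric.ball θ₀ r, freezeMomentum θ₀.2.2 θ = θ₀ → ∀ z,
      L *ᵥ toR4 (projJ0 z) = toR4 (projJ0 (fderiv ℝ Φ θ z)) := by
    intro θ hθ hfr z
    rw [hL, ofR4_toR4_projJ0, hDp θ hθ, hfr]
  have hvert : Function.Surjective (mom ∘ₗ D ∘ₗ vert) := by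
    refine LinearMap.injective_iff_surjective.1 ?_
    rw [← LinearMap.ker_eq_bot, LinearMap.ker_eq_bot']
    intro w hw
    have h0 : D (vert w) = D 0 := by
      rw [map_zero]
      have h1 := hv θ₀ hθ₀ w
      exact Prod.ext (congrArg (fun z : R3 × ℝ => z.1) h1)
        (Prod.ext (congrArg (fun z : R3 × ℝ => z.2) h1) hw)
    exact congrArg (fun z : Jet1 => z.2.2) (hDinj h0)
  -- A null vector of `L` gives a horizontal vector with vertical image. Vertical vectors already
  -- map onto vertical ones, so injectivity makes it vertical as well, hence zero.
  have hLdet : L.det ≠ 0 := by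
    intro h0
    obtain ⟨n, hn, hLn⟩ := exists_mulVec_eq_zero_iff.2 h0
    rw [hL] at hLn
    obtain ⟨w, hw⟩ := hvert (mom (D (ofR4 n)))
    have heq : D (vert w) = D (ofR4 n) := by
      have h1 := hv θ₀ hθ₀ w
      have e : ∀ i, toR4 (projJ0 (fderiv ℝ Φ θ₀ (ofR4 n))) i = 0 := fun i => by rw [hLn]; rfl
      refine Prod.ext ?_ (Prod.ext ?_ hw)
      · refine (congrArg (fun z : R3 × ℝ => z.1) h1).trans (funext fun i => ?_)
        fin_cases i
        · exact (e 0).symm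
        · exact (e 1).symm
        · exact (e 2).symm
      · exact (congrArg (fun z : R3 × ℝ => z.2) h1).trans (e 3).symm
    have := hDinj heq
    apply hn
    rw [← toR4_projJ0_ofR4 n, ← this]
    ext i
    fin_cases i <;> rfl
  have hLu : IsUnit L.det := Ne.isUnit hLdet
  refine ⟨θ₀.1, hl.nondeg (hUΩ _ hU₀), (Φ θ₀).1, hm.nondeg (hUΩ' _ hU₀), L, hLdet,
    θ₀.2.2, r, hr, fun p hp => ?_⟩
  set θ : Jet1 := freezeMomentum p θ₀ with hθdef
  have hθ : θ ∈ Metric.ball θ₀ r := freezeMomentum_mem_ball hθ₀ hp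
  have hfr : freezeMomentum θ₀.2.2 θ = θ₀ := rfl
  have hbase : (Φ θ).1 = (Φ θ₀).1 := congrArg (fun z : R3 × ℝ => z.1) (hΦp θ hθ)
  obtain ⟨-, a, σ, hσ, ha, hS⟩ := hvs θ hθ
  obtain ⟨ρ, hρ, hcon⟩ := hΦ.contact θ (hball θ hθ).1
  -- The conormal represents minus the contact form, so this is the contact condition read in `ℝ⁴`.
  have hN : conormal (Φ θ).2.2 ᵥ* L = ρ • conormal p := by
    refine dotProduct_eq _ _ fun n => ?_
    rw [← dotProduct_mulVec, ← toR4_projJ0_ofR4 n, hLz θ hθ hfr, conormal_dotProduct_toR4, hcon,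
      smul_dotProduct, smul_eq_mul]
    rw [show conormal p ⬝ᵥ toR4 (projJ0 (ofR4 n)) = - contactForm θ (ofR4 n) from
      conormal_dotProduct_toR4 θ _]
    ring
  have hN' : conormal (Φ θ).2.2 = ρ • (conormal p ᵥ* L⁻¹) := by
    rw [← smul_vecMul, ← hN, vecMul_vecMul, mul_nonsing_inv _ hLu, vecMul_one]
  have hJ : L * graphMatrix p = graphMatrix (Φ θ).2.2 * a := by
    refine ext_of_mulVec_single fun i => ?_
    rw [← mulVec_mulVec, ← mulVec_mulVec, ha, graphMatrix_mulVec, graphMatrix_mulVec]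
    have h1 : (((Pi.single i 1 : R3), p ⬝ᵥ Pi.single i 1) : R3 × ℝ) =
        projJ0 (jetLift θ 0 (Pi.single i 1)) := rfl
    have h2 : (fderiv ℝ Φ θ (jetLift θ 0 (Pi.single i 1))).2.1 =
        (Φ θ).2.2 ⬝ᵥ (fderiv ℝ Φ θ (jetLift θ 0 (Pi.single i 1))).1 := by
      have := hcon (jetLift θ 0 (Pi.single i 1))
      rw [contactForm_jetLift, mul_zero, contactForm_eq, sub_eq_zero] at this
      exact this
    rw [h1, hLz θ hθ hfr, ← h2]
    rfl
  have hT : conormalForm Y m (Φ θ₀).1 (conormal (Φ θ).2.2) =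
      σ • (L * conormalForm X l θ₀.1 (conormal p) * Lᵀ) := by
    rw [conormalForm_conormal, conormalForm_conormal, ← hbase, hS]
    have h3 : L * (graphMatrix p * principalSymbol X l θ₀.1 p * (graphMatrix p)ᵀ) * Lᵀ =
        (L * graphMatrix p) * principalSymbol X l θ₀.1 p * (L * graphMatrix p)ᵀ := by
      rw [transpose_mul]
      simp only [Matrix.mul_assoc]
    rw [h3, hJ, transpose_mul, Matrix.mul_smul, Matrix.smul_mul]
    simp only [Matrix.mul_assoc]
    rfl
  rw [hN', conormalForm_smul] at hT
  refine ⟨(ρ ^ 2)⁻¹ * σ, ?_⟩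
  rw [← smul_smul, ← hT, smul_smul, inv_mul_cancel₀ (pow_ne_zero _ hρ), one_smul]

end

noncomputable section
open Matrix

/-! ### The singular conormals -/

/-- Analytic functions on a connected space have no zero divisors, by the identity theorem. -/
theorem eq_zero_or_eq_zero_of_contDiff_omega {f g : R4 → ℝ} (hf : ContDiff ℝ ω f)
    (hg : ContDiff ℝ ω g) (h : ∀ n, f n * g n = 0) : (∀ n, f n = 0) ∨ ∀ n, g n = 0 := by
  by_contra hcon
  push Not at hcon
  obtain ⟨⟨n₀, hn₀⟩, n₁, hn₁⟩ := hcon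
  have hev : g =ᶠ[nhds n₀] 0 := by
    filter_upwards [hf.continuous.continuousAt.eventually_ne hn₀] with n hn
    exact (mul_eq_zero.1 (h n)).resolve_left hn
  have hga : AnalyticOnNhd ℝ g Set.univ := fun n _ => hg.contDiffAt.analyticAt
  exact hn₁ (hga.eqOn_zero_of_preconnected_of_eventuallyEq_zero isPreconnected_univ
    (Set.mem_univ n₀) hev (Set.mem_univ n₁))

/-- Linear dependence of two matrices. -/
def Parallel (A B : Mat4) : Prop := ∀ i j k l, A i j * B k l = A k l * B i j

theorem Parallel.exists_smul {A B : Mat4} (h : Parallel A B) (hB : B ≠ 0) : ∃ κ : ℝ, A = κ • B := by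
  obtain ⟨k, hk⟩ := Function.ne_iff.1 hB
  obtain ⟨l, hkl⟩ := Function.ne_iff.1 hk
  have hkl' : B k l ≠ 0 := hkl
  refine ⟨A k l / B k l, ?_⟩
  ext i j
  rw [Matrix.smul_apply, smul_eq_mul, div_mul_eq_mul_div, ← h i j k l, mul_div_cancel_right₀ _ hkl']

theorem parallel_smul (κ : ℝ) (B : Mat4) : Parallel (κ • B) B := fun i j k l => by
  simp only [Matrix.smul_apply, smul_eq_mul]
  ring

theorem Parallel.symm {A B : Mat4} (h : Parallel A B) : Parallel B A := fun i j k l => by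
  rw [mul_comm, ← h i j k l, mul_comm]

theorem Parallel.conj {A B : Mat4} (h : Parallel A B) (P : Mat4) :
    Parallel (P * A * Pᵀ) (P * B * Pᵀ) := by
  by_cases hB : B = 0
  · intro i j k l
    simp [hB]
  · obtain ⟨κ, rfl⟩ := h.exists_smul hB
    rw [mul_smul_comm, smul_mul_assoc]
    exact parallel_smul _ _

/-- The linear map `L` matches the families of symbols of two equations up to factors. -/
structure SymbolMatch {X Y : WebClass} (l : WebParam X) (x : R3) (m : WebParam Y) (y : R3)
    (L : Mat4) : Prop where
  source : x ∈ nondegLocus X l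
  target : y ∈ nondegLocus Y m
  det_ne_zero : L.det ≠ 0
  parallel : ∀ n : R4, Parallel (conormalForm Y m y (n ᵥ* L⁻¹)) (L * conormalForm X l x n * Lᵀ)

theorem SymbolMatch.symm {X Y : WebClass} {l : WebParam X} {x : R3} {m : WebParam Y} {y : R3}
    {L : Mat4} (h : SymbolMatch l x m y L) : SymbolMatch m y l x L⁻¹ where
  source := h.target
  target := h.source
  det_ne_zero := by
    rw [det_nonsing_inv, Ring.inverse_eq_inv']
    exact inv_ne_zero h.det_ne_zero
  parallel := by
    have hLu : IsUnit L.det := Ne.isUnit h.det_ne_zero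
    intro n
    have h1 := ((h.parallel (n ᵥ* L)).conj L⁻¹).symm
    rw [vecMul_vecMul, mul_nonsing_inv _ hLu, vecMul_one] at h1
    have h2 : L⁻¹ * (L * conormalForm X l x (n ᵥ* L) * Lᵀ) * (L⁻¹)ᵀ =
        conormalForm X l x (n ᵥ* L) := by
      rw [mul_assoc, mul_assoc, ← transpose_mul, nonsing_inv_mul _ hLu, transpose_one, mul_one,
        ← mul_assoc, nonsing_inv_mul _ hLu, one_mul]
    rw [h2] at h1
    rwa [nonsing_inv_nonsing_inv _ hLu]

theorem contDiff_vecMul (P : Mat4) : ContDiff ℝ ω (fun n : R4 => n ᵥ* P) :=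
  (LinearMap.toContinuousLinearMap (Matrix.vecMulLinear P)).contDiff

/-- Conormals of momenta fill only the slice `n₃ = -1`; their multiples fill an open set, as the
identity theorem requires. -/
theorem exists_conormal_smul {p₀ : R3} {r : ℝ} (hr : 0 < r) :
    ∀ᶠ n in nhds (conormal p₀), ∃ (c : ℝ), ∃ p ∈ Metric.ball p₀ r, n = c • conormal p := by
  have hc : ContinuousAt (fun n : R4 => (![n 0 / -n 3, n 1 / -n 3, n 2 / -n 3] : R3))
      (conormal p₀) := by
    refine continuousAt_pi.2 fun i => ?_
    have h3 : -(conormal p₀ 3) ≠ 0 := by simp [conormal]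
    have hd : ∀ k : Fin 4, ContinuousAt (fun n : R4 => n k / -n 3) (conormal p₀) := fun k =>
      (continuous_apply k).continuousAt.div (continuous_apply 3).neg.continuousAt h3
    fin_cases i
    · exact hd 0
    · exact hd 1
    · exact hd 2
  have hval : (![conormal p₀ 0 / -conormal p₀ 3, conormal p₀ 1 / -conormal p₀ 3,
      conormal p₀ 2 / -conormal p₀ 3] : R3) = p₀ := by
    ext i
    fin_cases i <;> simp [conormal]
  have h1 : ∀ᶠ n : R4 in nhds (conormal p₀),
      (![n 0 / -n 3, n 1 / -n 3, n 2 / -n 3] : R3) ∈ Metric.ball p₀ r :=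
    hc.eventually_mem (by rw [hval]; exact Metric.ball_mem_nhds p₀ hr)
  have h2 : ∀ᶠ n : R4 in nhds (conormal p₀), n 3 ≠ 0 :=
    (continuous_apply 3).continuousAt.eventually_ne (by simp [conormal])
  filter_upwards [h1, h2] with n hn hn3
  refine ⟨-n 3, _, hn, ?_⟩
  ext i
  fin_cases i <;> simp [conormal] <;> field_simp

theorem ContactEquivalent.exists_symbolMatch {X Y : WebClass} {Ω Ω' : Set R3} {l : WebParam X}
    {m : WebParam Y} (hl : IsWebParam X Ω l) (hm : IsWebParam Y Ω' m)
    (h : ContactEquivalent Ω (webPDE X l) Ω' (webPDE Y m)) :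
    ∃ (x y : R3) (L : Mat4), SymbolMatch l x m y L := by
  obtain ⟨x, hx, y, hy, L, hL, p₀, r, hr, hp⟩ := h.exists_linear hl hm
  refine ⟨x, y, L, hx, hy, hL, fun n i j k s => ?_⟩
  have hY : ∀ i j, ContDiff ℝ ω fun n : R4 => conormalForm Y m y (n ᵥ* L⁻¹) i j := fun i j =>
    (contDiff_conormalForm Y m y i j).comp (contDiff_vecMul _)
  have hX : ∀ i j, ContDiff ℝ ω fun n : R4 => (L * conormalForm X l x n * Lᵀ) i j := fun i j => by
    simp only [mul_apply]
    exact ContDiff.sum fun a _ => (ContDiff.sum fun b _ => contDiff_const.mul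
      (contDiff_conormalForm X l x b a)).mul contDiff_const
  -- Proportionality is expressed by analytic minors. Unlike the proportionality factor, these
  -- extend to all `n`, including those where a symbol vanishes.
  set f : R4 → ℝ := fun n => conormalForm Y m y (n ᵥ* L⁻¹) i j *
      (L * conormalForm X l x n * Lᵀ) k s - conormalForm Y m y (n ᵥ* L⁻¹) k s *
      (L * conormalForm X l x n * Lᵀ) i j with hf
  have hfc : ContDiff ℝ ω f := ((hY i j).mul (hX k s)).sub ((hY k s).mul (hX i j))
  have hfa : AnalyticOnNhd ℝ f Set.univ := fun n _ => hfc.contDiffAt.analyticAt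
  have hev : f =ᶠ[nhds (conormal p₀)] 0 := by
    filter_upwards [exists_conormal_smul hr] with n' hn'
    obtain ⟨c, p, hpb, rfl⟩ := hn'
    obtain ⟨κ, hκ⟩ := hp p hpb
    have hpar : Parallel (conormalForm Y m y ((c • conormal p) ᵥ* L⁻¹))
        (L * conormalForm X l x (c • conormal p) * Lᵀ) := by
      rw [smul_vecMul, conormalForm_smul, conormalForm_smul, hκ, mul_smul_comm, smul_mul_assoc,
        smul_comm]
      exact parallel_smul _ _
    exact sub_eq_zero.2 (hpar i j k s)
  exact sub_eq_zero.1 (hfa.eqOn_zero_of_preconnected_of_eventuallyEq_zero isPreconnected_univ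
    (Set.mem_univ _) hev (Set.mem_univ n))

/-- The polynomial whose zeros are the conormals with degenerate symbol. -/
def singularPoly : WebClass → R4 → ℝ
  | .A, n => n 0 * (n 1 * (n 2 * n 3))
  | .B, n => n 0 ^ 2 * (n 2 * n 3)
  | .C, n => n 0 ^ 3 * n 3
  | .D, n => (n 0 ^ 2 + n 1 ^ 2) * (n 2 * n 3)

/-- The form annihilates `n`, so its adjugate is a multiple of `n nᵀ`; the multiple detects further
degeneracy. The third coefficient is fixed by `α + β + γ = 0`. -/
theorem adjugate_conormalFormA (α β : ℝ) (n : R4) :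
    (conormalFormA α β (-α - β) n).adjugate =
      (-2 * (α * β * (-α - β)) * singularPoly .A n) • vecMulVec n n := by
  ext i j
  rw [adjugate_fin_succ_eq_det_submatrix]
  fin_cases i <;> fin_cases j <;>
    simp [det_fin_three, conormalFormA, singularPoly, vecMulVec_apply, Fin.succAbove] <;> ring

theorem adjugate_conormalFormB (μ : ℝ) (n : R4) :
    (conormalFormB μ n).adjugate = (-2 * μ ^ 2 * singularPoly .B n) • vecMulVec n n := by
  ext i j
  rw [adjugate_fin_succ_eq_det_submatrix]
  fin_cases i <;> fin_cases j <;>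
    simp [det_fin_three, conormalFormB, singularPoly, vecMulVec_apply, Fin.succAbove] <;> ring

theorem adjugate_conormalFormC (ε : ℝ) (n : R4) :
    (conormalFormC ε n).adjugate = (-2 * ε * singularPoly .C n) • vecMulVec n n := by
  ext i j
  rw [adjugate_fin_succ_eq_det_submatrix]
  fin_cases i <;> fin_cases j <;>
    simp [det_fin_three, conormalFormC, singularPoly, vecMulVec_apply, Fin.succAbove] <;> ring

theorem adjugate_conormalFormD (κ b : ℝ) (n : R4) :
    (conormalFormD κ b n).adjugate =
      (2 * (b * (κ ^ 2 + b ^ 2)) * singularPoly .D n) • vecMulVec n n := by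
  ext i j
  rw [adjugate_fin_succ_eq_det_submatrix]
  fin_cases i <;> fin_cases j <;>
    simp [det_fin_three, conormalFormD, singularPoly, vecMulVec_apply, Fin.succAbove] <;> ring

end

noncomputable section
open Matrix

/-! ### Correspondence of singular conormals and the distinction of the classes -/

theorem exists_adjugate_conormalForm {X : WebClass} {l : WebParam X} {x : R3}
    (hx : x ∈ nondegLocus X l) : ∃ c : ℝ, c ≠ 0 ∧ ∀ n,
      (conormalForm X l x n).adjugate = (c * singularPoly X n) • vecMulVec n n := by
  cases X
  · obtain ⟨l₁, l₂, l₃⟩ := l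
    obtain ⟨a₁, a₂, a₃⟩ := hx
    refine ⟨-2 * ((l₂ (x 1) - l₃ (x 2)) * (l₃ (x 2) - l₁ (x 0)) * (l₁ (x 0) - l₂ (x 1))),
      mul_ne_zero (by norm_num) (mul_ne_zero (mul_ne_zero (sub_ne_zero.2 a₂)
        (sub_ne_zero.2 a₃.symm)) (sub_ne_zero.2 a₁)), fun n => ?_⟩
    have h := adjugate_conormalFormA (l₂ (x 1) - l₃ (x 2)) (l₃ (x 2) - l₁ (x 0)) n
    rwa [show -(l₂ (x 1) - l₃ (x 2)) - (l₃ (x 2) - l₁ (x 0)) = l₁ (x 0) - l₂ (x 1) by ring] at h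
  · obtain ⟨l₂, l₃⟩ := l
    exact ⟨_, mul_ne_zero (by norm_num) (pow_ne_zero 2 (sub_ne_zero.2 hx)),
      adjugate_conormalFormB _⟩
  · exact ⟨_, mul_ne_zero (by norm_num) (Real.exp_ne_zero _), adjugate_conormalFormC _⟩
  · obtain ⟨L, l₃⟩ := l
    have hb : (L (zCoord x)).im ≠ 0 := hx
    have := sq_pos_of_ne_zero hb
    exact ⟨_, mul_ne_zero two_ne_zero (mul_ne_zero hb (by positivity)),
      adjugate_conormalFormD ((L (zCoord x)).re - l₃ (x 2)) _⟩

section Match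

variable {X Y : WebClass} {l : WebParam X} {x : R3} {m : WebParam Y} {y : R3} {L : Mat4}

/-- Singular conormals with nonzero symbol correspond to singular conormals. -/
theorem SymbolMatch.mul_singularPoly_eq_zero (h : SymbolMatch l x m y L) {n : R4}
    (hn : singularPoly X n = 0) (i j : Fin 4) :
    conormalForm X l x n i j * singularPoly Y (n ᵥ* L⁻¹) = 0 := by
  by_cases hT : conormalForm X l x n = 0
  · rw [hT, Matrix.zero_apply, zero_mul]
  have hLu : IsUnit L.det := Ne.isUnit h.det_ne_zero
  have hT' : L * conormalForm X l x n * Lᵀ ≠ 0 := by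
    intro h0
    apply hT
    have : L⁻¹ * (L * conormalForm X l x n * Lᵀ) * (L⁻¹)ᵀ = conormalForm X l x n := by
      rw [mul_assoc, mul_assoc, ← transpose_mul, nonsing_inv_mul _ hLu, transpose_one, mul_one,
        ← mul_assoc, nonsing_inv_mul _ hLu, one_mul]
    rw [← this, h0]
    simp
  obtain ⟨κ, hκ⟩ := (h.parallel n).exists_smul hT'
  obtain ⟨c, -, hc⟩ := exists_adjugate_conormalForm h.source
  obtain ⟨c', hc', hc''⟩ := exists_adjugate_conormalForm h.target
  have hadj := congrArg adjugate hκ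
  rw [hc'', adjugate_smul, adjugate_mul_distrib, adjugate_mul_distrib, hc, hn, mul_zero, zero_smul,
    zero_mul, mul_zero, smul_zero, smul_eq_zero] at hadj
  rcases hadj with h0 | h0
  · rw [(mul_eq_zero.1 h0).resolve_left hc', mul_zero]
  -- A vanishing square `n nᵀ` of the image conormal forces `n = 0`, where the symbol is zero by
  -- homogeneity.
  · exfalso
    have hz : n ᵥ* L⁻¹ = 0 := by
      ext k
      have := congrFun (congrFun h0 k) k
      rw [vecMulVec_apply] at this
      exact mul_self_eq_zero.1 this
    have hn0 : n = 0 := by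
      rw [← vecMul_one n, ← nonsing_inv_mul _ hLu, ← vecMul_vecMul, hz, zero_vecMul]
    apply hT
    have := conormalForm_smul X l x 0 n
    rw [hn0] at this ⊢
    simpa using this

/-- The coordinate hyperplanes of singular conormals. -/
def singularCoords : WebClass → Finset (Fin 4)
  | .A => {0, 1, 2, 3}
  | .B => {0, 2, 3}
  | .C => {0, 3}
  | .D => {2, 3}

theorem singularPoly_eq_zero_of_mem {X : WebClass} {i : Fin 4} (hi : i ∈ singularCoords X) {n : R4}
    (hn : n i = 0) : singularPoly X n = 0 := by
  cases X
  all_goals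
    simp only [singularCoords, Finset.mem_insert, Finset.mem_singleton] at hi
    rcases hi with rfl | rfl | rfl | rfl <;> simp [singularPoly, hn]

/-- Matching up to scalars says nothing where the symbol vanishes, so each singular hyperplane needs
a conormal with nonzero symbol. -/
theorem exists_conormalForm_ne_zero {X : WebClass} {l : WebParam X} {x : R3}
    (hx : x ∈ nondegLocus X l) {i : Fin 4} (hi : i ∈ singularCoords X) :
    ∃ n : R4, n i = 0 ∧ conormalForm X l x n ≠ 0 := by
  have key : ∀ (n : R4) (j k : Fin 4), n i = 0 → conormalForm X l x n j k ≠ 0 →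
      ∃ n : R4, n i = 0 ∧ conormalForm X l x n ≠ 0 := fun n j k hn hT =>
    ⟨n, hn, fun h0 => hT (by rw [h0, Matrix.zero_apply])⟩
  cases X
  · obtain ⟨l₁, l₂, l₃⟩ := l
    obtain ⟨a₁, a₂, a₃⟩ := hx
    simp only [singularCoords, Finset.mem_insert, Finset.mem_singleton] at hi
    rcases hi with rfl | rfl | rfl | rfl
    · exact key ![0, 1, 1, 0] 0 3 rfl
        (by simpa [conormalForm, conormalFormA, sub_eq_zero] using a₂.symm)
    · exact key ![1, 0, 1, 0] 1 3 rfl (by simpa [conormalForm, conormalFormA, sub_eq_zero] using a₃)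
    · exact key ![1, 1, 0, 0] 2 3 rfl
        (by simpa [conormalForm, conormalFormA, sub_eq_zero] using a₁.symm)
    · exact key ![0, 1, 1, 0] 0 3 rfl
        (by simpa [conormalForm, conormalFormA, sub_eq_zero] using a₂.symm)
  · obtain ⟨l₂, l₃⟩ := l
    have hx' : l₂ (x 1) ≠ l₃ (x 2) := hx
    simp only [singularCoords, Finset.mem_insert, Finset.mem_singleton] at hi
    rcases hi with rfl | rfl | rfl
    · exact key ![0, 1, 1, 0] 0 3 rfl
        (by simpa [conormalForm, conormalFormB, sub_eq_zero] using hx'.symm)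
    · exact key ![1, 0, 0, 0] 2 3 rfl (by simp [conormalForm, conormalFormB])
    · exact key ![1, 0, 0, 0] 2 3 rfl (by simp [conormalForm, conormalFormB])
  · simp only [singularCoords, Finset.mem_insert, Finset.mem_singleton] at hi
    rcases hi with rfl | rfl
    · exact key ![0, 1, 0, 0] 0 3 rfl (by simp [conormalForm, conormalFormC])
    · exact key ![1, 0, 0, 0] 2 3 rfl (by simp [conormalForm, conormalFormC])
  · obtain ⟨L, l₃⟩ := l
    have hb : (L (zCoord x)).im ≠ 0 := hx
    simp only [singularCoords, Finset.mem_insert, Finset.mem_singleton] at hi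
    rcases hi with rfl | rfl
    · exact key ![1, 0, 0, 0] 2 3 rfl (by simpa [conormalForm, conormalFormD] using hb)
    · exact key ![1, 0, 0, 0] 2 3 rfl (by simpa [conormalForm, conormalFormD] using hb)

/-- The coordinate projection onto the common kernel of the coordinates outside `K`. -/
def coordProj (K : Finset (Fin 4)) : Mat4 := diagonal fun k => if k ∈ K then 1 else 0

theorem contDiff_singularPoly (X : WebClass) : ContDiff ℝ ω (singularPoly X) := by
  cases X <;> unfold singularPoly <;> fun_prop

/-- If the singular polynomial vanishes on a linear image, so does one of its real factors. -/
theorem exists_coord_eq_zero_of_singularPoly (P : Mat4)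
    (h : ∀ n : R4, singularPoly X (n ᵥ* P) = 0) :
    (∃ j ∈ singularCoords X, ∀ k, P k j = 0) ∨ X = .D ∧ (∀ k, P k 0 = 0) ∧ ∀ k, P k 1 = 0 := by
  have hc : ∀ j, ContDiff ℝ ω fun n : R4 => (n ᵥ* P) j := fun j =>
    contDiff_pi.1 (contDiff_vecMul P) j
  have hcol : ∀ j, (∀ n : R4, (n ᵥ* P) j = 0) → ∀ k, P k j = 0 := fun j hj k => by
    simpa using hj (Pi.single k 1)
  have hpow : ∀ j (e : ℕ), (∀ n : R4, (n ᵥ* P) j ^ e = 0) → ∀ k, P k j = 0 := fun j e hj =>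
    hcol j fun n => eq_zero_of_pow_eq_zero (hj n)
  cases X
  · rcases eq_zero_or_eq_zero_of_contDiff_omega (hc 0) ((hc 1).mul ((hc 2).mul (hc 3))) h
      with h | h
    · exact Or.inl ⟨0, by simp [singularCoords], hcol 0 h⟩
    rcases eq_zero_or_eq_zero_of_contDiff_omega (hc 1) ((hc 2).mul (hc 3)) h with h | h
    · exact Or.inl ⟨1, by simp [singularCoords], hcol 1 h⟩
    rcases eq_zero_or_eq_zero_of_contDiff_omega (hc 2) (hc 3) h with h | h
    · exact Or.inl ⟨2, by simp [singularCoords], hcol 2 h⟩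
    · exact Or.inl ⟨3, by simp [singularCoords], hcol 3 h⟩
  · rcases eq_zero_or_eq_zero_of_contDiff_omega ((hc 0).pow 2) ((hc 2).mul (hc 3)) h with h | h
    · exact Or.inl ⟨0, by simp [singularCoords], hpow 0 2 h⟩
    rcases eq_zero_or_eq_zero_of_contDiff_omega (hc 2) (hc 3) h with h | h
    · exact Or.inl ⟨2, by simp [singularCoords], hcol 2 h⟩
    · exact Or.inl ⟨3, by simp [singularCoords], hcol 3 h⟩
  · rcases eq_zero_or_eq_zero_of_contDiff_omega ((hc 0).pow 3) (hc 3) h with h | h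
    · exact Or.inl ⟨0, by simp [singularCoords], hpow 0 3 h⟩
    · exact Or.inl ⟨3, by simp [singularCoords], hcol 3 h⟩
  -- Over the reals the factor `n₀² + n₁²` vanishes only if both coordinates do, which gives the
  -- exceptional alternative.
  · rcases eq_zero_or_eq_zero_of_contDiff_omega (((hc 0).pow 2).add ((hc 1).pow 2))
      ((hc 2).mul (hc 3)) h with h | h
    · have h' : ∀ n : R4, (n ᵥ* P) 0 ^ 2 + (n ᵥ* P) 1 ^ 2 = 0 := h
      refine Or.inr ⟨rfl, hpow 0 2 fun n => ?_, hpow 1 2 fun n => ?_⟩ <;>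
        nlinarith [h' n, sq_nonneg ((n ᵥ* P) 0), sq_nonneg ((n ᵥ* P) 1)]
    rcases eq_zero_or_eq_zero_of_contDiff_omega (hc 2) (hc 3) h with h | h
    · exact Or.inl ⟨2, by simp [singularCoords], hcol 2 h⟩
    · exact Or.inl ⟨3, by simp [singularCoords], hcol 3 h⟩

theorem vecMul_coordProj (K : Finset (Fin 4)) (n : R4) :
    n ᵥ* coordProj K = fun k => if k ∈ K then n k else 0 := by
  ext k
  simp [coordProj, vecMul_diagonal]

theorem coordProj_mul_apply (K : Finset (Fin 4)) (P : Mat4) (k j : Fin 4) :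
    (coordProj K * P) k j = if k ∈ K then P k j else 0 := by
  simp [coordProj, diagonal_mul]

/-- A coordinate subspace of singular conormals, on which the symbol does not vanish identically,
is mapped into a component of the singular locus. -/
theorem SymbolMatch.exists_coord (h : SymbolMatch l x m y L) {K : Finset (Fin 4)}
    (hK : ∀ n : R4, (∀ k ∉ K, n k = 0) → singularPoly X n = 0)
    (hT : ∃ n : R4, (∀ k ∉ K, n k = 0) ∧ conormalForm X l x n ≠ 0) :
    (∃ j ∈ singularCoords Y, ∀ k ∈ K, L⁻¹ k j = 0) ∨
      Y = .D ∧ (∀ k ∈ K, L⁻¹ k 0 = 0) ∧ ∀ k ∈ K, L⁻¹ k 1 = 0 := by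
  obtain ⟨n₀, hn₀, hT₀⟩ := hT
  obtain ⟨i, hi⟩ := Function.ne_iff.1 hT₀
  obtain ⟨j, hij⟩ := Function.ne_iff.1 hi
  have hproj : n₀ ᵥ* coordProj K = n₀ := by
    rw [vecMul_coordProj]
    ext k
    by_cases hk : k ∈ K
    · simp [hk]
    · simp [hk, hn₀ k hk]
  have hprod : ∀ n : R4, conormalForm X l x (n ᵥ* coordProj K) i j *
      singularPoly Y (n ᵥ* (coordProj K * L⁻¹)) = 0 := by
    intro n
    rw [← vecMul_vecMul]
    refine h.mul_singularPoly_eq_zero (hK _ fun k hk => ?_) i j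
    rw [vecMul_coordProj]
    simp [hk]
  -- On the subspace the product of a symbol entry with the target polynomial vanishes. The entry is
  -- nonzero at `n₀`, so the polynomial vanishes identically there.
  have hz : ∀ n : R4, singularPoly Y (n ᵥ* (coordProj K * L⁻¹)) = 0 := by
    refine (eq_zero_or_eq_zero_of_contDiff_omega
      ((contDiff_conormalForm X l x i j).comp (contDiff_vecMul (coordProj K)))
      ((contDiff_singularPoly Y).comp (contDiff_vecMul (coordProj K * L⁻¹)))
      hprod).resolve_left fun h0 => hij ?_
    have := h0 n₀
    rw [Function.comp_apply, hproj] at this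
    exact this
  have key : ∀ j, (∀ k, (coordProj K * L⁻¹) k j = 0) → ∀ k ∈ K, L⁻¹ k j = 0 := fun j hj k hk => by
    have := hj k
    rwa [coordProj_mul_apply, if_pos hk] at this
  rcases exists_coord_eq_zero_of_singularPoly _ hz with ⟨j, hj, hj'⟩ | ⟨hY, h0, h1⟩
  · exact Or.inl ⟨j, hj, key j hj'⟩
  · exact Or.inr ⟨hY, key 0 h0, key 1 h1⟩

theorem SymbolMatch.inv_mulVec_ne_zero (h : SymbolMatch l x m y L) {v : R4} (hv : v ≠ 0) :
    L⁻¹ *ᵥ v ≠ 0 := fun h0 => hv (by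
  rw [← one_mulVec v, ← mul_nonsing_inv _ (Ne.isUnit h.det_ne_zero), ← mulVec_mulVec, h0,
    mulVec_zero])

theorem SymbolMatch.exists_inv_apply_ne_zero (h : SymbolMatch l x m y L) (j : Fin 4) :
    ∃ k, L⁻¹ k j ≠ 0 := by
  by_contra! h0
  refine h.inv_mulVec_ne_zero (v := Pi.single j 1) (by simp) ?_
  ext k
  simp [h0]

/-- Two columns of an invertible matrix are not supported at the same index. -/
theorem SymbolMatch.eq_of_column_support (h : SymbolMatch l x m y L) {i j j' : Fin 4}
    (hj : ∀ k ≠ i, L⁻¹ k j = 0) (hj' : ∀ k ≠ i, L⁻¹ k j' = 0) : j = j' := by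
  by_contra hne
  have hi : L⁻¹ i j' ≠ 0 := by
    obtain ⟨k, hk⟩ := h.exists_inv_apply_ne_zero j'
    by_cases hki : k = i
    · rwa [hki] at hk
    · exact absurd (hj' k hki) hk
  refine h.inv_mulVec_ne_zero
    (v := L⁻¹ i j' • Pi.single j 1 - L⁻¹ i j • Pi.single j' 1) (fun h0 => hi ?_) ?_
  · simpa [hne] using congrFun h0 j
  · ext k
    by_cases hk : k = i
    · simp [mulVec_sub, mulVec_smul, hk, mul_comm]
    · simp [mulVec_sub, mulVec_smul, hj k hk, hj' k hk]

/-- Hyperplanes of singular conormals are mapped to hyperplanes of singular conormals. -/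
theorem SymbolMatch.exists_singularCoord (h : SymbolMatch l x m y L) {i : Fin 4}
    (hi : i ∈ singularCoords X) : ∃ j ∈ singularCoords Y, ∀ k ≠ i, L⁻¹ k j = 0 := by
  obtain ⟨n, hn, hT⟩ := exists_conormalForm_ne_zero h.source hi
  rcases h.exists_coord (K := Finset.univ.erase i)
    (fun n hn => singularPoly_eq_zero_of_mem hi (hn i (by simp)))
    ⟨n, fun k hk => by simp at hk; rwa [hk], hT⟩ with ⟨j, hj, hjk⟩ | ⟨-, h0, h1⟩
  · exact ⟨j, hj, fun k hk => hjk k (by simpa using hk)⟩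
  -- A hyperplane cannot be mapped into the codimension two component of D.
  · exact absurd (h.eq_of_column_support (fun k hk => h0 k (by simpa using hk))
      fun k hk => h1 k (by simpa using hk)) (by decide)

theorem SymbolMatch.eq_of_row_support (h : SymbolMatch l x m y L) {i i' j : Fin 4}
    (hi : ∀ k ≠ i, L⁻¹ k j = 0) (hi' : ∀ k ≠ i', L⁻¹ k j = 0) : i = i' := by
  obtain ⟨k, hk⟩ := h.exists_inv_apply_ne_zero j
  exact (not_imp_comm.1 (hi k) hk).symm.trans (not_imp_comm.1 (hi' k) hk)

/-- Distinct source hyperplanes have distinct targets, since a nonzero column of `L⁻¹` cannot be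
supported at two different single rows. -/
theorem SymbolMatch.card_singularCoords_le (h : SymbolMatch l x m y L) :
    (singularCoords X).card ≤ (singularCoords Y).card := by
  choose! f hf hfk using fun i (hi : i ∈ singularCoords X) => h.exists_singularCoord hi
  refine Finset.card_le_card_of_injOn f hf fun i hi i' hi' hii' => ?_
  refine h.eq_of_row_support (hfk i hi) ?_
  rw [hii']
  exact hfk i' hi'

end Match

/-- The hyperplanes `n₂ = 0` and `n₃ = 0` of D use up both hyperplanes of C. The plane `n₀ = n₁ =
0`, also singular with nonzero symbol, lies in neither of the first two and so has no possible
image. -/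
theorem not_symbolMatch_D_C {l : WebParam .D} {x : R3} {m : WebParam .C} {y : R3} {L : Mat4} :
    ¬ SymbolMatch l x m y L := by
  intro h
  obtain ⟨j₂, hj₂, h₂⟩ := h.exists_singularCoord (i := 2) (by decide)
  obtain ⟨j₃, hj₃, h₃⟩ := h.exists_singularCoord (i := 3) (by decide)
  have hne : j₂ ≠ j₃ := fun he => by
    rw [← he] at h₃
    exact absurd (h.eq_of_row_support h₂ h₃) (by decide)
  have hT : ∃ n : R4, (∀ k ∉ ({2, 3} : Finset (Fin 4)), n k = 0) ∧ conormalForm .D l x n ≠ 0 := by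
    obtain ⟨M, l₃⟩ := l
    have hb : (M (zCoord x)).im ≠ 0 := h.source
    refine ⟨![0, 0, 1, 1], fun k hk => ?_, fun h0 => hb ?_⟩
    · fin_cases k <;> simp at hk ⊢
    · simpa [conormalForm, conormalFormD] using congrFun (congrFun h0 0) 0
  rcases h.exists_coord (K := {2, 3})
    (fun n hn => by simp [singularPoly, hn 0 (by decide), hn 1 (by decide)]) hT with
    ⟨j, hj, hK⟩ | ⟨h0, -⟩
  · obtain ⟨k, hk⟩ := h.exists_inv_apply_ne_zero j
    -- Column `j` is supported at row `2` or `3` alone and yet vanishes at both rows, so it would be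
    -- zero.
    have hjj : j = j₂ ∨ j = j₃ := by
      simp only [singularCoords, Finset.mem_insert, Finset.mem_singleton] at hj hj₂ hj₃
      omega
    rcases hjj with rfl | rfl
    · exact hk ((eq_or_ne k 2).elim (fun he => he ▸ hK 2 (by decide)) (h₂ k))
    · exact hk ((eq_or_ne k 3).elim (fun he => he ▸ hK 3 (by decide)) (h₃ k))
  · exact WebClass.noConfusion h0

/-- The class of a web equation is determined by its symbol. -/
theorem SymbolMatch.class_eq {X Y : WebClass} {l : WebParam X} {x : R3} {m : WebParam Y} {y : R3}
    {L : Mat4} (h : SymbolMatch l x m y L) : X = Y := by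
  have hcard := le_antisymm h.card_singularCoords_le h.symm.card_singularCoords_le
  -- The numbers of hyperplanes 4, 3, 2, 2 decide every case except C against D.
  cases X <;> cases Y <;> first
    | rfl
    | exact absurd hcard (by decide)
    | exact absurd h not_symbolMatch_D_C
    | exact absurd h.symm not_symbolMatch_D_C

end

theorem mainTheorem8 :
    -- no equation of one class is, anywhere, locally contact equivalent to one of another class
    (∀ X Y : WebClass, X ≠ Y →
      ∀ (Ω Ω' : Set R3) (l : WebParam X) (m : WebParam Y),
        IsWebParam X Ω l → IsWebParam Y Ω' m →
        ¬ ContactEquivalent Ω (webPDE X l) Ω' (webPDE Y m)) ∧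
    (∀ (X : WebClass) (Ω : Set R3) (l : WebParam X), IsWebParam X Ω l →
      -- the quotient by the equivalence pseudogroup has no functional parameters:
      -- normal forms at every nonflat point,
      (∀ x ∈ Ω, ParamNonflatAt X l x →
        ∃ (Ω' : Set R3) (m : WebParam X), IsWebParam X Ω' m ∧ (0 : R3) ∈ Ω' ∧
          ParamMonomial X m ∧ PseudogroupEquivalent X Ω l x Ω' m 0) ∧
      -- and reduction to identity or constant parameters at the points of an open dense set
      (∃ V : Set R3, IsOpen V ∧ V ⊆ Ω ∧ Ω ⊆ closure V ∧ ∀ x ∈ V,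
        ∃ (Ω' : Set R3) (m : WebParam X) (y : R3), IsWebParam X Ω' m ∧ y ∈ Ω' ∧
          ParamBasic X m ∧ PseudogroupEquivalent X Ω l x Ω' m y) ∧
      -- on the generic stratum everything reduces to `A₀`, `B₀`, `C₀`, `D₀`
      (∀ x ∈ Ω, ParamGenericAt X l x →
        ∃ y ∈ nondegLocus X (stdParam X),
          PseudogroupEquivalent X Ω l x (nondegLocus X (stdParam X)) (stdParam X) y)) := by
  refine ⟨fun X Y hXY Ω Ω' l m hl hm h => ?_, fun X Ω l hl => hasNormalForms hl⟩
  obtain ⟨x, y, L, hL⟩ := ContactEquivalent.exists_symbolMatch hl hm h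
  exact hXY hL.class_eq
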